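/- Let $n\ge 2$, let $a<b$ be real numbers and let $W\colon\mathbb R\to[0,+\infty)$ be such that (W1) $W\in C^2(\mathbb R)$; (W2) $W(a)=W(b)=0$ and $W(s)>0$ for every $s\in(a,b)$; (W3+) there exists $\kappa>0$ such that $W''(s)\ge 2\kappa^2$ for every $s\in\mathbb R\setminus(a,b)$. Set $\sigma:=2\int_a^b\sqrt{W(s)}\,ds$. For $\varepsilon>0$ and $u\in W^{2,1}_{\mathrm{loc}}(\mathbb R^n)\cap W^{1,2}_{\mathrm{loc}}(\mathbb R^n)$ put $$E_\varepsilon(u):=\int_{\mathbb R^n}\Big[\varepsilon|\nabla u|^2+\frac{W(u)}{\varepsilon}\Big]dx,\qquad G_\varepsilon(u):=\int_{\mathbb R^n}\Big[2\varepsilon\Delta u-\frac{W'(u)}{\varepsilon}\Big]^2\Big[\varepsilon|\nabla u|^2+\frac{W(u)}{\varepsilon}\Big]dx,$$ with values in $[0,+\infty]$. Let $\{u_\varepsilon\}_{\varepsilon>0}\subset W^{2,1}_{\mathrm{loc}}(\mathbb R^n)\cap W^{1,2}_{\mathrm{loc}}(\mathbb R^n)$ be a family of radially symmetric functions such that $$\limsup_{\varepsilon\to0^+}\big(E_\varepsilon(u_\varepsilon)+G_\varepsilon(u_\varepsilon)\big)<+\infty,$$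 and let $\mathcal L^n$ denote Lebesgue measure, $\mathcal H^{n-1}$ the $(n-1)$-dimensional Hausdorff measure, $B_r$ the ball of radius $r$ centred at the origin, and $$\mu_\varepsilon:=\frac1\sigma\Big[\varepsilon|\nabla u_\varepsilon|^2+\frac{W(u_\varepsilon)}{\varepsilon}\Big]\mathcal L^n,\qquad \xi_\varepsilon:=\Big[\varepsilon|\nabla u_\varepsilon|^2-\frac{W(u_\varepsilon)}{\varepsilon}\Big]\mathcal L^n .$$ Then for every sequence $\varepsilon_k\to0^+$ there exist an at most countable index set $I$ and a family of radii $\{r_i\}_{i\in I}\subset(0,+\infty)$ with $$\sum_{i\in I}r_i^{\,n-1}<+\infty$$ such that, along a subsequence of $\{\varepsilon_k\}$, $$\mu_{\varepsilon_k}\overset{*}{\rightharpoonup}\sum_{i\in I}\mathcal H^{n-1}\llcorner\partial B_{r_i}\quad\text{in duality with } C_0(\mathbb R^n\setminus\{0\}).$$ Moreover, for the whole family, as $\varepsilon\to0^+$, $$\xi_\varepsilon\overset{*}{\rightharpoonup}0\quad\text{in duality with } C_0(\mathbb R^n\setminus\{0\}).$$ Here $C_0(\mathbb R^n\setminus\{0\})$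 is the space of continuous real functions on the locally compact space $\mathbb R^n\setminus\{0\}$ that vanish at infinity (that is, that tend to $0$ both as $x\to0$ and as $|x|\to+\infty$). -/

import Mathlib

open MeasureTheory Filter Topology Set
open scoped ENNReal ZeroAtInfty

noncomputable section

namespace AllenCahn

/-- The Euclidean space `ℝⁿ`. -/
abbrev Space (n : ℕ) : Type := EuclideanSpace ℝ (Fin n)

/-- The punctured space `ℝⁿ \ {0}`, with the subspace topology. -/
abbrev Punctured (n : ℕ) : Type := ↥(({0} : Set (Space n))ᶜ)

/-! ### Potentials -/

/-- `W : ℝ → [0, +∞)` is of class `C²`, `a < b`, `W(a) = W(b) = 0`, `W > 0` on `(a, b)`, and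
there is `κ > 0` with `W'' ≥ 2 κ²` on `ℝ \ (a, b)`. -/
structure IsDoubleWell (W : ℝ → ℝ) (a b : ℝ) : Prop where
  nonneg : ∀ s, 0 ≤ W s
  contDiff : ContDiff ℝ 2 W
  lt : a < b
  left_zero : W a = 0
  right_zero : W b = 0
  pos : ∀ s ∈ Ioo a b, 0 < W s
  convex_outside : ∃ κ : ℝ, 0 < κ ∧ ∀ s ∉ Ioo a b, 2 * κ ^ 2 ≤ deriv (deriv W) s

/-- The constant `σ = 2 ∫ₐᵇ √W`. -/
def surfaceTension (W : ℝ → ℝ) (a b : ℝ) : ℝ := 2 * ∫ s in a..b, √(W s)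

/-! ### Weak derivatives and local Sobolev spaces -/

/-- `f ∈ L^p_loc(ℝⁿ)`. -/
def MemLpLoc {n : ℕ} (p : ℝ≥0∞) (f : Space n → ℝ) : Prop :=
  ∀ K : Set (Space n), IsCompact K → MemLp f p (volume.restrict K)

/-- `v` is the weak (distributional) partial derivative `∂ᵢ u`, both functions being in
`L^1_loc(ℝⁿ)`: `∫ u ∂ᵢφ = - ∫ v φ` for all test functions `φ ∈ C_c^∞(ℝⁿ)`. -/
def HasWeakPartial {n : ℕ} (i : Fin n) (u v : Space n → ℝ) : Prop :=
  LocallyIntegrable u ∧ LocallyIntegrable v ∧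
    ∀ φ : Space n → ℝ, ContDiff ℝ ((⊤ : ℕ∞) : WithTop ℕ∞) φ → HasCompactSupport φ →
      ∫ x, u x * fderiv ℝ φ x (EuclideanSpace.single i 1) = - ∫ x, v x * φ x

/-- `u ∈ W^{k,p}_loc(ℝⁿ)`: all weak partial derivatives of order at most `k` exist and belong to
`L^p_loc(ℝⁿ)`. -/
def MemSobolevLoc {n : ℕ} (p : ℝ≥0∞) : ℕ → (Space n → ℝ) → Prop
  | 0, u => MemLpLoc p u
  | k + 1, u => MemLpLoc p u ∧ ∀ i : Fin n, ∃ v, HasWeakPartial i u v ∧ MemSobolevLoc p k v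

open Classical in
/-- The weak partial derivative `∂ᵢ u` (unique up to null sets; `0` if there is none). -/
def weakPartial {n : ℕ} (i : Fin n) (u : Space n → ℝ) : Space n → ℝ :=
  if h : ∃ v, HasWeakPartial i u v then h.choose else 0

/-- The weak gradient `∇u`. -/
def weakGrad {n : ℕ} (u : Space n → ℝ) (x : Space n) : Space n :=
  WithLp.toLp 2 (fun i => weakPartial i u x)

/-- The weak Laplacian `Δu = ∑ᵢ ∂ᵢ∂ᵢ u`. -/
def weakLaplacian {n : ℕ} (u : Space n → ℝ) (x : Space n) : ℝ :=
  ∑ i, weakPartial i (weakPartial i u) x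

/-- `u` is radially symmetric: `u(x) = û(|x|)`. Elements of Sobolev spaces are functions up to null
sets, hence the identity is required for almost every `x`. -/
def IsRadial {n : ℕ} (u : Space n → ℝ) : Prop :=
  ∃ w : ℝ → ℝ, ∀ᵐ x : Space n, u x = w ‖x‖

/-! ### The functionals and the measures -/

/-- The energy density `ε |∇u|² + W(u) / ε`. -/
def energyDensity {n : ℕ} (W : ℝ → ℝ) (ε : ℝ) (u : Space n → ℝ) (x : Space n) : ℝ :=
  ε * ‖weakGrad u x‖ ^ 2 + W (u x) / ε

/-- The discrepancy density `ε |∇u|² - W(u) / ε`. -/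
def discrepancyDensity {n : ℕ} (W : ℝ → ℝ) (ε : ℝ) (u : Space n → ℝ) (x : Space n) : ℝ :=
  ε * ‖weakGrad u x‖ ^ 2 - W (u x) / ε

/-- `E_ε(u, ℝⁿ) = ∫ (ε |∇u|² + W(u) / ε) dx ∈ [0, +∞]`. -/
def energy {n : ℕ} (W : ℝ → ℝ) (ε : ℝ) (u : Space n → ℝ) : ℝ≥0∞ :=
  ∫⁻ x, ENNReal.ofReal (energyDensity W ε u x)

/-- `G_ε(u, ℝⁿ) = ∫ (2 ε Δu - W'(u) / ε)² (ε |∇u|² + W(u) / ε) dx ∈ [0, +∞]`. -/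
def willmore {n : ℕ} (W : ℝ → ℝ) (ε : ℝ) (u : Space n → ℝ) : ℝ≥0∞ :=
  ∫⁻ x, ENNReal.ofReal
    ((2 * ε * weakLaplacian u x - deriv W (u x) / ε) ^ 2 * energyDensity W ε u x)

/-- The normalized energy measure `μ_ε = σ⁻¹ (ε |∇u|² + W(u) / ε) ℒⁿ`. -/
def energyMeasure {n : ℕ} (W : ℝ → ℝ) (a b ε : ℝ) (u : Space n → ℝ) : Measure (Space n) :=
  volume.withDensity fun x =>
    ENNReal.ofReal ((surfaceTension W a b)⁻¹ * energyDensity W ε u x)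

/-- `∑ᵢ ℋ^{n-1} ⌞ ∂B_{rᵢ}`, where `ℋ^{n-1}` is the Hausdorff measure with the usual normalization
(the one that agrees with Lebesgue measure on `ℝ^{n-1}`). -/
def sphereSum {n : ℕ} {I : Type} (r : I → ℝ) : Measure (Space n) :=
  Measure.sum fun i =>
    (Measure.euclideanHausdorffMeasure (n - 1)).restrict (Metric.sphere (0 : Space n) (r i))

/-! ### Weak* convergence in duality with `C₀(ℝⁿ \ {0})` -/

/-- Weak* convergence, on `ℝⁿ \ {0}` and in duality with `C₀(ℝⁿ \ {0})`, of the measures `m k` to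
the measure `m'` along the filter `l`. All the pairings are required to make sense, for the measures
`m k` eventually along `l`. -/
def WeakStarTendsto {n : ℕ} {ι : Type*} (m : ι → Measure (Space n)) (l : Filter ι)
    (m' : Measure (Space n)) : Prop :=
  ∀ φ : C₀(Punctured n, ℝ),
    (∀ᶠ k in l, Integrable φ ((m k).comap ((↑) : Punctured n → Space n))) ∧
    Integrable φ (m'.comap ((↑) : Punctured n → Space n)) ∧
    Tendsto (fun k => ∫ x, φ x ∂((m k).comap ((↑) : Punctured n → Space n))) l
      (𝓝 (∫ x, φ x ∂(m'.comap ((↑) : Punctured n → Space n))))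

/-- Weak* convergence to `0`, on `ℝⁿ \ {0}` and in duality with `C₀(ℝⁿ \ {0})`, of the signed
measures `f k ℒⁿ` along the filter `l`. The densities `f k` are required to be integrable (so that
`f k ℒⁿ` is a finite signed measure) eventually along `l`. -/
def DensityWeakStarTendstoZero {n : ℕ} {ι : Type*} (f : ι → Space n → ℝ) (l : Filter ι) : Prop :=
  (∀ᶠ k in l, Integrable (f k)) ∧
  ∀ φ : C₀(Punctured n, ℝ),
    Tendsto (fun k => ∫ x, φ x * f k x ∂(volume.comap ((↑) : Punctured n → Space n))) l (𝓝 0)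

end AllenCahn

end

/-!
The idea is to reduce to ordinary differential equations on `(0, ∞)`. In polar coordinates a radial
function of class `W^{2,1}_loc` is a `C¹` function `w` of `r = |x|` with absolutely continuous
derivative (`MemSobolevLoc.exists_isRadialProfile`); this follows by testing the weak derivatives
with radial fields and integrating the resulting weak derivatives in one variable
(`HasWeakDeriv.ae_eq`). With `p = ε w'`, the function `w` solves
`p' = H / 2 + W'(w) / (2 ε) - (n - 1) p / r`, where `H` is the spherical mean of
`2 ε Δu - W'(u) / ε`. On a compact interval of `(0, ∞)` the weight `r ^ (n - 1)` is bounded from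
below, so that the bounds on `E_ε` and `G_ε` give `∫ (p² + W(w)) ≤ C ε` and
`∫ |H| √(p² + W(w)) ≤ C √ε` (`IsRadialProfile.isProfile`).

The heart of the matter is `IsDoubleWell.exists_quantization`, for such solutions on an interval.
* The terms with `W'` cancel in the derivative of `p² - W(w)`, which is therefore uniformly of order
  `√ε`. Testing the equation with functions `ψ(w)` that are adapted to the convexity of `W` outside
  `(a, b)` shows that there is little energy where `w` is close to the wells or outside `[a, b]`.
  Together these two facts give the equipartition of energy, `∫ |p² - W(w)| / ε → 0`.
* Let `ρ` be a cutoff that vanishes near the wells and outside `[a, b]`, put `s = 2 ∫ₐᵇ ρ √W`, and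
  let `Φ` be the primitive of `2 ρ √W` that vanishes at `a`. Up to small errors, the vector
  `(cos (π Φ(w) / s), sin (π Φ(w) / s) p / √W)` rotates with angular velocity `2 π ρ(w) W(w) / (s ε)`,
  which by equipartition is close to `π / s` times the energy density, in the mean. At points where
  `w` is close to a well the second component vanishes, so that the angle swept between two such
  points is close to an integer multiple of `π` (`IsProfile.abs_sin_le`); that is, the energy between
  them is close to an integer multiple of `σ = 2 ∫ₐᵇ √W`, as `s` is close to `σ`.

Along a subsequence `W(w)` tends to `0` almost everywhere. Hence the normalized energy between two
points of a suitable dense sequence has an integer limit (`IsDoubleWell.exists_hasIntegerLimit`),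
and the limit measure on `(0, ∞)` is a sum of unit masses, at the quantiles of its distribution
function (`HasIntegerLimit.tendsto_integral_Ioi`). The bound on the total mass gives the summability
of `r_i ^ (n - 1)`. To return to `ℝⁿ`, the cone measure on the unit sphere, with respect to which
polar coordinates are taken, is identified with the Hausdorff measure
(`toSphere_eq_euclideanHausdorffMeasure`), by comparing small pieces of the sphere with their central
projections to tangent planes.
-/

namespace AllenCahn

/-! ### Absolutely continuous functions of one variable -/

/-- `f` is absolutely continuous on `[A, B]` with (almost everywhere) derivative `f'`: it is the
indefinite integral of the integrable function `f'`. -/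
def IsPrimitiveOn (f f' : ℝ → ℝ) (A B : ℝ) : Prop :=
  IntervalIntegrable f' volume A B ∧ ∀ r ∈ Icc A B, f r = f A + ∫ t in A..r, f' t

namespace IsPrimitiveOn

variable {f f' g g' : ℝ → ℝ} {A B : ℝ}

theorem mono (hf : IsPrimitiveOn f f' A B) {A' B' : ℝ} (h1 : A ≤ A') (h2 : A' ≤ B') (h3 : B' ≤ B) :
    IsPrimitiveOn f f' A' B' := by
  have hsub : ∀ x y, A ≤ x → x ≤ y → y ≤ B → IntervalIntegrable f' volume x y := fun x y hx hxy hy =>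
    hf.1.mono_set (by rw [uIcc_of_le hxy, uIcc_of_le (by linarith)]; exact Icc_subset_Icc hx hy)
  refine ⟨hsub _ _ h1 h2 h3, fun r hr => ?_⟩
  rw [hf.2 r ⟨h1.trans hr.1, hr.2.trans h3⟩, hf.2 A' ⟨h1, h2.trans h3⟩, add_assoc,
    intervalIntegral.integral_add_adjacent_intervals (hsub _ _ le_rfl h1 (h2.trans h3))
      (hsub _ _ h1 hr.1 (hr.2.trans h3))]

theorem sub_eq (hf : IsPrimitiveOn f f' A B) {r s : ℝ} (hr : A ≤ r) (hrs : r ≤ s) (hs : s ≤ B) :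
    f s - f r = ∫ t in r..s, f' t := by
  rw [(hf.mono hr hrs hs).2 s ⟨hrs, le_rfl⟩]; ring

theorem continuousOn (hf : IsPrimitiveOn f f' A B) (hAB : A ≤ B) : ContinuousOn f (Icc A B) := by
  have := intervalIntegral.continuousOn_primitive_interval
    (f := f') (μ := volume) (a := A) (b := B) (by
      have := (intervalIntegrable_iff_integrableOn_Icc_of_le hAB).1 hf.1
      rwa [uIcc_of_le hAB])
  rw [uIcc_of_le hAB] at this
  exact (continuousOn_const.add this).congr hf.2

theorem of_hasDerivAt (h : ∀ r ∈ Icc A B, HasDerivAt f (f' r) r) (hc : ContinuousOn f' (Icc A B))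
    (hAB : A ≤ B) : IsPrimitiveOn f f' A B := by
  refine ⟨ContinuousOn.intervalIntegrable (by rwa [uIcc_of_le hAB]), fun r hr => ?_⟩
  rw [intervalIntegral.integral_eq_sub_of_hasDerivAt (f := f)]
  · ring
  · intro x hx
    rw [uIcc_of_le hr.1] at hx
    exact h x ⟨hx.1, hx.2.trans hr.2⟩
  · apply ContinuousOn.intervalIntegrable
    rw [uIcc_of_le hr.1]
    exact hc.mono (Icc_subset_Icc_right hr.2)

theorem sub (hf : IsPrimitiveOn f f' A B) (hg : IsPrimitiveOn g g' A B) :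
    IsPrimitiveOn (fun r => f r - g r) (fun r => f' r - g' r) A B := by
  refine ⟨hf.1.sub hg.1, fun r hr => ?_⟩
  have hAB : A ≤ B := hr.1.trans hr.2
  have hs : uIcc A r ⊆ uIcc A B := by
    rw [uIcc_of_le hr.1, uIcc_of_le hAB]; exact Icc_subset_Icc_right hr.2
  rw [intervalIntegral.integral_sub (hf.1.mono_set hs) (hg.1.mono_set hs)]
  simp only [hf.2 r hr, hg.2 r hr]
  ring

/-- Leibniz rule for absolutely continuous functions. -/
theorem mul (hf : IsPrimitiveOn f f' A B) (hg : IsPrimitiveOn g g' A B) (hAB : A ≤ B) :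
    IsPrimitiveOn (fun r => f r * g r) (fun r => f' r * g r + f r * g' r) A B := by
  have hfc := hf.continuousOn hAB
  have hgc := hg.continuousOn hAB
  rw [← uIcc_of_le hAB] at hfc hgc
  refine ⟨(hf.1.mul_continuousOn hgc).add (hg.1.continuousOn_mul hfc), fun r hr => ?_⟩
  have hf1 := hf.mono le_rfl hr.1 hr.2
  have hg1 := hg.mono le_rfl hr.1 hr.2
  let F : ℝ → ℝ := fun x => f A + ∫ t in A..x, f' t
  let G : ℝ → ℝ := fun x => g A + ∫ t in A..x, g' t
  have hconst : ∀ c : ℝ, AbsolutelyContinuousOnInterval (fun _ : ℝ => c) A r := fun c =>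
    (contDiff_const.contDiffOn).absolutelyContinuousOnInterval
  have hF : AbsolutelyContinuousOnInterval F A r :=
    (hconst (f A)).add (hf1.1.absolutelyContinuousOnInterval_intervalIntegral (c := A) (by simp))
  have hG : AbsolutelyContinuousOnInterval G A r :=
    (hconst (g A)).add (hg1.1.absolutelyContinuousOnInterval_intervalIntegral (c := A) (by simp))
  have key := hF.integral_deriv_mul_eq_sub hG
  have hcongr : ∫ x in A..r, deriv F x * G x + F x * deriv G x
      = ∫ x in A..r, f' x * g x + f x * g' x := by
    apply intervalIntegral.integral_congr_ae
    filter_upwards [hf1.1.ae_hasDerivAt_integral, hg1.1.ae_hasDerivAt_integral] with x hx1 hx2 hx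
    have hx' : x ∈ uIcc A r := uIoc_subset_uIcc hx
    have hd1 : deriv F x = f' x := ((hx1 hx' A (by simp)).const_add (f A)).deriv
    have hd2 : deriv G x = g' x := ((hx2 hx' A (by simp)).const_add (g A)).deriv
    rw [uIcc_of_le hr.1] at hx'
    rw [hd1, hd2, hf1.2 x hx', hg1.2 x hx']
  rw [← hcongr, key]
  have e1 : F r = f r := (hf.2 r hr).symm
  have e2 : G r = g r := (hg.2 r hr).symm
  have e3 : F A = f A := by simp [F]
  have e4 : G A = g A := by simp [G]
  rw [e1, e2, e3, e4]; ring

theorem congr_deriv (hf : IsPrimitiveOn f f' A B) (h : ∀ r ∈ Icc A B, f' r = g' r)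
    (hAB : A ≤ B) : IsPrimitiveOn f g' A B := by
  refine ⟨hf.1.congr ?_, fun r hr => ?_⟩
  · intro x hx
    exact h x (by rw [uIoc_of_le hAB] at hx; exact ⟨hx.1.le, hx.2⟩)
  · rw [hf.2 r hr]
    congr 1
    apply intervalIntegral.integral_congr
    intro x hx
    rw [uIcc_of_le hr.1] at hx
    exact h x ⟨hx.1, hx.2.trans hr.2⟩

end IsPrimitiveOn

end AllenCahn

namespace AllenCahn

/-! ### Test functions of the order parameter -/

theorem hasDerivAt_max_zero_sq (x : ℝ) :
    HasDerivAt (fun y : ℝ => (max y 0) ^ 2) (2 * max x 0) x := by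
  rcases lt_trichotomy x 0 with h | h | h
  · have : (fun y : ℝ => (max y 0) ^ 2) =ᶠ[𝓝 x] fun _ => 0 := by
      filter_upwards [Iio_mem_nhds h] with y hy
      simp [max_eq_right (le_of_lt (mem_Iio.1 hy))]
    simpa [max_eq_right h.le] using (hasDerivAt_const x (0 : ℝ)).congr_of_eventuallyEq this
  · subst h
    rw [hasDerivAt_iff_isLittleO]
    have h2 : (fun y : ℝ => y ^ 2) =o[𝓝 0] fun y : ℝ => y := by
      simpa using Asymptotics.isLittleO_pow_id (𝕜 := ℝ) (n := 2) (by norm_num)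
    refine (Asymptotics.IsBigO.of_bound 1 ?_).trans_isLittleO (by simpa using h2)
    filter_upwards with y
    simp only [max_self, ne_eq, OfNat.ofNat_ne_zero, not_false_eq_true, zero_pow, sub_zero,
      mul_zero, smul_zero, one_mul, Real.norm_eq_abs, abs_pow, sq_abs]
    rcases le_total y 0 with hy | hy
    · simp [max_eq_right hy, sq_nonneg]
    · simp [max_eq_left hy]
  · have : (fun y : ℝ => (max y 0) ^ 2) =ᶠ[𝓝 x] fun y => y ^ 2 := by
      filter_upwards [Ioi_mem_nhds h] with y hy
      simp [max_eq_left (le_of_lt (mem_Ioi.1 hy))]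
    simpa [max_eq_left h.le] using (hasDerivAt_pow 2 x).congr_of_eventuallyEq this

/-- A function that vanishes at `a` and decreases before, increases after `a` is nonnegative. -/
theorem nonneg_of_deriv_mul_sub_nonneg {f f' : ℝ → ℝ} {a c : ℝ}
    (hf : ∀ s, HasDerivAt f (f' s) s) (h0 : f a = 0) (hac : a ≤ c) (h : ∀ s ≤ c, 0 ≤ f' s * (s - a)) :
    ∀ s ≤ c, 0 ≤ f s := by
  intro s hs
  have hcont : Continuous f := continuous_iff_continuousAt.2 fun x => (hf x).continuousAt
  rcases le_total a s with has | has
  · have := monotoneOn_of_deriv_nonneg (convex_Icc a s) hcont.continuousOn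
      (fun x _ => (hf x).differentiableAt.differentiableWithinAt) (fun x hx => by
        rw [interior_Icc] at hx
        rw [(hf x).deriv]
        exact nonneg_of_mul_nonneg_left (h x (hx.2.le.trans hs)) (sub_pos.2 hx.1))
    simpa [h0] using this ⟨le_rfl, has⟩ ⟨has, le_rfl⟩ has
  · have := antitoneOn_of_deriv_nonpos (convex_Icc s a) hcont.continuousOn
      (fun x _ => (hf x).differentiableAt.differentiableWithinAt) (fun x hx => by
        rw [interior_Icc] at hx
        rw [(hf x).deriv]
        by_contra! hpos
        nlinarith [hx.2, h x (hx.2.le.trans hac)])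
    simpa [h0] using this ⟨le_rfl, has⟩ ⟨has, le_rfl⟩ has

/-- Near a nondegenerate well `a`, and on the whole half-line beyond it, a potential dominates a
parabola, and it is convex in the sense that `W ≤ W' · (s - a)`. -/
theorem exists_well_convexity {W : ℝ → ℝ} (hC : ContDiff ℝ 2 W) (hnn : ∀ s, 0 ≤ W s) {a : ℝ}
    (h0 : W a = 0) (hκ : ∃ κ : ℝ, 0 < κ ∧ ∀ s ≤ a, 2 * κ ^ 2 ≤ deriv (deriv W) s) :
    ∃ η > 0, ∃ K > 0, ∀ s ≤ a + η, (s - a) ^ 2 ≤ K * W s ∧ W s ≤ deriv W s * (s - a) := by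
  obtain ⟨κ, hκ0, hκ⟩ := hκ
  have hd1 : ∀ s, HasDerivAt W (deriv W s) s := fun s =>
    ((hC.differentiable (by norm_num)) s).hasDerivAt
  have hC1 : ContDiff ℝ 1 (deriv W) := by
    have : ContDiff ℝ (1 + 1) W := by simpa [one_add_one_eq_two] using hC
    exact (contDiff_succ_iff_deriv.1 this).2.2
  have hd2 : ∀ s, HasDerivAt (deriv W) (deriv (deriv W) s) s := fun s =>
    ((hC1.differentiable (by norm_num)) s).hasDerivAt
  have hc2 : Continuous (deriv (deriv W)) := hC1.continuous_deriv (by norm_num)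
  have hda : deriv W a = 0 :=
    IsLocalMin.deriv_eq_zero (Eventually.of_forall fun s => by rw [h0]; exact hnn s)
  have hκ2 : 0 < κ ^ 2 := by positivity
  obtain ⟨η, hη, hηκ⟩ : ∃ η > 0, ∀ s ≤ a + η, κ ^ 2 ≤ deriv (deriv W) s := by
    have : ∀ᶠ s in 𝓝 a, κ ^ 2 < deriv (deriv W) s :=
      hc2.continuousAt.eventually (lt_mem_nhds (by linarith [hκ a le_rfl]))
    obtain ⟨δ, hδ, h⟩ := Metric.eventually_nhds_iff.1 this
    refine ⟨δ / 2, by positivity, fun s hs => ?_⟩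
    rcases le_total s a with hsa | hsa
    · linarith [hκ s hsa]
    · exact (h (by rw [Real.dist_eq, abs_of_nonneg (by linarith)]; linarith)).le
  have hac : a ≤ a + η := by linarith
  have hsq : ∀ s, HasDerivAt (fun s : ℝ => (s - a) ^ 2) (2 * (s - a)) s := fun s => by
    have := ((hasDerivAt_id' s).sub_const a).fun_pow 2
    simpa using this
  -- the derivative `W'` lies on the correct side of its tangent with slope `κ ^ 2`
  have hl : ∀ s ≤ a + η, 0 ≤ (deriv W s - κ ^ 2 * (s - a)) * (s - a) := by
    have hl' : ∀ s, HasDerivAt (fun s => deriv W s - κ ^ 2 * (s - a))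
        (deriv (deriv W) s - κ ^ 2) s := fun s => by
      have := (hd2 s).fun_sub (((hasDerivAt_id' s).sub_const a).const_mul (κ ^ 2))
      simpa using this
    have hmono : MonotoneOn (fun s => deriv W s - κ ^ 2 * (s - a)) (Iic (a + η)) :=
      monotoneOn_of_deriv_nonneg (convex_Iic _)
        (continuous_iff_continuousAt.2 fun x => (hl' x).continuousAt).continuousOn
        (fun x _ => (hl' x).differentiableAt.differentiableWithinAt) (fun x hx => by
          rw [interior_Iic] at hx
          rw [(hl' x).deriv]
          linarith [hηκ x hx.le])
    intro s hs
    rcases le_total a s with has | has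
    · have := hmono (show a ∈ Iic (a + η) from hac) hs has
      simp only [hda, sub_self, mul_zero] at this
      exact mul_nonneg this (by linarith)
    · have := hmono hs (show a ∈ Iic (a + η) from hac) has
      simp only [hda, sub_self, mul_zero] at this
      exact mul_nonneg_of_nonpos_of_nonpos this (by linarith)
  have h1 : ∀ s ≤ a + η, 0 ≤ W s - κ ^ 2 / 2 * (s - a) ^ 2 :=
    nonneg_of_deriv_mul_sub_nonneg (a := a)
      (fun s => (hd1 s).sub ((hsq s).const_mul (κ ^ 2 / 2))) (by simp [h0]) hac (fun s hs => by
        have := hl s hs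
        nlinarith)
  have h2 : ∀ s ≤ a + η, 0 ≤ deriv W s * (s - a) - W s :=
    nonneg_of_deriv_mul_sub_nonneg (a := a)
      (fun s => ((hd2 s).mul ((hasDerivAt_id s).sub_const a)).sub (hd1 s)) (by simp [h0]) hac
      (fun s hs => by
        have h3 := hηκ s hs
        simp only [id, mul_one]
        have : (deriv (deriv W) s * (s - a) + deriv W s - deriv W s) * (s - a)
          = deriv (deriv W) s * (s - a) ^ 2 := by ring
        rw [this]
        exact mul_nonneg (hκ2.le.trans h3) (sq_nonneg _))
  refine ⟨η, hη, 2 / κ ^ 2, by positivity, fun s hs => ⟨?_, by linarith [h2 s hs]⟩⟩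
  have := h1 s hs
  rw [div_mul_eq_mul_div, le_div_iff₀ hκ2]
  linarith

/-- A test function adapted to one well. It is the function `s - a`, cut off logarithmically to the
right of `a`; the logarithmic cutoff keeps the derivative of the test function above `- τ`. -/
theorem exists_well_test {W : ℝ → ℝ} (hC : ContDiff ℝ 2 W) (hnn : ∀ s, 0 ≤ W s) {a : ℝ}
    (h0 : W a = 0) (hκ : ∃ κ : ℝ, 0 < κ ∧ ∀ s ≤ a, 2 * κ ^ 2 ≤ deriv (deriv W) s)
    {τ η : ℝ} (hτ : 0 < τ) (hη : 0 < η) :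
    ∃ δ > 0, ∃ χ ψ ψ' : ℝ → ℝ, Continuous χ ∧ Continuous ψ' ∧ (∀ s, HasDerivAt ψ (ψ' s) s) ∧
      (∀ s, 0 ≤ χ s) ∧ (∀ s, a + η ≤ s → χ s = 0) ∧ (∀ s ≤ a + δ, 1 / 2 < χ s) ∧
      (∀ s, χ s - τ ≤ ψ' s) ∧ (∀ s, W s * χ s ≤ deriv W s * ψ s) ∧
      ∃ K, 0 ≤ K ∧ ∀ s, |ψ s| ≤ K * √(W s) := by
  obtain ⟨η₀, hη₀, K, hK, hconv⟩ := exists_well_convexity hC hnn h0 hκ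
  set t : ℝ := τ / 4 with ht
  have ht0 : 0 < t := by positivity
  set η₁ := min η η₀ with hη₁
  have hη₁0 : 0 < η₁ := lt_min hη hη₀
  -- the inner scale, exponentially small with respect to the outer scale `η₁`
  set d : ℝ := η₁ * Real.exp (-(1 / (2 * t))) with hd
  have hd0 : 0 < d := by positivity
  let X : ℝ → ℝ := fun s => (max (s - a) 0) ^ 2
  let L : ℝ → ℝ := fun s => Real.log (1 + X s / d ^ 2)
  let M : ℝ → ℝ := fun s => max (1 - t * L s) 0
  let χ : ℝ → ℝ := fun s => (M s) ^ 2
  let ψ : ℝ → ℝ := fun s => (s - a) * χ s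
  let L' : ℝ → ℝ := fun s => (2 * max (s - a) 0 / d ^ 2) / (1 + X s / d ^ 2)
  let ψ' : ℝ → ℝ := fun s => 1 * χ s + (s - a) * (2 * M s * (-(t * L' s)))
  have hXd : ∀ s, HasDerivAt X (2 * max (s - a) 0) s := fun s => by
    have := (hasDerivAt_max_zero_sq (s - a)).comp s ((hasDerivAt_id' s).sub_const a)
    rw [mul_one] at this
    exact this
  have hX0 : ∀ s, 0 ≤ X s := fun s => sq_nonneg _
  have hpos : ∀ s, 0 < 1 + X s / d ^ 2 := fun s => by have := hX0 s; positivity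
  have hLd : ∀ s, HasDerivAt L (L' s) s := fun s =>
    (((hXd s).div_const (d ^ 2)).const_add 1).log (hpos s).ne'
  have hL0 : ∀ s, 0 ≤ L s := fun s =>
    Real.log_nonneg (by have := hX0 s; linarith [show 0 ≤ X s / d ^ 2 by positivity])
  have hχd : ∀ s, HasDerivAt χ (2 * M s * (-(t * L' s))) s := fun s => by
    have h1 : HasDerivAt (fun s => 1 - t * L s) (-(t * L' s)) s := by
      simpa using ((hLd s).const_mul t).const_sub 1
    exact (hasDerivAt_max_zero_sq (1 - t * L s)).comp s h1
  have hψd : ∀ s, HasDerivAt ψ (ψ' s) s := fun s => ((hasDerivAt_id s).sub_const a).mul (hχd s)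
  have hXc : Continuous X := continuous_iff_continuousAt.2 fun s => (hXd s).continuousAt
  have hLc : Continuous L := continuous_iff_continuousAt.2 fun s => (hLd s).continuousAt
  have hχc : Continuous χ := continuous_iff_continuousAt.2 fun s => (hχd s).continuousAt
  have hMc : Continuous M := by fun_prop
  have hL'c : Continuous L' := by
    refine Continuous.div (by fun_prop) (by fun_prop) fun s => (hpos s).ne'
  have hM0 : ∀ s, 0 ≤ M s := fun s => le_max_right _ _
  have hM1 : ∀ s, M s ≤ 1 := fun s => max_le (by nlinarith [hL0 s]) zero_le_one
  have hχ0 : ∀ s, 0 ≤ χ s := fun s => sq_nonneg _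
  have hχ1 : ∀ s, χ s ≤ 1 := fun s => pow_le_one₀ (hM0 s) (hM1 s)
  have hχout : ∀ s, a + η₁ ≤ s → χ s = 0 := by
    intro s hs
    have h1 : 1 ≤ t * L s := by
      have h2 : Real.exp (1 / t) ≤ 1 + X s / d ^ 2 := by
        have h3 : η₁ ^ 2 ≤ X s := by
          have : η₁ ≤ max (s - a) 0 := le_max_of_le_left (by linarith)
          exact pow_le_pow_left₀ hη₁0.le this 2
        have h4 : Real.exp (1 / t) = η₁ ^ 2 / d ^ 2 := by
          rw [hd, mul_pow, ← Real.exp_nat_mul, eq_div_iff (by positivity), mul_left_comm,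
            ← Real.exp_add]
          have : 1 / t + ((2 : ℕ) : ℝ) * -(1 / (2 * t)) = 0 := by push_cast; field_simp; ring
          rw [this]; simp
        rw [h4]
        have : η₁ ^ 2 / d ^ 2 ≤ X s / d ^ 2 := by gcongr
        linarith
      have h5 : 1 / t ≤ L s := (Real.le_log_iff_exp_le (hpos s)).2 h2
      rw [div_le_iff₀ ht0] at h5
      linarith
    simp only [χ, M]
    rw [max_eq_right (by linarith)]; simp
  have hχa : ∀ s ≤ a, χ s = 1 := fun s hs => by
    have : X s = 0 := by simp only [X]; rw [max_eq_right (by linarith)]; simp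
    simp [χ, M, L, this]
  obtain ⟨δ, hδ, hδχ⟩ : ∃ δ > 0, ∀ s ≤ a + δ, 1 / 2 < χ s := by
    have : ∀ᶠ s in 𝓝 a, 1 / 2 < χ s :=
      hχc.continuousAt.eventually (lt_mem_nhds (by rw [hχa a le_rfl]; norm_num))
    obtain ⟨δ, hδ, h⟩ := Metric.eventually_nhds_iff.1 this
    refine ⟨δ / 2, by positivity, fun s hs => ?_⟩
    rcases le_total s a with hsa | hsa
    · rw [hχa s hsa]; norm_num
    · exact h (by rw [Real.dist_eq, abs_of_nonneg (by linarith)]; linarith)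
  refine ⟨δ, hδ, χ, ψ, ψ', hχc, by fun_prop, hψd, hχ0,
    fun s hs => hχout s (by linarith [min_le_left η η₀]), hδχ, ?_, ?_, √K, by positivity, ?_⟩
  · intro s
    have h1 : (s - a) * L' s ≤ 2 := by
      have h2 : (s - a) * max (s - a) 0 = X s := by
        rcases le_total (s - a) 0 with h | h
        · simp [X, max_eq_right h]
        · simp [X, max_eq_left h, sq]
      have h3 : (s - a) * L' s = 2 * (X s / d ^ 2) / (1 + X s / d ^ 2) := by
        simp only [L']
        rw [← h2]; ring
      rw [h3, div_le_iff₀ (hpos s)]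
      linarith
    have h4 : M s * ((s - a) * L' s) ≤ 1 * 2 := by
      rcases le_total 0 ((s - a) * L' s) with h | h
      · exact mul_le_mul (hM1 s) h1 h zero_le_one
      · nlinarith [hM0 s]
    have h5 : ψ' s = χ s - 2 * t * (M s * ((s - a) * L' s)) := by simp only [ψ']; ring
    rw [h5]
    nlinarith
  · intro s
    rcases le_total s (a + η₁) with hs | hs
    · have := (hconv s (by linarith [min_le_right η η₀])).2
      have := mul_le_mul_of_nonneg_right this (hχ0 s)
      simp only [ψ]
      linarith
    · simp [ψ, hχout s hs]
  · intro s
    rcases le_total s (a + η₁) with hs | hs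
    · have h1 := (hconv s (by linarith [min_le_right η η₀])).1
      rw [← Real.sqrt_mul hK.le]
      calc |ψ s| = |s - a| * χ s := by simp only [ψ]; rw [abs_mul, abs_of_nonneg (hχ0 s)]
        _ ≤ |s - a| * 1 := by gcongr; exact hχ1 s
        _ = √((s - a) ^ 2) := by rw [mul_one, Real.sqrt_sq_eq_abs]
        _ ≤ √(K * W s) := Real.sqrt_le_sqrt h1
    · simp only [ψ, hχout s hs, mul_zero, abs_zero]; positivity

theorem integral_sqrt_pos {W : ℝ → ℝ} {a b : ℝ} (hW : IsDoubleWell W a b) :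
    0 < surfaceTension W a b := by
  have hc : Continuous fun s => √(W s) := hW.contDiff.continuous.sqrt
  have := intervalIntegral.intervalIntegral_pos_of_pos_on (hc.intervalIntegrable a b)
    (fun s hs => Real.sqrt_pos.2 (hW.pos s hs)) hW.lt
  simp only [surfaceTension]
  linarith

/-- A cutoff `ρ` compactly supported in `(a, b)`, almost equal to `1` there, and a test function `ψ`
that detects the energy where `ρ` is not `1`, in particular near the wells and outside `(a, b)`. -/
theorem exists_cutoff_test {W : ℝ → ℝ} {a b : ℝ} (hW : IsDoubleWell W a b) {τ : ℝ} (hτ : 0 < τ) :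
    ∃ δ > 0, a + δ < b - δ ∧ ∃ ρ ψ ψ' : ℝ → ℝ, Continuous ρ ∧ Continuous ψ' ∧
      (∀ s, HasDerivAt ψ (ψ' s) s) ∧ (∀ s, 0 ≤ ρ s) ∧ (∀ s, ρ s ≤ 1) ∧
      (∀ s ∉ Icc (a + δ) (b - δ), ρ s = 0) ∧
      surfaceTension W a b - τ ≤ 2 * ∫ s in a..b, ρ s * √(W s) ∧
      (∀ s, (1 - ρ s) - τ ≤ 2 * ψ' s) ∧ (∀ s, (1 - ρ s) * W s ≤ 2 * (deriv W s * ψ s)) ∧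
      ∃ K, 0 ≤ K ∧ ∀ s, |ψ s| ≤ K * √(W s) := by
  have hab := hW.lt
  obtain ⟨κ, hκ0, hκ⟩ := hW.convex_outside
  have hcs : Continuous fun s => √(W s) := hW.contDiff.continuous.sqrt
  obtain ⟨Mx, hMx⟩ := (isCompact_Icc (a := a) (b := b)).exists_bound_of_continuousOn hcs.continuousOn
  have hMx0 : 0 ≤ Mx := (norm_nonneg _).trans (hMx a ⟨le_rfl, hab.le⟩)
  set η := min (τ / (4 * (Mx + 1))) ((b - a) / 4) with hη
  have hη0 : 0 < η := lt_min (by positivity) (by linarith)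
  have hη1 : η ≤ (b - a) / 4 := min_le_right _ _
  have hη2 : 4 * (Mx + 1) * η ≤ τ := by
    have : η ≤ τ / (4 * (Mx + 1)) := min_le_left _ _
    rw [le_div_iff₀ (by positivity)] at this
    linarith
  obtain ⟨δ₁, hδ₁, χ₁, ψ₁, ψ₁', hχ₁c, hψ₁'c, hψ₁d, hχ₁0, hχ₁out, hχ₁in, hψ₁', hWψ₁, K₁, hK₁, hψ₁K⟩ :=
    exists_well_test hW.contDiff hW.nonneg hW.left_zero
      ⟨κ, hκ0, fun s hs => hκ s (fun h => absurd h.1 (not_lt.2 hs))⟩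
      (τ := τ / 4) (by positivity) hη0
  -- the well `b` is treated by the reflection `s ↦ -s`
  have hrefl1 : deriv (fun s => W (-s)) = fun s => - deriv W (-s) := by
    funext s; exact deriv_comp_neg W s
  have hrefl2 : deriv (deriv fun s => W (-s)) = fun s => deriv (deriv W) (-s) := by
    rw [hrefl1]
    funext s
    have : (fun s => - deriv W (-s)) = fun s => -((fun t => deriv W (-t)) s) := rfl
    rw [this, deriv.fun_neg, deriv_comp_neg, neg_neg]
  obtain ⟨δ₂, hδ₂, χ₂, ψ₂, ψ₂', hχ₂c, hψ₂'c, hψ₂d, hχ₂0, hχ₂out, hχ₂in, hψ₂', hWψ₂, K₂, hK₂, hψ₂K⟩ :=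
    exists_well_test (W := fun s => W (-s)) (hW.contDiff.comp contDiff_neg)
      (fun s => hW.nonneg _) (a := -b) (by simp [hW.right_zero])
      ⟨κ, hκ0, fun s hs => by
        rw [hrefl2]
        exact hκ _ (fun h => absurd h.2 (not_lt.2 (by linarith)))⟩
      (τ := τ / 4) (by positivity) hη0
  rw [hrefl1] at hWψ₂
  set δ := min (min δ₁ δ₂) ((b - a) / 4) with hδ
  have hδ0 : 0 < δ := lt_min (lt_min hδ₁ hδ₂) (by linarith)
  have hδ1 : δ ≤ (b - a) / 4 := min_le_right _ _
  have hδa : δ ≤ δ₁ := (min_le_left _ _).trans (min_le_left _ _)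
  have hδb : δ ≤ δ₂ := (min_le_left _ _).trans (min_le_right _ _)
  have hdef : ∀ s, 1 - max 0 (1 - 2 * χ₁ s - 2 * χ₂ (-s)) ≤ 2 * χ₁ s + 2 * χ₂ (-s) := fun s => by
    linarith [le_max_right 0 (1 - 2 * χ₁ s - 2 * χ₂ (-s))]
  refine ⟨δ, hδ0, by linarith, fun s => max 0 (1 - 2 * χ₁ s - 2 * χ₂ (-s)),
    fun s => ψ₁ s - ψ₂ (-s), fun s => ψ₁' s + ψ₂' (-s), by fun_prop, by fun_prop, ?_,
    fun s => le_max_left _ _, ?_, ?_, ?_, ?_, ?_, K₁ + K₂, by positivity, ?_⟩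
  · intro s
    have h2 := (hψ₂d (-s)).comp s (hasDerivAt_neg s)
    have := (hψ₁d s).sub h2
    simpa using! this
  · intro s
    exact max_le zero_le_one (by linarith [hχ₁0 s, hχ₂0 (-s)])
  · intro s hs
    apply max_eq_left
    rw [mem_Icc, not_and_or, not_le, not_le] at hs
    rcases hs with hs | hs
    · linarith [hχ₁in s (by linarith), hχ₂0 (-s)]
    · linarith [hχ₂in (-s) (by linarith), hχ₁0 s]
  · have hρc : Continuous fun s => max 0 (1 - 2 * χ₁ s - 2 * χ₂ (-s)) := by fun_prop
    set ρ := fun s => max 0 (1 - 2 * χ₁ s - 2 * χ₂ (-s)) with hρ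
    have hc : Continuous fun s => (1 - ρ s) * √(W s) := by fun_prop
    have e : surfaceTension W a b - 2 * ∫ s in a..b, ρ s * √(W s)
        = 2 * ∫ s in a..b, (1 - ρ s) * √(W s) := by
      rw [surfaceTension, ← mul_sub, ← intervalIntegral.integral_sub (hcs.intervalIntegrable _ _)
        ((show Continuous fun s => ρ s * √(W s) by fun_prop).intervalIntegrable _ _)]
      congr 2
      funext s; ring
    have hbd : ∀ s ∈ Icc a b, ‖(1 - ρ s) * √(W s)‖ ≤ Mx := fun s hs => by
      rw [norm_mul]
      have h1 : ‖1 - ρ s‖ ≤ 1 := by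
        rw [Real.norm_eq_abs, abs_le]
        have : 0 ≤ ρ s := le_max_left _ _
        have : ρ s ≤ 1 := max_le zero_le_one (by linarith [hχ₁0 s, hχ₂0 (-s)])
        constructor <;> linarith
      calc _ ≤ 1 * Mx := mul_le_mul h1 (hMx s hs) (norm_nonneg _) zero_le_one
        _ = Mx := one_mul _
    have hsplit : ∫ s in a..b, (1 - ρ s) * √(W s)
        = (∫ s in a..(a + η), (1 - ρ s) * √(W s)) + (∫ s in (a + η)..(b - η), (1 - ρ s) * √(W s))
          + ∫ s in (b - η)..b, (1 - ρ s) * √(W s) := by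
      rw [intervalIntegral.integral_add_adjacent_intervals (hc.intervalIntegrable _ _)
        (hc.intervalIntegrable _ _), intervalIntegral.integral_add_adjacent_intervals
        (hc.intervalIntegrable _ _) (hc.intervalIntegrable _ _)]
    have i1 : ∫ s in a..(a + η), (1 - ρ s) * √(W s) ≤ Mx * η := by
      have := intervalIntegral.norm_integral_le_of_norm_le_const (a := a) (b := a + η)
        (f := fun s => (1 - ρ s) * √(W s)) (C := Mx) (fun s hs => by
          rw [uIoc_of_le (by linarith)] at hs
          exact hbd s ⟨hs.1.le, by linarith [hs.2]⟩)
      rw [show a + η - a = η by ring, abs_of_pos hη0] at this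
      exact (le_abs_self _).trans this
    have i3 : ∫ s in (b - η)..b, (1 - ρ s) * √(W s) ≤ Mx * η := by
      have := intervalIntegral.norm_integral_le_of_norm_le_const (a := b - η) (b := b)
        (f := fun s => (1 - ρ s) * √(W s)) (C := Mx) (fun s hs => by
          rw [uIoc_of_le (by linarith)] at hs
          exact hbd s ⟨by linarith [hs.1], hs.2⟩)
      rw [show b - (b - η) = η by ring, abs_of_pos hη0] at this
      exact (le_abs_self _).trans this
    have i2 : ∫ s in (a + η)..(b - η), (1 - ρ s) * √(W s) = 0 := by
      rw [intervalIntegral.integral_congr (g := fun _ => 0)]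
      · simp
      · intro s hs
        rw [uIcc_of_le (by linarith)] at hs
        have h1 : ρ s = 1 := by
          simp only [hρ]
          rw [hχ₁out s hs.1, hχ₂out (-s) (by linarith [hs.2])]
          norm_num
        simp [h1]
    have : (Mx + 1) * η = Mx * η + η := by ring
    rw [i2] at hsplit
    linarith
  · intro s
    linarith [hdef s, hψ₁' s, hψ₂' (-s), hχ₁0 s, hχ₂0 (-s)]
  · intro s
    have h1 := hWψ₁ s
    have h2 := hWψ₂ (-s)
    simp only [neg_neg] at h2
    have h3 := mul_le_mul_of_nonneg_right (hdef s) (hW.nonneg s)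
    calc _ ≤ (2 * χ₁ s + 2 * χ₂ (-s)) * W s := h3
      _ ≤ _ := by linarith
  · intro s
    have h2 := hψ₂K (-s)
    simp only [neg_neg] at h2
    calc _ ≤ |ψ₁ s| + |ψ₂ (-s)| := abs_sub _ _
      _ ≤ _ := by linarith [hψ₁K s]

end AllenCahn

namespace AllenCahn

/-! ### The one-dimensional equation -/

theorem IsPrimitiveOn.abs_sub_le {f f' g : ℝ → ℝ} {A B : ℝ} (hf : IsPrimitiveOn f f' A B)
    (hg : IntervalIntegrable g volume A B) (h : ∀ r ∈ Icc A B, |f' r| ≤ g r) {x y : ℝ}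
    (hx : x ∈ Icc A B) (hy : y ∈ Icc A B) : |f x - f y| ≤ ∫ r in A..B, g r := by
  wlog hxy : y ≤ x generalizing x y
  · rw [abs_sub_comm]; exact this hy hx (le_of_not_ge hxy)
  have hAB : A ≤ B := hx.1.trans hx.2
  have hgi : IntervalIntegrable g volume y x := hg.mono_set (by
    rw [uIcc_of_le hxy, uIcc_of_le hAB]; exact Icc_subset_Icc hy.1 hx.2)
  rw [hf.sub_eq hy.1 hxy hx.2]
  calc |∫ t in y..x, f' t| ≤ ∫ t in y..x, g t := by
        have := intervalIntegral.norm_integral_le_of_norm_le (f := f') hxy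
          (ae_of_all _ fun t ht => h t ⟨hy.1.trans ht.1.le, ht.2.trans hx.2⟩) hgi
        simpa using this
    _ ≤ ∫ r in A..B, g r := by
        apply intervalIntegral.integral_mono_interval hy.1 hxy hx.2 _ hg
        exact (ae_restrict_iff' measurableSet_Ioc).2 (ae_of_all _ fun t ht =>
          (abs_nonneg _).trans (h t ⟨ht.1.le, ht.2⟩))

/-- A solution `w` on `[A, B]`, with `p = ε w'`, of the radial equation
`2 ε (w'' + m w') - W'(w) / ε = H`, where `m` is the curvature coefficient, with bounds on the
energy and on the right-hand side `H` that scale as those of an Allen-Cahn sequence. -/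
structure IsProfile (W m : ℝ → ℝ) (M C A B ε : ℝ) (w p H : ℝ → ℝ) : Prop where
  eps_pos : 0 < ε
  eps_le : ε ≤ 1
  curv_cont : ContinuousOn m (Icc A B)
  curv_le : ∀ r ∈ Icc A B, |m r| ≤ M
  deriv_eq : ∀ r ∈ Icc A B, HasDerivAt w (p r / ε) r
  int_forcing : IntervalIntegrable H volume A B
  equation : IsPrimitiveOn p (fun r => H r / 2 + deriv W (w r) / (2 * ε) - m r * p r) A B
  energy_le : ∫ r in A..B, (p r ^ 2 + W (w r)) ≤ C * ε
  forcing_le : ∫ r in A..B, |H r| * √(p r ^ 2 + W (w r)) ≤ C * √ε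

/-- The pointwise inequalities behind all the absorption arguments: `√W` and `|p|` are controlled
by the square root of the energy density. -/
theorem abs_le_sqrt_energy {p W : ℝ} (hW : 0 ≤ W) :
    |p| ≤ √(p ^ 2 + W) ∧ √W ≤ √(p ^ 2 + W) ∧ |p| * √W ≤ p ^ 2 + W := by
  have h1 : |p| ≤ √(p ^ 2 + W) := by
    rw [← Real.sqrt_sq_eq_abs]; exact Real.sqrt_le_sqrt (by linarith)
  have h2 : √W ≤ √(p ^ 2 + W) := Real.sqrt_le_sqrt (by nlinarith [sq_nonneg p])
  refine ⟨h1, h2, ?_⟩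
  calc |p| * √W ≤ √(p ^ 2 + W) * √(p ^ 2 + W) :=
        mul_le_mul h1 h2 (Real.sqrt_nonneg _) (Real.sqrt_nonneg _)
    _ = p ^ 2 + W := Real.mul_self_sqrt (by positivity)

namespace IsProfile

variable {W m : ℝ → ℝ} {M C A B ε : ℝ} {w p H : ℝ → ℝ} {a b : ℝ}

theorem continuousOn_w (h : IsProfile W m M C A B ε w p H) : ContinuousOn w (Icc A B) :=
  fun r hr => (h.deriv_eq r hr).continuousAt.continuousWithinAt

theorem continuousOn_p (h : IsProfile W m M C A B ε w p H) (hAB : A ≤ B) :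
    ContinuousOn p (Icc A B) := h.equation.continuousOn hAB

theorem continuousOn_comp (h : IsProfile W m M C A B ε w p H) {f : ℝ → ℝ} (hf : Continuous f) :
    ContinuousOn (fun r => f (w r)) (Icc A B) := hf.comp_continuousOn h.continuousOn_w

theorem continuousOn_energy (h : IsProfile W m M C A B ε w p H) (hAB : A ≤ B)
    (hW : IsDoubleWell W a b) : ContinuousOn (fun r => p r ^ 2 + W (w r)) (Icc A B) :=
  ((h.continuousOn_p hAB).pow 2).add (h.continuousOn_comp hW.contDiff.continuous)

theorem intervalIntegrable_energy (h : IsProfile W m M C A B ε w p H) (hAB : A ≤ B)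
    (hW : IsDoubleWell W a b) : IntervalIntegrable (fun r => p r ^ 2 + W (w r)) volume A B :=
  ContinuousOn.intervalIntegrable (by rw [uIcc_of_le hAB]; exact h.continuousOn_energy hAB hW)

theorem intervalIntegrable_forcing (h : IsProfile W m M C A B ε w p H) (hAB : A ≤ B)
    (hW : IsDoubleWell W a b) :
    IntervalIntegrable (fun r => |H r| * √(p r ^ 2 + W (w r))) volume A B :=
  h.int_forcing.abs.mul_continuousOn
    (by rw [uIcc_of_le hAB]; exact (h.continuousOn_energy hAB hW).sqrt)

theorem energy_nonneg (hW : IsDoubleWell W a b) (r : ℝ) : 0 ≤ p r ^ 2 + W (w r) :=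
  add_nonneg (sq_nonneg _) (hW.nonneg _)

theorem const_nonneg (h : IsProfile W m M C A B ε w p H) (hAB : A ≤ B) (hW : IsDoubleWell W a b) :
    0 ≤ C := by
  have : 0 ≤ ∫ r in A..B, (p r ^ 2 + W (w r)) :=
    intervalIntegral.integral_nonneg hAB fun r _ => energy_nonneg hW r
  exact nonneg_of_mul_nonneg_left (this.trans h.energy_le) h.eps_pos

theorem curv_nonneg (h : IsProfile W m M C A B ε w p H) (hAB : A ≤ B) : 0 ≤ M :=
  (abs_nonneg _).trans (h.curv_le A ⟨le_rfl, hAB⟩)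

theorem eps_le_sqrt (h : IsProfile W m M C A B ε w p H) : ε ≤ √ε :=
  Real.le_sqrt_of_sq_le (by nlinarith [h.eps_pos, h.eps_le])

theorem hasDerivAt_comp (h : IsProfile W m M C A B ε w p H) {f f' : ℝ → ℝ}
    (hf : ∀ s, HasDerivAt f (f' s) s) :
    ∀ r ∈ Icc A B, HasDerivAt (fun r => f (w r)) (f' (w r) * (p r / ε)) r :=
  fun r hr => (hf (w r)).comp r (h.deriv_eq r hr)

theorem isPrimitiveOn_comp (h : IsProfile W m M C A B ε w p H) (hAB : A ≤ B) {f f' : ℝ → ℝ}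
    (hf : ∀ s, HasDerivAt f (f' s) s) (hf' : Continuous f') :
    IsPrimitiveOn (fun r => f (w r)) (fun r => f' (w r) * (p r / ε)) A B :=
  IsPrimitiveOn.of_hasDerivAt (h.hasDerivAt_comp hf)
    ((h.continuousOn_comp hf').mul ((h.continuousOn_p hAB).div_const ε)) hAB

theorem _root_.AllenCahn.IsDoubleWell.hasDerivAt (hW : IsDoubleWell W a b) (s : ℝ) :
    HasDerivAt W (deriv W s) s := ((hW.contDiff.differentiable (by norm_num)) s).hasDerivAt

theorem _root_.AllenCahn.IsDoubleWell.continuous_deriv (hW : IsDoubleWell W a b) :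
    Continuous (deriv W) := hW.contDiff.continuous_deriv (by norm_num)

/-- Uniform smallness of the discrepancy `p ^ 2 - W(w)`. The terms with `W'` cancel in its
derivative `p H - 2 m p ^ 2`, which is small in `L¹`. -/
theorem discrepancy_le (h : IsProfile W m M C A B ε w p H) (hAB : A < B) (hW : IsDoubleWell W a b)
    {r : ℝ} (hr : r ∈ Icc A B) :
    |p r ^ 2 - W (w r)| ≤ (C / (B - A) + C + 2 * M * C) * √ε := by
  have hC := h.const_nonneg hAB.le hW
  have hM := h.curv_nonneg hAB.le
  have hε := h.eps_pos
  set T := (C + 2 * M * C) * √ε with hT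
  have hprim : IsPrimitiveOn (fun r => p r * p r - W (w r))
      (fun r => p r * H r - 2 * m r * p r ^ 2) A B := by
    refine ((h.equation.mul h.equation hAB.le).sub
      (h.isPrimitiveOn_comp hAB.le hW.hasDerivAt hW.continuous_deriv)).congr_deriv
      (fun r _ => ?_) hAB.le
    field_simp
    ring
  have hei := h.intervalIntegrable_energy hAB.le hW
  have hfi := h.intervalIntegrable_forcing hAB.le hW
  have hosc : ∀ x ∈ Icc A B, ∀ y ∈ Icc A B,
      |(p x * p x - W (w x)) - (p y * p y - W (w y))| ≤ T := by
    intro x hx y hy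
    have := hprim.abs_sub_le (hfi.add (hei.const_mul (2 * M))) (fun r hr => by
      obtain ⟨h1, -, -⟩ := abs_le_sqrt_energy (p := p r) (hW.nonneg (w r))
      calc |p r * H r - 2 * m r * p r ^ 2| ≤ |p r * H r| + |2 * m r * p r ^ 2| := abs_sub _ _
        _ ≤ |H r| * √(p r ^ 2 + W (w r)) + 2 * M * (p r ^ 2 + W (w r)) := by
          apply add_le_add
          · rw [abs_mul, mul_comm]
            exact mul_le_mul_of_nonneg_left h1 (abs_nonneg _)
          · rw [abs_mul, abs_mul, abs_two, abs_of_nonneg (sq_nonneg (p r))]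
            have := h.curv_le r hr
            have := hW.nonneg (w r)
            gcongr
            linarith) hx hy
    refine this.trans ?_
    rw [intervalIntegral.integral_add hfi (hei.const_mul (2 * M)),
      intervalIntegral.integral_const_mul]
    have h1 := h.forcing_le
    have h2 := h.energy_le
    have h3 := h.eps_le_sqrt
    have h4 : 2 * M * ∫ r in A..B, (p r ^ 2 + W (w r)) ≤ 2 * M * (C * √ε) := by
      gcongr
      exact h2.trans (by gcongr)
    rw [hT]
    linarith
  have havg : (B - A) * |p r * p r - W (w r)| ≤ C * ε + T * (B - A) := by
    calc (B - A) * |p r * p r - W (w r)| = ∫ y in A..B, |p r * p r - W (w r)| := by simp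
      _ ≤ ∫ y in A..B, ((p y ^ 2 + W (w y)) + T) := by
        apply intervalIntegral.integral_mono_on hAB.le (by simp) (hei.add (by simp))
        intro y hy
        have h1 := hosc r hr y hy
        have h2 : |p y * p y - W (w y)| ≤ p y ^ 2 + W (w y) := by
          have := hW.nonneg (w y)
          rw [abs_le]; constructor <;> nlinarith [sq_nonneg (p y)]
        have h3 := abs_sub_abs_le_abs_sub (p r * p r - W (w r)) (p y * p y - W (w y))
        linarith
      _ ≤ C * ε + T * (B - A) := by
        rw [intervalIntegral.integral_add hei (by simp), intervalIntegral.integral_const,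
          smul_eq_mul]
        linarith [h.energy_le]
  have hBA : 0 < B - A := sub_pos.2 hAB
  rw [mul_comm, ← le_div_iff₀ hBA] at havg
  rw [sq]
  refine havg.trans ?_
  rw [add_div, mul_div_cancel_right₀ _ hBA.ne', hT, mul_div_right_comm]
  have : C / (B - A) * ε ≤ C / (B - A) * √ε := by gcongr; exact h.eps_le_sqrt
  linarith

/-- Testing the equation with `ψ(w) (r - A) (B - r)`: the energy where the cutoff `ρ` is not `1` is
bounded by the tolerance `τ` up to an error of order `√ε`. -/
theorem energy_off_cutoff_le (h : IsProfile W m M C A B ε w p H) (hAB : A < B)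
    (hW : IsDoubleWell W a b) {ρ ψ ψ' : ℝ → ℝ} {τ K : ℝ} (hρc : Continuous ρ)
    (hψ'c : Continuous ψ') (hψd : ∀ s, HasDerivAt ψ (ψ' s) s) (hρ1 : ∀ s, ρ s ≤ 1)
    (hτ : 0 ≤ τ) (hψ' : ∀ s, (1 - ρ s) - τ ≤ 2 * ψ' s)
    (hWψ : ∀ s, (1 - ρ s) * W s ≤ 2 * (deriv W s * ψ s)) (hK : 0 ≤ K)
    (hψK : ∀ s, |ψ s| ≤ K * √(W s)) :
    ∫ r in A..B, (r - A) * (B - r) * ((1 - ρ (w r)) * (p r ^ 2 + W (w r))) ≤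
      (2 * (B - A) ^ 2 * τ * C
        + (4 * (B - A) ^ 2 * K * (1 + M) + 4 * (B - A) * K) * C * √ε) * ε := by
  have hε := h.eps_pos
  have hM := h.curv_nonneg hAB.le
  have hC := h.const_nonneg hAB.le hW
  set ℓ := B - A with hℓ
  have hℓ0 : 0 < ℓ := sub_pos.2 hAB
  have hη : IsPrimitiveOn (fun r => (r - A) * (B - r)) (fun r => (B - r) - (r - A)) A B :=
    IsPrimitiveOn.of_hasDerivAt (fun r _ => by
      have := ((hasDerivAt_id' r).sub_const A).fun_mul ((hasDerivAt_id' r).const_sub B)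
      simpa [sub_eq_add_neg] using this) (by fun_prop) hAB.le
  have hprim := (h.equation.mul ((h.isPrimitiveOn_comp hAB.le hψd hψ'c).mul hη hAB.le) hAB.le)
  have h0 := hprim.sub_eq le_rfl hAB.le le_rfl
  simp only [sub_self, mul_zero, zero_mul] at h0
  have hei := h.intervalIntegrable_energy hAB.le hW
  have hfi := h.intervalIntegrable_forcing hAB.le hW
  have hmain : IntervalIntegrable
      (fun r => (r - A) * (B - r) * ((1 - ρ (w r)) * (p r ^ 2 + W (w r)))) volume A B := by
    apply ContinuousOn.intervalIntegrable
    rw [uIcc_of_le hAB.le]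
    exact (show Continuous fun r => (r - A) * (B - r) by fun_prop).continuousOn.mul
      ((continuousOn_const.sub (h.continuousOn_comp hρc)).mul (h.continuousOn_energy hAB.le hW))
  have hlow : (∫ r in A..B, ((r - A) * (B - r) * ((1 - ρ (w r)) * (p r ^ 2 + W (w r))) / (4 * ε)
      - ((ℓ ^ 2 * τ / (2 * ε) + (ℓ ^ 2 * M + ℓ) * K) * (p r ^ 2 + W (w r))
        + ℓ ^ 2 * K * (|H r| * √(p r ^ 2 + W (w r)))))) ≤ 0 := by
    rw [h0]
    apply intervalIntegral.integral_mono_on hAB.le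
      ((hmain.div_const _).sub ((hei.const_mul _).add (hfi.const_mul _))) hprim.1
    intro r hr
    obtain ⟨h1, h2, h3⟩ := abs_le_sqrt_energy (p := p r) (hW.nonneg (w r))
    have hWn := hW.nonneg (w r)
    have he := energy_nonneg (w := w) (p := p) hW r
    have hm := h.curv_le r hr
    have hψr := hψK (w r)
    set s := w r
    set e := p r ^ 2 + W s with hedef
    set η := (r - A) * (B - r) with hηdef
    have hη0 : 0 ≤ η := mul_nonneg (by linarith [hr.1]) (by linarith [hr.2])
    have hη1 : η ≤ ℓ ^ 2 := by
      rw [sq]; exact mul_le_mul (by linarith [hr.2]) (by linarith [hr.1]) (by linarith [hr.2]) hℓ0.le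
    have hη' : |(B - r) - (r - A)| ≤ ℓ := by
      rw [abs_le]; constructor <;> linarith [hr.1, hr.2]
    have hψe : |ψ s| ≤ K * √e := hψr.trans (by gcongr)
    have hpψ : |p r * ψ s| ≤ K * e := by
      rw [abs_mul]
      calc |p r| * |ψ s| ≤ |p r| * (K * √(W s)) := by gcongr
        _ = K * (|p r| * √(W s)) := by ring
        _ ≤ K * e := by gcongr
    have hHψ : |H r * ψ s| ≤ K * (|H r| * √e) := by
      rw [abs_mul]
      calc |H r| * |ψ s| ≤ |H r| * (K * √e) := by gcongr
        _ = K * (|H r| * √e) := by ring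
    -- the good terms
    have hgood : η * ((1 - ρ s) * e) / (4 * ε) - ℓ ^ 2 * τ / (2 * ε) * e ≤
        η * (ψ' s * p r ^ 2 / ε + deriv W s * ψ s / (2 * ε)) := by
      have g1 := mul_le_mul_of_nonneg_right (hψ' s) (sq_nonneg (p r))
      have g2 := hWψ s
      have g3 : 0 ≤ (1 - ρ s) * p r ^ 2 := mul_nonneg (by linarith [hρ1 s]) (sq_nonneg _)
      have g4 : (1 - ρ s) * e / 4 - τ * e / 2 ≤ ψ' s * p r ^ 2 + deriv W s * ψ s / 2 := by
        have : τ * p r ^ 2 ≤ τ * e := by gcongr; linarith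
        rw [hedef] at *
        nlinarith
      have g5 : η * (τ * e / 2) ≤ ℓ ^ 2 * (τ * e / 2) := by gcongr
      have g6 := mul_le_mul_of_nonneg_left g4 hη0
      have g7 : η * ((1 - ρ s) * e) / 4 - ℓ ^ 2 * τ / 2 * e ≤
        η * (ψ' s * p r ^ 2 + deriv W s * ψ s / 2) := by linarith
      have g8 := div_le_div_of_nonneg_right g7 hε.le
      calc _ = (η * ((1 - ρ s) * e) / 4 - ℓ ^ 2 * τ / 2 * e) / ε := by field_simp
        _ ≤ _ := g8
        _ = _ := by field_simp
    -- the error terms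
    have hb1 : |η * (H r * ψ s) / 2| ≤ ℓ ^ 2 * K * (|H r| * √e) := by
      rw [abs_div, abs_mul, abs_of_nonneg hη0, abs_two]
      have : η * |H r * ψ s| ≤ ℓ ^ 2 * (K * (|H r| * √e)) :=
        mul_le_mul hη1 hHψ (abs_nonneg _) (by positivity)
      have : 0 ≤ η * |H r * ψ s| := by positivity
      linarith
    have hb2 : |η * (m r * (p r * ψ s))| ≤ ℓ ^ 2 * M * (K * e) := by
      rw [abs_mul, abs_of_nonneg hη0, abs_mul, mul_assoc (ℓ ^ 2)]
      exact mul_le_mul hη1 (mul_le_mul hm hpψ (abs_nonneg _) hM) (by positivity) (by positivity)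
    have hb3 : |(p r * ψ s) * ((B - r) - (r - A))| ≤ K * e * ℓ := by
      rw [abs_mul]
      exact mul_le_mul hpψ hη' (abs_nonneg _) (by positivity)
    have e1 : (H r / 2 + deriv W s / (2 * ε) - m r * p r) * (ψ s * η) +
        p r * (ψ' s * (p r / ε) * η + ψ s * (B - r - (r - A)))
        = η * (ψ' s * p r ^ 2 / ε + deriv W s * ψ s / (2 * ε)) + η * (H r * ψ s) / 2
          - η * (m r * (p r * ψ s)) + (p r * ψ s) * ((B - r) - (r - A)) := by
      field_simp
      ring
    rw [e1]
    have i1 := neg_abs_le (η * (H r * ψ s) / 2)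
    have i2 := le_abs_self (η * (m r * (p r * ψ s)))
    have i3 := neg_abs_le ((p r * ψ s) * ((B - r) - (r - A)))
    linarith
  rw [intervalIntegral.integral_sub (hmain.div_const _) ((hei.const_mul _).add (hfi.const_mul _)),
    intervalIntegral.integral_add (hei.const_mul _) (hfi.const_mul _),
    intervalIntegral.integral_const_mul, intervalIntegral.integral_const_mul,
    intervalIntegral.integral_div] at hlow
  have j1 : (ℓ ^ 2 * τ / (2 * ε) + (ℓ ^ 2 * M + ℓ) * K) * ∫ r in A..B, (p r ^ 2 + W (w r))
      ≤ (ℓ ^ 2 * τ / (2 * ε) + (ℓ ^ 2 * M + ℓ) * K) * (C * ε) := by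
    gcongr; exact h.energy_le
  have j2 : ℓ ^ 2 * K * (∫ r in A..B, |H r| * √(p r ^ 2 + W (w r))) ≤ ℓ ^ 2 * K * (C * √ε) := by
    gcongr; exact h.forcing_le
  have j3 : (ℓ ^ 2 * M + ℓ) * K * (C * ε) ≤ (ℓ ^ 2 * M + ℓ) * K * (C * √ε) := by
    gcongr; exact h.eps_le_sqrt
  have j4 : (∫ r in A..B, (r - A) * (B - r) * ((1 - ρ (w r)) * (p r ^ 2 + W (w r)))) / (4 * ε) ≤
      ℓ ^ 2 * τ * C / 2 + (ℓ ^ 2 * M + ℓ) * K * (C * √ε) + ℓ ^ 2 * K * (C * √ε) := by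
    have : ℓ ^ 2 * τ / (2 * ε) * (C * ε) = ℓ ^ 2 * τ * C / 2 := by field_simp
    linarith
  rw [div_le_iff₀ (by positivity)] at j4
  refine j4.trans (le_of_eq ?_)
  ring

end IsProfile

end AllenCahn

namespace AllenCahn

/-! ### Quantization of the energy of a profile -/

/-- A continuous function supported in a compact subinterval of `(a, b)` is bounded by a multiple
of `W`. -/
theorem IsDoubleWell.exists_abs_le_mul {W : ℝ → ℝ} {a b : ℝ} (hW : IsDoubleWell W a b) {δ : ℝ}
    (hδ : 0 < δ) {f g : ℝ → ℝ} (hf : Continuous f) (hf0 : ∀ s ∉ Icc (a + δ) (b - δ), f s = 0)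
    (hg : Continuous g) (hg0 : ∀ s, 0 ≤ g s) (hgW : ∀ s, 0 < W s → 0 < g s) :
    ∃ K, 0 ≤ K ∧ ∀ s, |f s| ≤ K * g s := by
  have hpos : ∀ s ∈ Icc (a + δ) (b - δ), 0 < g s := fun s hs =>
    hgW s (hW.pos s ⟨by linarith [hs.1], by linarith [hs.2]⟩)
  obtain ⟨K, hK⟩ := (isCompact_Icc (a := a + δ) (b := b - δ)).exists_bound_of_continuousOn
    (f := fun s => f s / g s)
    (hf.continuousOn.div hg.continuousOn fun s hs => (hpos s hs).ne')
  refine ⟨max K 0, le_max_right _ _, fun s => ?_⟩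
  by_cases hs : s ∈ Icc (a + δ) (b - δ)
  · have := hK s hs
    rw [Real.norm_eq_abs, abs_div, abs_of_pos (hpos s hs), div_le_iff₀ (hpos s hs)] at this
    exact this.trans (mul_le_mul_of_nonneg_right (le_max_left _ _) (hg0 s))
  · rw [hf0 s hs, abs_zero]
    exact mul_nonneg (le_max_right _ _) (hg0 s)

/-- The angle functions of the phase plane. Along an exact solution of `ε² w'² = W(w)` the vector
`(D(w), ε w' Q(w))` rotates, with angular velocity proportional to `ρ(w) W(w) / ε`; it is equal to
`(± 1, 0)` whenever `w` is close to a well. -/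
theorem exists_angle_functions {W : ℝ → ℝ} {a b : ℝ} (hW : IsDoubleWell W a b) {δ : ℝ}
    (hδ : 0 < δ) {ρ : ℝ → ℝ} (hρc : Continuous ρ)
    (hρ0 : ∀ s ∉ Icc (a + δ) (b - δ), ρ s = 0) {S : ℝ}
    (hS : S = 2 * ∫ s in a..b, ρ s * √(W s)) (hSpos : 0 < S) :
    ∃ Q Q' D : ℝ → ℝ, Continuous Q' ∧ (∀ s, HasDerivAt Q (Q' s) s) ∧
      (∀ s, HasDerivAt D (-(2 * Real.pi / S * (ρ s * W s * Q s))) s) ∧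
      (∀ s, Q' s * W s + Q s * deriv W s / 2 = 2 * Real.pi / S * (ρ s * W s * D s)) ∧
      (∀ s ∉ Icc (a + δ) (b - δ), Q s = 0 ∧ |D s| = 1) ∧
      ∃ K, 0 ≤ K ∧ (∀ s, |Q s| ≤ K * √(W s)) ∧ ∀ s, |Q' s| ≤ K * W s := by
  have hcs : Continuous fun s => √(W s) := hW.contDiff.continuous.sqrt
  have hcρ : Continuous fun s => ρ s * √(W s) := hρc.mul hcs
  let Φ : ℝ → ℝ := fun s => 2 * ∫ t in a..s, ρ t * √(W t)
  have hΦd : ∀ s, HasDerivAt Φ (2 * (ρ s * √(W s))) s := fun s =>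
    ((hcρ.integral_hasStrictDerivAt a s).hasDerivAt).const_mul 2
  have hΦC : ContDiff ℝ 1 Φ := by
    rw [contDiff_one_iff_deriv]
    refine ⟨fun s => (hΦd s).differentiableAt, ?_⟩
    rw [show deriv Φ = fun s => 2 * (ρ s * √(W s)) from funext fun s => (hΦd s).deriv]
    fun_prop
  have hΦl : ∀ s < a + δ, Φ s = 0 := fun s hs => by
    simp only [Φ]
    rw [intervalIntegral.integral_congr (g := fun _ => 0)]
    · simp
    · intro t ht
      have : t < a + δ := lt_of_le_of_lt ht.2 (max_lt (by linarith) hs)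
      simp [hρ0 t (fun h => absurd h.1 (not_le.2 this))]
  have hΦr : ∀ s, b - δ < s → Φ s = S := fun s hs => by
    rw [hS]
    simp only [Φ]
    rw [← intervalIntegral.integral_add_adjacent_intervals (hcρ.intervalIntegrable a b)
      (hcρ.intervalIntegrable b s)]
    rw [intervalIntegral.integral_congr (a := b) (g := fun _ => 0)]
    · simp
    · intro t ht
      have : b - δ < t := lt_of_lt_of_le (lt_min (by linarith) hs) ht.1
      simp [hρ0 t (fun h => absurd h.2 (not_le.2 this))]
  let α : ℝ → ℝ := fun s => Real.pi / S * Φ s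
  let Q : ℝ → ℝ := fun s => Real.sin (α s) / √(W s)
  have hαC : ContDiff ℝ 1 α := contDiff_const.mul hΦC
  have hαd : ∀ s, HasDerivAt α (Real.pi / S * (2 * (ρ s * √(W s)))) s := fun s =>
    (hΦd s).const_mul _
  have hsin : ∀ s, s < a + δ ∨ b - δ < s → Real.sin (α s) = 0 := by
    rintro s (hs | hs)
    · simp [α, hΦl s hs]
    · simp [α, hΦr s hs, div_mul_cancel₀ _ hSpos.ne']
  have hout : IsOpen {s : ℝ | s < a + δ ∨ b - δ < s} := (isOpen_Iio.union isOpen_Ioi)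
  have hQloc : ∀ s, s < a + δ ∨ b - δ < s → Q =ᶠ[𝓝 s] fun _ => 0 := fun s hs => by
    filter_upwards [hout.mem_nhds hs] with t ht
    simp [Q, hsin t ht]
  have hin : ∀ s, ¬ (s < a + δ ∨ b - δ < s) → 0 < W s := fun s hs => by
    push Not at hs
    exact hW.pos s ⟨by linarith, by linarith⟩
  have hQC : ContDiff ℝ 1 Q := by
    rw [contDiff_iff_contDiffAt]
    intro s
    by_cases hs : s < a + δ ∨ b - δ < s
    · exact contDiffAt_const.congr_of_eventuallyEq (hQloc s hs)
    · exact ((Real.contDiff_sin.comp hαC).contDiffAt).div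
        ((hW.contDiff.of_le (by norm_num)).contDiffAt.sqrt (hin s hs).ne')
        (Real.sqrt_pos.2 (hin s hs)).ne'
  have hQd : ∀ s, HasDerivAt Q (deriv Q s) s := fun s =>
    ((hQC.differentiable (by norm_num)) s).hasDerivAt
  have hQ'c : Continuous (deriv Q) := hQC.continuous_deriv (by norm_num)
  have hnot : ∀ s, s ∉ Icc (a + δ) (b - δ) → s < a + δ ∨ b - δ < s := fun s hs => by
    rwa [mem_Icc, not_and_or, not_le, not_le] at hs
  have hQ0 : ∀ s ∉ Icc (a + δ) (b - δ), Q s = 0 := fun s hs => (hQloc s (hnot s hs)).eq_of_nhds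
  have hQ'0 : ∀ s ∉ Icc (a + δ) (b - δ), deriv Q s = 0 := fun s hs => by
    rw [(hQloc s (hnot s hs)).deriv_eq]; simp
  obtain ⟨K₁, hK₁, hQK⟩ := hW.exists_abs_le_mul hδ hQC.continuous hQ0 hcs
    (fun s => Real.sqrt_nonneg _) (fun s => Real.sqrt_pos.2)
  obtain ⟨K₂, hK₂, hQK'⟩ := hW.exists_abs_le_mul hδ hQ'c hQ'0 hW.contDiff.continuous
    hW.nonneg (fun s => id)
  refine ⟨Q, deriv Q, fun s => Real.cos (α s), hQ'c, hQd, ?_, ?_, ?_, max K₁ K₂,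
    le_max_of_le_left hK₁, ?_, ?_⟩
  · intro s
    convert (hαd s).cos using 1
    by_cases hs : s < a + δ ∨ b - δ < s
    · simp [hQ0 s (fun h => by rcases hs with hs | hs <;> linarith [h.1, h.2]), hsin s hs]
    · have hq : √(W s) ≠ 0 := (Real.sqrt_pos.2 (hin s hs)).ne'
      have : W s * Q s = √(W s) * Real.sin (α s) := by
        simp only [Q]
        nth_rewrite 1 [← Real.mul_self_sqrt (hW.nonneg s)]
        field_simp
      rw [mul_assoc (ρ s), this]
      ring
  · intro s
    by_cases hs : s < a + δ ∨ b - δ < s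
    · have h1 : s ∉ Icc (a + δ) (b - δ) := fun h => by
        rcases hs with hs | hs <;> linarith [h.1, h.2]
      simp [hQ0 s h1, hQ'0 s h1, hρ0 s h1]
    · have hWs := hin s hs
      have hq : √(W s) ≠ 0 := (Real.sqrt_pos.2 hWs).ne'
      -- differentiate `Q √W = sin α`
      have d1 : HasDerivAt (fun s => Q s * √(W s))
          (deriv Q s * √(W s) + Q s * (deriv W s / (2 * √(W s)))) s :=
        (hQd s).mul ((hW.contDiff.differentiable (by norm_num) s).hasDerivAt.sqrt hWs.ne')
      have d2 : HasDerivAt (fun s => Real.sin (α s))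
          (Real.cos (α s) * (Real.pi / S * (2 * (ρ s * √(W s))))) s := (hαd s).sin
      have heq : (fun s => Q s * √(W s)) =ᶠ[𝓝 s] fun s => Real.sin (α s) := by
        filter_upwards [hW.contDiff.continuous.continuousAt.eventually (lt_mem_nhds hWs)] with t ht
        exact div_mul_cancel₀ _ (Real.sqrt_pos.2 ht).ne'
      have d3 := d1.unique (d2.congr_of_eventuallyEq heq)
      have d4 := congrArg (fun x => x * √(W s)) d3
      have d5 : √(W s) * √(W s) = W s := Real.mul_self_sqrt hWs.le
      calc deriv Q s * W s + Q s * deriv W s / 2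
          = (deriv Q s * √(W s) + Q s * (deriv W s / (2 * √(W s)))) * √(W s) := by
            rw [add_mul, mul_assoc, d5]; field_simp
        _ = Real.cos (α s) * (Real.pi / S * (2 * (ρ s * √(W s)))) * √(W s) := d4
        _ = 2 * Real.pi / S * (ρ s * (√(W s) * √(W s)) * Real.cos (α s)) := by ring
        _ = _ := by rw [d5]
  · intro s hs
    refine ⟨hQ0 s hs, ?_⟩
    have h1 := Real.sin_sq_add_cos_sq (α s)
    rw [hsin s (hnot s hs)] at h1
    rw [← sq_eq_sq₀ (abs_nonneg _) zero_le_one, sq_abs]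
    linarith
  · exact fun s => (hQK s).trans (mul_le_mul_of_nonneg_right (le_max_left _ _) (Real.sqrt_nonneg _))
  · exact fun s => (hQK' s).trans (mul_le_mul_of_nonneg_right (le_max_right _ _) (hW.nonneg _))

namespace IsProfile

variable {W m : ℝ → ℝ} {M C A B ε : ℝ} {w p H : ℝ → ℝ} {a b : ℝ}

/-- The rotation identity, integrated: the angle swept between two points at which `w` is close to
the wells is a multiple of `π`, up to an error of order `√ε`. -/
theorem abs_sin_le (h : IsProfile W m M C A B ε w p H) (hAB : A < B)
    (hW : IsDoubleWell W a b) {δ lam : ℝ} {ρ Q Q' D : ℝ → ℝ} (hρc : Continuous ρ)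
    (hQ'c : Continuous Q') (hQd : ∀ s, HasDerivAt Q (Q' s) s)
    (hDd : ∀ s, HasDerivAt D (-(lam * (ρ s * W s * Q s))) s)
    (hQD : ∀ s, Q' s * W s + Q s * deriv W s / 2 = lam * (ρ s * W s * D s))
    (hout : ∀ s ∉ Icc (a + δ) (b - δ), Q s = 0 ∧ |D s| = 1)
    {K : ℝ} (hK : 0 ≤ K) (hQK : ∀ s, |Q s| ≤ K * √(W s)) (hQ'K : ∀ s, |Q' s| ≤ K * W s)
    {r s : ℝ} (hr : r ∈ Icc A B) (hs : s ∈ Icc A B) (hrs : r ≤ s)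
    (hwr : w r ∉ Icc (a + δ) (b - δ)) (hws : w s ∉ Icc (a + δ) (b - δ)) :
    |Real.sin (∫ t in r..s, lam * (ρ (w t) * W (w t)) / ε)| ≤
      (K * (C / (B - A) + C + 2 * M * C) * C + K * C + M * K * C) * √ε := by
  have hε := h.eps_pos
  have hM := h.curv_nonneg hAB.le
  have hC := h.const_nonneg hAB.le hW
  set K₁ := C / (B - A) + C + 2 * M * C with hK₁
  have hK₁0 : 0 ≤ K₁ := by have := sub_pos.2 hAB; positivity
  have hWc := hW.contDiff.continuous
  -- the angle, extended beyond `[A, B]` to a function of class `C¹` on the line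
  let g : ℝ → ℝ := fun t => lam * (ρ (w (projIcc A B hAB.le t)) * W (w (projIcc A B hAB.le t))) / ε
  have hgc : Continuous g := by
    have hcw : Continuous fun t => w (projIcc A B hAB.le t) :=
      (continuousOn_iff_continuous_domRestrict.1 h.continuousOn_w).comp continuous_projIcc
    exact (continuous_const.mul ((hρc.comp hcw).mul (hWc.comp hcw))).div_const ε
  have hg : ∀ t ∈ Icc A B, g t = lam * (ρ (w t) * W (w t)) / ε := fun t ht => by
    simp only [g, projIcc_of_mem hAB.le ht]
  let θ : ℝ → ℝ := fun t => ∫ x in r..t, g x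
  have hθd : ∀ t, HasDerivAt θ (g t) t := fun t => (hgc.integral_hasStrictDerivAt r t).hasDerivAt
  have hθc : Continuous θ := continuous_iff_continuousAt.2 fun t => (hθd t).continuousAt
  have hcos : IsPrimitiveOn (fun t => Real.cos (θ t)) (fun t => -Real.sin (θ t) * g t) A B :=
    IsPrimitiveOn.of_hasDerivAt (fun t _ => (hθd t).cos) (by fun_prop) hAB.le
  have hsin : IsPrimitiveOn (fun t => Real.sin (θ t)) (fun t => Real.cos (θ t) * g t) A B :=
    IsPrimitiveOn.of_hasDerivAt (fun t _ => (hθd t).sin) (by fun_prop) hAB.le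
  have hQc : Continuous Q := continuous_iff_continuousAt.2 fun t => (hQd t).continuousAt
  have hprim := ((h.equation.mul (h.isPrimitiveOn_comp hAB.le hQd hQ'c) hAB.le).mul hcos
    hAB.le).sub ((h.isPrimitiveOn_comp hAB.le hDd (by fun_prop)).mul hsin hAB.le)
  have hY : IsPrimitiveOn (fun t => p t * Q (w t) * Real.cos (θ t) - D (w t) * Real.sin (θ t))
      (fun t => (Q' (w t) * (p t ^ 2 - W (w t)) / ε + H t * Q (w t) / 2 - m t * (p t * Q (w t)))
        * Real.cos (θ t)) A B := by
    refine hprim.congr_deriv (fun t ht => ?_) hAB.le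
    rw [hg t ht]
    have hqd := hQD (w t)
    have e : Real.cos (θ t) * (lam * (ρ (w t) * W (w t)) / ε) * D (w t)
      = (Q' (w t) * W (w t) + Q (w t) * deriv W (w t) / 2) / ε * Real.cos (θ t) := by
      rw [hqd]; ring
    have e2 : D (w t) * (Real.cos (θ t) * (lam * (ρ (w t) * W (w t)) / ε))
      = (Q' (w t) * W (w t) + Q (w t) * deriv W (w t) / 2) / ε * Real.cos (θ t) := by
      rw [← e]; ring
    rw [e2]
    field_simp
    ring
  have hei := h.intervalIntegrable_energy hAB.le hW
  have hfi := h.intervalIntegrable_forcing hAB.le hW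
  have hbound := hY.abs_sub_le (((hei.const_mul (K * K₁ * √ε / ε)).add (hfi.const_mul K)).add
    (hei.const_mul (M * K))) (fun t ht => by
      obtain ⟨h1, h2, h3⟩ := abs_le_sqrt_energy (p := p t) (hW.nonneg (w t))
      have hWn := hW.nonneg (w t)
      have hξ := h.discrepancy_le hAB hW ht
      have hmt := h.curv_le t ht
      have he := energy_nonneg (w := w) (p := p) hW t
      have hWe : W (w t) ≤ p t ^ 2 + W (w t) := by nlinarith [sq_nonneg (p t)]
      have hQt := hQK (w t)
      have hQ't := hQ'K (w t)
      set e := p t ^ 2 + W (w t)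
      have b1 : |Q' (w t) * (p t ^ 2 - W (w t)) / ε| ≤ K * K₁ * √ε / ε * e := by
        rw [abs_div, abs_mul, abs_of_pos hε]
        calc |Q' (w t)| * |p t ^ 2 - W (w t)| / ε ≤ (K * e) * (K₁ * √ε) / ε := by
              gcongr
              exact hQ't.trans (by gcongr)
          _ = _ := by ring
      have b2 : |H t * Q (w t) / 2| ≤ K * (|H t| * √e) := by
        rw [abs_div, abs_mul, abs_two]
        have : |H t| * |Q (w t)| ≤ |H t| * (K * √e) := by
          gcongr
          exact hQt.trans (by gcongr)
        have : 0 ≤ |H t| * |Q (w t)| := by positivity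
        linarith
      have b3 : |m t * (p t * Q (w t))| ≤ M * K * e := by
        rw [abs_mul, abs_mul, mul_assoc M]
        apply mul_le_mul hmt _ (by positivity) hM
        calc |p t| * |Q (w t)| ≤ |p t| * (K * √(W (w t))) := by gcongr
          _ = K * (|p t| * √(W (w t))) := by ring
          _ ≤ K * e := by gcongr
      rw [abs_mul]
      calc _ ≤ |Q' (w t) * (p t ^ 2 - W (w t)) / ε + H t * Q (w t) / 2 - m t * (p t * Q (w t))| * 1
            := by gcongr; exact Real.abs_cos_le_one _
        _ ≤ |Q' (w t) * (p t ^ 2 - W (w t)) / ε| + |H t * Q (w t) / 2| + |m t * (p t * Q (w t))| := by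
            rw [mul_one]
            exact (abs_sub _ _).trans (by gcongr; exact abs_add_le _ _)
        _ ≤ _ := by gcongr) hs hr
  have hθr : θ r = 0 := by simp [θ]
  have hθs : θ s = ∫ t in r..s, lam * (ρ (w t) * W (w t)) / ε := by
    apply intervalIntegral.integral_congr
    intro t ht
    rw [uIcc_of_le hrs] at ht
    exact hg t ⟨hr.1.trans ht.1, ht.2.trans hs.2⟩
  rw [(hout _ hwr).1, (hout _ hws).1, hθr, hθs] at hbound
  simp only [mul_zero, zero_mul, Real.sin_zero, sub_zero, zero_sub, abs_neg, abs_mul,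
    (hout _ hws).2, one_mul] at hbound
  refine hbound.trans ?_
  rw [intervalIntegral.integral_add ((hei.const_mul _).add (hfi.const_mul _)) (hei.const_mul _),
    intervalIntegral.integral_add (hei.const_mul _) (hfi.const_mul _),
    intervalIntegral.integral_const_mul, intervalIntegral.integral_const_mul,
    intervalIntegral.integral_const_mul]
  have j1 : K * K₁ * √ε / ε * (∫ r in A..B, (p r ^ 2 + W (w r))) ≤ K * K₁ * √ε / ε * (C * ε) := by
    gcongr; exact h.energy_le
  have j2 : K * (∫ r in A..B, |H r| * √(p r ^ 2 + W (w r))) ≤ K * (C * √ε) := by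
    gcongr; exact h.forcing_le
  have j3 : M * K * (∫ r in A..B, (p r ^ 2 + W (w r))) ≤ M * K * (C * √ε) := by
    gcongr; exact h.energy_le.trans (by gcongr; exact h.eps_le_sqrt)
  have j4 : K * K₁ * √ε / ε * (C * ε) = K * K₁ * C * √ε := by field_simp
  linarith

end IsProfile

/-- Outside the set where `ρ(w) = 1` the energy is small, uniformly for all profiles. -/
theorem IsDoubleWell.exists_cutoff {W : ℝ → ℝ} {a b : ℝ} (hW : IsDoubleWell W a b)
    {A A' B' B : ℝ} (hA : A < A') (hAB' : A' < B') (hB : B' < B) {M C : ℝ} (hM : 0 ≤ M)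
    (hC : 0 ≤ C) {τ : ℝ} (hτ : 0 < τ) :
    ∃ δ > 0, a + δ < b - δ ∧ ∃ ρ : ℝ → ℝ, Continuous ρ ∧ (∀ s, 0 ≤ ρ s) ∧ (∀ s, ρ s ≤ 1) ∧
      (∀ s ∉ Icc (a + δ) (b - δ), ρ s = 0) ∧
      surfaceTension W a b - τ ≤ 2 * ∫ s in a..b, ρ s * √(W s) ∧
      ∃ K, 0 ≤ K ∧ ∀ {m w p H : ℝ → ℝ} {ε : ℝ}, IsProfile W m M C A B ε w p H →
        ∫ r in A'..B', (1 - ρ (w r)) * (p r ^ 2 + W (w r)) ≤ (τ + K * √ε) * ε := by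
  have hAB : A < B := by linarith
  set c := (A' - A) * (B - B') with hc
  have hc0 : 0 < c := mul_pos (by linarith) (by linarith)
  have hℓ : 0 < B - A := by linarith
  obtain ⟨δ, hδ, hδab, ρ, ψ, ψ', hρc, hψ'c, hψd, hρ0, hρ1, hρs, hσ, hψ', hWψ, K, hK, hψK⟩ :=
    exists_cutoff_test hW (τ := min τ (τ * c / (2 * (B - A) ^ 2 * (C + 1)))) (by positivity)
  have hτ2 := min_le_right τ (τ * c / (2 * (B - A) ^ 2 * (C + 1)))
  have hτ1 := min_le_left τ (τ * c / (2 * (B - A) ^ 2 * (C + 1)))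
  have hτ0 : 0 ≤ min τ (τ * c / (2 * (B - A) ^ 2 * (C + 1))) := by positivity
  set τ₁ := min τ (τ * c / (2 * (B - A) ^ 2 * (C + 1)))
  refine ⟨δ, hδ, hδab, ρ, hρc, hρ0, hρ1, hρs, by linarith,
    (4 * (B - A) ^ 2 * K * (1 + M) + 4 * (B - A) * K) * C / c, by positivity,
    fun {m w p H ε} h => ?_⟩
  have hmain := h.energy_off_cutoff_le hAB hW hρc hψ'c hψd hρ1 hτ0 hψ' hWψ hK hψK
  have hcont : ContinuousOn (fun r => (1 - ρ (w r)) * (p r ^ 2 + W (w r))) (Icc A B) :=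
    (continuousOn_const.sub (h.continuousOn_comp hρc)).mul (h.continuousOn_energy hAB.le hW)
  have hη : Continuous fun r : ℝ => (r - A) * (B - r) := by fun_prop
  have hnn : ∀ r, 0 ≤ (1 - ρ (w r)) * (p r ^ 2 + W (w r)) := fun r =>
    mul_nonneg (by linarith [hρ1 (w r)]) (IsProfile.energy_nonneg hW r)
  have hi : IntervalIntegrable (fun r => (r - A) * (B - r) * ((1 - ρ (w r)) * (p r ^ 2 + W (w r))))
      volume A B := ContinuousOn.intervalIntegrable (by
    rw [uIcc_of_le hAB.le]; exact hη.continuousOn.mul hcont)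
  have hsub : Icc A' B' ⊆ Icc A B := Icc_subset_Icc hA.le hB.le
  have hle : c * ∫ r in A'..B', (1 - ρ (w r)) * (p r ^ 2 + W (w r)) ≤
      ∫ r in A..B, (r - A) * (B - r) * ((1 - ρ (w r)) * (p r ^ 2 + W (w r))) := by
    calc _ = ∫ r in A'..B', c * ((1 - ρ (w r)) * (p r ^ 2 + W (w r))) := by
          rw [intervalIntegral.integral_const_mul]
      _ ≤ ∫ r in A'..B', (r - A) * (B - r) * ((1 - ρ (w r)) * (p r ^ 2 + W (w r))) := by
          apply intervalIntegral.integral_mono_on hAB'.le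
          · apply ContinuousOn.intervalIntegrable
            rw [uIcc_of_le hAB'.le]
            exact continuousOn_const.mul (hcont.mono hsub)
          · exact hi.mono_set (by rwa [uIcc_of_le hAB'.le, uIcc_of_le hAB.le])
          · intro r hr
            apply mul_le_mul_of_nonneg_right _ (hnn r)
            exact mul_le_mul (by linarith [hr.1]) (by linarith [hr.2]) (by linarith)
              (by linarith [hr.1])
      _ ≤ _ := by
          apply intervalIntegral.integral_mono_interval hA.le hAB'.le hB.le _ hi
          exact (ae_restrict_iff' measurableSet_Ioc).2 (ae_of_all _ fun r hr =>
            mul_nonneg (mul_nonneg (by linarith [hr.1]) (by linarith [hr.2])) (hnn r))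
  have hτc : 2 * (B - A) ^ 2 * τ₁ * C ≤ τ * c := by
    rw [le_div_iff₀ (by positivity)] at hτ2
    have : 0 ≤ 2 * (B - A) ^ 2 * τ₁ := by positivity
    linarith
  have hε := h.eps_pos
  rw [← mul_le_mul_iff_right₀ hc0]
  refine hle.trans (hmain.trans ?_)
  have e : c * ((τ + (4 * (B - A) ^ 2 * K * (1 + M) + 4 * (B - A) * K) * C / c * √ε) * ε)
      = (τ * c + (4 * (B - A) ^ 2 * K * (1 + M) + 4 * (B - A) * K) * C * √ε) * ε := by
    field_simp
  rw [e]
  gcongr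

theorem exists_int_abs_sub_le_of_abs_sin_le {x η : ℝ} (h : |Real.sin (Real.pi * x)| ≤ η) :
    ∃ j : ℤ, |x - j| ≤ η / 2 := by
  refine ⟨round x, ?_⟩
  have hpi := Real.pi_pos
  have h1 : |x - round x| ≤ 1 / 2 := abs_sub_round x
  have h2 : |Real.sin (Real.pi * x)| = Real.sin (Real.pi * |x - round x|) := by
    have e1 : |Real.sin (Real.pi * x)| = |Real.sin (Real.pi * (x - round x))| := by
      rw [mul_sub, mul_comm Real.pi (round x : ℝ), Real.sin_sub_int_mul_pi, abs_mul, abs_zpow]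
      simp
    rw [e1]
    have h0 : 0 ≤ Real.sin (Real.pi * |x - round x|) :=
      Real.sin_nonneg_of_nonneg_of_le_pi (by positivity) (by nlinarith)
    rw [← abs_of_nonneg h0]
    rcases abs_cases (x - round x) with ⟨h3, -⟩ | ⟨h3, -⟩
    · rw [h3]
    · rw [h3, mul_neg, Real.sin_neg, abs_neg]
  have h3 : 2 / Real.pi * (Real.pi * |x - round x|) ≤ Real.sin (Real.pi * |x - round x|) :=
    Real.mul_le_sin (by positivity) (by nlinarith)
  have h4 : 2 / Real.pi * (Real.pi * |x - round x|) = 2 * |x - round x| := by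
    field_simp
  rw [h4, ← h2] at h3
  linarith

namespace IsProfile

variable {W m : ℝ → ℝ} {M C A B ε : ℝ} {w p H : ℝ → ℝ} {a b : ℝ}

theorem intervalIntegrable_of_continuousOn {f : ℝ → ℝ} (hf : ContinuousOn f (Icc A B)) {x y : ℝ}
    (hx : A ≤ x) (hxy : x ≤ y) (hy : y ≤ B) : IntervalIntegrable f volume x y :=
  ContinuousOn.intervalIntegrable (by rw [uIcc_of_le hxy]; exact hf.mono (Icc_subset_Icc hx hy))

theorem integral_energy_le (h : IsProfile W m M C A B ε w p H) (hAB : A ≤ B)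
    (hW : IsDoubleWell W a b) {x y : ℝ} (hx : A ≤ x) (hxy : x ≤ y) (hy : y ≤ B) :
    ∫ t in x..y, (p t ^ 2 + W (w t)) ≤ C * ε :=
  (intervalIntegral.integral_mono_interval hx hxy hy (ae_of_all _ fun t => energy_nonneg hW t)
    (h.intervalIntegrable_energy hAB hW)).trans h.energy_le

theorem continuousOn_discrepancy (h : IsProfile W m M C A B ε w p H) (hAB : A ≤ B)
    (hW : IsDoubleWell W a b) : ContinuousOn (fun r => |p r ^ 2 - W (w r)|) (Icc A B) :=
  (((h.continuousOn_p hAB).pow 2).sub (h.continuousOn_comp hW.contDiff.continuous)).abs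

theorem continuousOn_off_cutoff (h : IsProfile W m M C A B ε w p H) (hAB : A ≤ B)
    (hW : IsDoubleWell W a b) {ρ : ℝ → ℝ} (hρc : Continuous ρ) :
    ContinuousOn (fun r => (1 - ρ (w r)) * (p r ^ 2 + W (w r))) (Icc A B) :=
  (continuousOn_const.sub (h.continuousOn_comp hρc)).mul (h.continuousOn_energy hAB hW)

/-- The `L¹` norm of the discrepancy: where `ρ(w)` vanishes the energy is small, where it does not
the discrepancy is uniformly small and `W(w)` is bounded below. -/
theorem integral_discrepancy_le (h : IsProfile W m M C A B ε w p H) (hAB : A < B)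
    (hW : IsDoubleWell W a b) {ρ : ℝ → ℝ} (hρc : Continuous ρ) (hρ0 : ∀ s, 0 ≤ ρ s)
    (hρ1 : ∀ s, ρ s ≤ 1) {K : ℝ} (hK : 0 ≤ K) (hρK : ∀ s, |ρ s| ≤ K * W s) {A' B' : ℝ}
    (hA : A ≤ A') (hAB' : A' ≤ B') (hB : B' ≤ B) :
    ∫ r in A'..B', |p r ^ 2 - W (w r)| ≤ (∫ r in A'..B', (1 - ρ (w r)) * (p r ^ 2 + W (w r))) +
      K * (C / (B - A) + C + 2 * M * C) * C * √ε * ε := by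
  have hM := h.curv_nonneg hAB.le
  have hC := h.const_nonneg hAB.le hW
  set K₁ := C / (B - A) + C + 2 * M * C with hK₁
  have hK₁0 : 0 ≤ K₁ := by have := sub_pos.2 hAB; positivity
  have hec := h.continuousOn_energy hAB.le hW
  have hoffc := h.continuousOn_off_cutoff hAB.le hW hρc
  have hmajc : ContinuousOn (fun r => K * (K₁ * √ε) * (p r ^ 2 + W (w r))) (Icc A B) :=
    continuousOn_const.mul hec
  calc ∫ r in A'..B', |p r ^ 2 - W (w r)|
      ≤ ∫ r in A'..B', ((1 - ρ (w r)) * (p r ^ 2 + W (w r))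
          + K * (K₁ * √ε) * (p r ^ 2 + W (w r))) := by
        apply intervalIntegral.integral_mono_on hAB'
          (intervalIntegrable_of_continuousOn (h.continuousOn_discrepancy hAB.le hW) hA hAB' hB)
          (intervalIntegrable_of_continuousOn (hoffc.add hmajc) hA hAB' hB)
        intro r hr
        have h1 := h.discrepancy_le hAB hW (Icc_subset_Icc hA hB hr)
        have hWn := hW.nonneg (w r)
        have h2 : |p r ^ 2 - W (w r)| ≤ p r ^ 2 + W (w r) := by
          rw [abs_le]; constructor <;> nlinarith [sq_nonneg (p r)]
        have h3 := hρK (w r)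
        rw [abs_of_nonneg (hρ0 _)] at h3
        have h4 : W (w r) ≤ p r ^ 2 + W (w r) := by nlinarith [sq_nonneg (p r)]
        calc |p r ^ 2 - W (w r)|
            = (1 - ρ (w r)) * |p r ^ 2 - W (w r)| + ρ (w r) * |p r ^ 2 - W (w r)| := by ring
          _ ≤ (1 - ρ (w r)) * (p r ^ 2 + W (w r)) + K * (p r ^ 2 + W (w r)) * (K₁ * √ε) := by
              apply add_le_add
              · exact mul_le_mul_of_nonneg_left h2 (by linarith [hρ1 (w r)])
              · exact mul_le_mul (h3.trans (by gcongr)) h1 (abs_nonneg _) (by positivity)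
          _ = (1 - ρ (w r)) * (p r ^ 2 + W (w r)) + K * (K₁ * √ε) * (p r ^ 2 + W (w r)) := by ring
    _ ≤ (∫ r in A'..B', (1 - ρ (w r)) * (p r ^ 2 + W (w r))) + K * (K₁ * √ε) * (C * ε) := by
        rw [intervalIntegral.integral_add (intervalIntegrable_of_continuousOn hoffc hA hAB' hB)
          (intervalIntegrable_of_continuousOn hmajc hA hAB' hB),
          intervalIntegral.integral_const_mul]
        have := h.integral_energy_le hAB.le hW hA hAB' hB
        gcongr
    _ = _ := by ring

theorem abs_energy_sub_cutoff_le (h : IsProfile W m M C A B ε w p H) (hAB : A < B)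
    (hW : IsDoubleWell W a b) {ρ : ℝ → ℝ} (hρc : Continuous ρ)
    (hρ1 : ∀ s, ρ s ≤ 1) {A' B' r s : ℝ} (hA : A ≤ A') (hB : B' ≤ B)
    (hr : A' ≤ r) (hrs : r ≤ s) (hs : s ≤ B') :
    |(∫ t in r..s, (p t ^ 2 + W (w t))) - 2 * ∫ t in r..s, ρ (w t) * W (w t)| ≤
      (∫ t in A'..B', |p t ^ 2 - W (w t)|) +
        2 * ∫ t in A'..B', (1 - ρ (w t)) * (p t ^ 2 + W (w t)) := by
  have hAB' : A' ≤ B' := by linarith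
  have hrA : A ≤ r := by linarith
  have hsB : s ≤ B := by linarith
  have hoffc := h.continuousOn_off_cutoff hAB.le hW hρc
  have hoffc2 : ContinuousOn (fun t => 2 * ((1 - ρ (w t)) * (p t ^ 2 + W (w t)))) (Icc A B) :=
    continuousOn_const.mul hoffc
  have hξc := h.continuousOn_discrepancy hAB.le hW
  have hρWc : ContinuousOn (fun t => 2 * (ρ (w t) * W (w t))) (Icc A B) :=
    continuousOn_const.mul
      ((h.continuousOn_comp hρc).mul (h.continuousOn_comp hW.contDiff.continuous))
  have e1 : (∫ t in r..s, (p t ^ 2 + W (w t))) - 2 * ∫ t in r..s, ρ (w t) * W (w t)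
      = ∫ t in r..s, ((p t ^ 2 - W (w t)) + 2 * ((1 - ρ (w t)) * W (w t))) := by
    rw [← intervalIntegral.integral_const_mul, ← intervalIntegral.integral_sub
      (intervalIntegrable_of_continuousOn (h.continuousOn_energy hAB.le hW) hrA hrs hsB)
      (intervalIntegrable_of_continuousOn hρWc hrA hrs hsB)]
    congr 1
    funext t
    ring
  have hmajc : ContinuousOn (fun t => |p t ^ 2 - W (w t)|
      + 2 * ((1 - ρ (w t)) * (p t ^ 2 + W (w t)))) (Icc A B) := hξc.add hoffc2
  have hmaj0 : ∀ t, 0 ≤ |p t ^ 2 - W (w t)| + 2 * ((1 - ρ (w t)) * (p t ^ 2 + W (w t))) :=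
    fun t => add_nonneg (abs_nonneg _) (mul_nonneg zero_le_two
      (mul_nonneg (by linarith [hρ1 (w t)]) (energy_nonneg hW t)))
  have hpt : ∀ t, ‖(p t ^ 2 - W (w t)) + 2 * ((1 - ρ (w t)) * W (w t))‖ ≤
      |p t ^ 2 - W (w t)| + 2 * ((1 - ρ (w t)) * (p t ^ 2 + W (w t))) := fun t => by
    have hρt : 0 ≤ 1 - ρ (w t) := by linarith [hρ1 (w t)]
    have h5 : 0 ≤ 2 * ((1 - ρ (w t)) * W (w t)) :=
      mul_nonneg zero_le_two (mul_nonneg hρt (hW.nonneg _))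
    refine (norm_add_le _ _).trans ?_
    rw [Real.norm_of_nonneg h5, Real.norm_eq_abs]
    have : (1 - ρ (w t)) * W (w t) ≤ (1 - ρ (w t)) * (p t ^ 2 + W (w t)) :=
      mul_le_mul_of_nonneg_left (by nlinarith [sq_nonneg (p t)]) hρt
    linarith
  rw [e1]
  calc _ ≤ ∫ t in r..s, (|p t ^ 2 - W (w t)| + 2 * ((1 - ρ (w t)) * (p t ^ 2 + W (w t)))) :=
        intervalIntegral.norm_integral_le_of_norm_le hrs (ae_of_all _ fun t _ => hpt t)
          (intervalIntegrable_of_continuousOn hmajc hrA hrs hsB)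
    _ ≤ ∫ t in A'..B', (|p t ^ 2 - W (w t)| + 2 * ((1 - ρ (w t)) * (p t ^ 2 + W (w t)))) :=
        intervalIntegral.integral_mono_interval hr hrs hs (ae_of_all _ hmaj0)
          (intervalIntegrable_of_continuousOn hmajc hA hAB' hB)
    _ = _ := by
        rw [intervalIntegral.integral_add (intervalIntegrable_of_continuousOn hξc hA hAB' hB)
          (intervalIntegrable_of_continuousOn hoffc2 hA hAB' hB),
          intervalIntegral.integral_const_mul]

end IsProfile

/-- Two energies `X` and `Z`, close to each other and measured in the close units `σ` and `S`. -/
theorem abs_div_sub_div_le {X Z C σ S τ E ε : ℝ} (hε : 0 < ε) (hσ : 0 < σ) (hX : 0 ≤ X)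
    (hXC : X ≤ C * ε) (hXZ : |X - Z| ≤ (3 * τ + E) * ε) (hS : σ / 2 ≤ S) (hSσ : S ≤ σ)
    (hτ : σ - S ≤ τ) :
    |X / (ε * σ) - Z / (ε * S)| ≤ τ * (2 * C / σ ^ 2 + 6 / σ) + 2 * E / σ := by
  have hS0 : 0 < S := by linarith
  have e1 : X / (ε * σ) - Z / (ε * S) = (X - Z) / (ε * S) - X * (σ - S) / (ε * (σ * S)) := by
    field_simp; ring
  have hσS : 0 ≤ σ - S := by linarith
  have i1 : |(X - Z) / (ε * S)| ≤ (3 * τ + E) / (σ / 2) := by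
    rw [abs_div, abs_of_pos (mul_pos hε hS0), div_le_div_iff₀ (by positivity) (by positivity)]
    calc |X - Z| * (σ / 2) ≤ ((3 * τ + E) * ε) * S :=
          mul_le_mul hXZ hS (by positivity) ((abs_nonneg _).trans hXZ)
      _ = _ := by ring
  have i2 : |X * (σ - S) / (ε * (σ * S))| ≤ C * τ / (σ * (σ / 2)) := by
    rw [abs_of_nonneg (by positivity), div_le_div_iff₀ (by positivity) (by positivity)]
    calc X * (σ - S) * (σ * (σ / 2)) ≤ (C * ε) * τ * (σ * S) := by
          have : 0 ≤ C * ε := hX.trans hXC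
          have : 0 ≤ τ := hσS.trans hτ
          gcongr
      _ = _ := by ring
  rw [e1]
  refine (abs_sub _ _).trans ((add_le_add i1 i2).trans (le_of_eq ?_))
  field_simp
  ring

/-- Equipartition of energy and quantization: on compact subintervals the discrepancy of a profile
is small in `L¹`, and the energy between two points at which `w` is close to the wells is
close to an integer multiple of the surface tension. -/
theorem IsDoubleWell.exists_quantization {W : ℝ → ℝ} {a b : ℝ} (hW : IsDoubleWell W a b)
    {A A' B' B : ℝ} (hA : A < A') (hAB' : A' < B') (hB : B' < B) {M C : ℝ} (hM : 0 ≤ M)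
    (hC : 0 ≤ C) {τ : ℝ} (hτ : 0 < τ) :
    ∃ K, 0 ≤ K ∧ ∃ δ > 0, ∀ {m w p H : ℝ → ℝ} {ε : ℝ}, IsProfile W m M C A B ε w p H →
      ∫ r in A'..B', |p r ^ 2 - W (w r)| ≤ (τ + K * √ε) * ε ∧
      ∀ r s, A' ≤ r → r ≤ s → s ≤ B' → W (w r) < δ → W (w s) < δ → ∃ j : ℤ,
        |(∫ t in r..s, (p t ^ 2 + W (w t))) / (ε * surfaceTension W a b) - j| ≤ τ + K * √ε := by
  have hAB : A < B := by linarith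
  have hσ := integral_sqrt_pos hW
  set σ := surfaceTension W a b with hσdef
  have hℓ : 0 < B - A := by linarith
  set τ₁ := min (min τ (σ / 2)) (τ / (2 * C / σ ^ 2 + 6 / σ)) with hτ₁
  have hτ₁0 : 0 < τ₁ := by positivity
  have hτ₁a : τ₁ ≤ τ := (min_le_left _ _).trans (min_le_left _ _)
  have hτ₁b : τ₁ ≤ σ / 2 := (min_le_left _ _).trans (min_le_right _ _)
  have hτ₁c : τ₁ * (2 * C / σ ^ 2 + 6 / σ) ≤ τ := by
    rw [← le_div_iff₀ (by positivity)]; exact min_le_right _ _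
  obtain ⟨δ, hδ, hδab, ρ, hρc, hρ0, hρ1, hρs, hσρ, K, hK, hoff⟩ :=
    hW.exists_cutoff hA hAB' hB hM hC hτ₁0
  set S := 2 * ∫ s in a..b, ρ s * √(W s) with hS
  have hS0 : 0 < S := by linarith
  have hSσ : S ≤ σ := by
    rw [hS, hσdef, surfaceTension]
    have hcs : Continuous fun s => √(W s) := hW.contDiff.continuous.sqrt
    gcongr
    apply intervalIntegral.integral_mono_on hW.lt.le
      ((show Continuous fun s => ρ s * √(W s) by fun_prop).intervalIntegrable _ _)
      (hcs.intervalIntegrable _ _)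
    intro s _
    exact mul_le_of_le_one_left (Real.sqrt_nonneg _) (hρ1 s)
  obtain ⟨Q, Q', D, hQ'c, hQd, hDd, hQD, hQout, K₂, hK₂, hQK, hQ'K⟩ :=
    exists_angle_functions hW hδ hρc hρs hS hS0
  obtain ⟨K₃, hK₃, hρK⟩ := hW.exists_abs_le_mul hδ hρc hρs hW.contDiff.continuous hW.nonneg
    (fun s => id)
  obtain ⟨δ₁, hδ₁, hout⟩ : ∃ δ₁ > 0, ∀ s, W s < δ₁ → s ∉ Icc (a + δ) (b - δ) := by
    obtain ⟨s₀, hs₀, hmin⟩ := (isCompact_Icc (a := a + δ) (b := b - δ)).exists_isMinOn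
      ⟨a + δ, le_rfl, hδab.le⟩ hW.contDiff.continuous.continuousOn
    exact ⟨W s₀, hW.pos s₀ ⟨by linarith [hs₀.1], by linarith [hs₀.2]⟩,
      fun s hs hmem => absurd (hmin hmem) (not_le.2 hs)⟩
  set K₁ := C / (B - A) + C + 2 * M * C with hK₁
  have hK₁0 : 0 ≤ K₁ := by positivity
  set K₄ := K₂ * K₁ * C + K₂ * C + M * K₂ * C with hK₄
  have hK₄0 : 0 ≤ K₄ := by positivity
  -- error constants of the discrepancy and of the energy
  set E₁ := K + K₃ * K₁ * C with hE₁
  have hE₁0 : 0 ≤ E₁ := by positivity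
  refine ⟨E₁ + (K₄ / 2 + 2 * (E₁ + 2 * K) / σ), by positivity, δ₁, hδ₁, fun {m w p H ε} h => ?_⟩
  have hε := h.eps_pos
  have hoff := hoff h
  have hξ : ∫ r in A'..B', |p r ^ 2 - W (w r)| ≤ (τ₁ + E₁ * √ε) * ε := by
    refine (h.integral_discrepancy_le hAB hW hρc hρ0 hρ1 hK₃ hρK hA.le hAB'.le hB.le).trans ?_
    calc _ ≤ (τ₁ + K * √ε) * ε + K₃ * K₁ * C * √ε * ε := by gcongr
      _ = _ := by rw [hE₁]; ring
  have h4 : 0 ≤ K₄ / 2 * √ε := by positivity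
  have h5 : 0 ≤ 2 * (E₁ + 2 * K) / σ * √ε := by positivity
  have h6 : 0 ≤ E₁ * √ε := by positivity
  refine ⟨hξ.trans ?_, fun r s hr hrs hs hWr hWs => ?_⟩
  · gcongr
    exact le_add_of_nonneg_right (by positivity)
  have hrA : A ≤ r := by linarith
  have hsB : s ≤ B := by linarith
  have hsin := h.abs_sin_le hAB hW hρc hQ'c hQd hDd hQD hQout hK₂ hQK hQ'K
    (r := r) (s := s) ⟨hrA, by linarith⟩ ⟨by linarith, hsB⟩ hrs (hout _ hWr) (hout _ hWs)
  have hXZ := h.abs_energy_sub_cutoff_le hAB hW hρc hρ1 hA.le hB.le hr hrs hs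
  have hX0 : 0 ≤ ∫ t in r..s, (p t ^ 2 + W (w t)) :=
    intervalIntegral.integral_nonneg hrs fun t _ => IsProfile.energy_nonneg hW t
  have hXC := h.integral_energy_le hAB.le hW hrA hrs hsB
  have hang : ∫ t in r..s, 2 * Real.pi / S * (ρ (w t) * W (w t)) / ε
      = Real.pi * ((2 * ∫ t in r..s, ρ (w t) * W (w t)) / (ε * S)) := by
    rw [intervalIntegral.integral_div, intervalIntegral.integral_const_mul]
    field_simp
  rw [hang] at hsin
  generalize (∫ t in r..s, (p t ^ 2 + W (w t))) = X at *
  generalize (2 * ∫ t in r..s, ρ (w t) * W (w t)) = Z at *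
  obtain ⟨j, hj⟩ := exists_int_abs_sub_le_of_abs_sin_le hsin
  have hcomp := abs_div_sub_div_le (τ := τ₁) (E := (E₁ + 2 * K) * √ε) hε hσ hX0 hXC
    (hXZ.trans (by linarith)) (by linarith) hSσ (by linarith)
  refine ⟨j, ?_⟩
  calc |X / (ε * σ) - j| = |(X / (ε * σ) - Z / (ε * S)) + (Z / (ε * S) - j)| := by ring_nf
    _ ≤ |X / (ε * σ) - Z / (ε * S)| + |Z / (ε * S) - j| := abs_add_le _ _
    _ ≤ _ := by
      have e : 2 * ((E₁ + 2 * K) * √ε) / σ = 2 * (E₁ + 2 * K) / σ * √ε := by ring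
      linarith

end AllenCahn

namespace AllenCahn

/-! ### The Hausdorff measure of spheres -/

section Sphere

open Metric Measure Module
open scoped RealInnerProductSpace NNReal Pointwise

/-- Two measures that compare on all sets of small diameter compare on all sets. -/
theorem measure_le_mul_of_closedBall {X : Type*} [MetricSpace X] [SecondCountableTopology X]
    [Nonempty X] [MeasurableSpace X] [BorelSpace X] {μ ν : Measure X} {K : ℝ≥0∞} {δ : ℝ}
    (hδ : 0 < δ)
    (h : ∀ p, ∀ A ⊆ closedBall p δ, MeasurableSet A → μ A ≤ K * ν A) {A : Set X}
    (hA : MeasurableSet A) : μ A ≤ K * ν A := by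
  let f : ℕ → Set X := fun i => closedBall (TopologicalSpace.denseSeq X i) δ
  have hf : ⋃ i, disjointed f i = univ := by
    rw [iUnion_disjointed]
    refine eq_univ_of_forall fun x => ?_
    obtain ⟨i, hi⟩ := (TopologicalSpace.denseRange_denseSeq X).exists_dist_lt x hδ
    exact mem_iUnion.2 ⟨i, hi.le⟩
  have hm : ∀ i, MeasurableSet (A ∩ disjointed f i) := fun i =>
    hA.inter (MeasurableSet.disjointed (fun j => measurableSet_closedBall) i)
  have hd : Pairwise (Function.onFun Disjoint fun i => A ∩ disjointed f i) := fun i j hij =>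
    (disjoint_disjointed f hij).mono inter_subset_right inter_subset_right
  have hU : A = ⋃ i, A ∩ disjointed f i := by rw [← inter_iUnion, hf, inter_univ]
  rw [hU, measure_iUnion hd hm, measure_iUnion hd hm, ← ENNReal.tsum_mul_left]
  exact ENNReal.tsum_le_tsum fun i =>
    h _ _ (inter_subset_right.trans (disjointed_subset f i)) (hm i)

variable {E : Type*} [NormedAddCommGroup E] [InnerProductSpace ℝ E]

theorem norm_sub_le_norm_smul_sub_smul {u v : E} (hu : ‖u‖ = 1) (hv : ‖v‖ = 1) {s t : ℝ}
    (hs : 1 ≤ s) (ht : 1 ≤ t) : ‖u - v‖ ≤ ‖s • u - t • v‖ := by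
  rw [← sq_le_sq₀ (norm_nonneg _) (norm_nonneg _), norm_sub_sq_real, norm_sub_sq_real, norm_smul,
    norm_smul, inner_smul_left, inner_smul_right, hu, hv, Real.norm_of_nonneg (by linarith),
    Real.norm_of_nonneg (by linarith)]
  have h1 : ⟪u, v⟫ ≤ 1 := by simpa [hu, hv] using real_inner_le_norm u v
  simp only [conj_trivial]
  nlinarith [sq_nonneg (s - t), mul_le_mul hs ht zero_le_one (by linarith)]

theorem inner_ge_of_norm_sub_le {u p : E} (hu : ‖u‖ = 1) (hp : ‖p‖ = 1) {δ : ℝ} (hδ1 : δ ≤ 1)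
    (h : ‖u - p‖ ≤ δ) : 1 - δ ≤ ⟪u, p⟫ := by
  have h1 := norm_sub_sq_real u p
  rw [hu, hp] at h1
  have h2 : ‖u - p‖ ^ 2 ≤ δ ^ 2 := pow_le_pow_left₀ (norm_nonneg _) h 2
  nlinarith [(norm_nonneg (u - p)).trans h]

/-- The central projection of the sphere to the tangent plane at `p` is almost isometric near `p`:
the derivative of `u ↦ ⟪u, p⟫` is small there. -/
theorem norm_gnomonic_sub_le {u v p : E} (hu : ‖u‖ = 1) (hv : ‖v‖ = 1) (hp : ‖p‖ = 1) {δ : ℝ}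
    (hδ1 : δ < 1) (hup : ‖u - p‖ ≤ δ) (hvp : ‖v - p‖ ≤ δ) :
    ‖(⟪u, p⟫)⁻¹ • u - (⟪v, p⟫)⁻¹ • v‖ ≤ ((1 - δ)⁻¹ + δ * ((1 - δ)⁻¹) ^ 2) * ‖u - v‖ := by
  have hc : 0 < 1 - δ := by linarith
  have hδ0 : 0 ≤ δ := (norm_nonneg _).trans hup
  have hui := inner_ge_of_norm_sub_le hu hp hδ1.le hup
  have hvi := inner_ge_of_norm_sub_le hv hp hδ1.le hvp
  have hu0 : 0 < ⟪u, p⟫ := hc.trans_le hui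
  have hv0 : 0 < ⟪v, p⟫ := hc.trans_le hvi
  have hinv : (⟪u, p⟫)⁻¹ ≤ (1 - δ)⁻¹ := inv_anti₀ hc hui
  have hinv' : (⟪v, p⟫)⁻¹ ≤ (1 - δ)⁻¹ := inv_anti₀ hc hvi
  have hdiff : |⟪v, p⟫ - ⟪u, p⟫| ≤ ‖u - v‖ * δ := by
    have h0 : ⟪v - u, (1 / 2 : ℝ) • (u + v)⟫ = 0 := by
      rw [inner_smul_right, inner_sub_left, inner_add_right, inner_add_right,
        real_inner_self_eq_norm_sq, real_inner_self_eq_norm_sq, hu, hv, real_inner_comm]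
      ring
    have h1 : ⟪v, p⟫ - ⟪u, p⟫ = ⟪v - u, p - (1 / 2 : ℝ) • (u + v)⟫ := by
      rw [inner_sub_right, h0, inner_sub_left]; ring
    have h2 : ‖p - (1 / 2 : ℝ) • (u + v)‖ ≤ δ := by
      have : p - (1 / 2 : ℝ) • (u + v) = -((1 / 2 : ℝ) • (u - p) + (1 / 2 : ℝ) • (v - p)) := by
        module
      rw [this, norm_neg]
      refine (norm_add_le _ _).trans ?_
      rw [norm_smul, norm_smul, Real.norm_of_nonneg (by norm_num : (0 : ℝ) ≤ 1 / 2)]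
      linarith
    rw [h1, norm_sub_rev u v]
    exact (abs_real_inner_le_norm _ _).trans (by gcongr)
  have hsplit : (⟪u, p⟫)⁻¹ • u - (⟪v, p⟫)⁻¹ • v
      = (⟪u, p⟫)⁻¹ • (u - v) + ((⟪v, p⟫ - ⟪u, p⟫) * ((⟪u, p⟫)⁻¹ * (⟪v, p⟫)⁻¹)) • v := by
    have : (⟪v, p⟫ - ⟪u, p⟫) * ((⟪u, p⟫)⁻¹ * (⟪v, p⟫)⁻¹) = (⟪u, p⟫)⁻¹ - (⟪v, p⟫)⁻¹ := by
      field_simp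
    rw [this]
    module
  rw [hsplit]
  refine (norm_add_le _ _).trans ?_
  rw [norm_smul, norm_smul, hv, mul_one, Real.norm_of_nonneg (inv_nonneg.2 hu0.le), norm_mul,
    Real.norm_of_nonneg (by positivity : 0 ≤ (⟪u, p⟫)⁻¹ * (⟪v, p⟫)⁻¹), Real.norm_eq_abs]
  calc _ ≤ (1 - δ)⁻¹ * ‖u - v‖ + (‖u - v‖ * δ) * ((1 - δ)⁻¹ * (1 - δ)⁻¹) := by gcongr
    _ = _ := by ring

theorem euclideanHausdorffMeasure_image_le {X Y : Type*} [MetricSpace X] [MeasurableSpace X]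
    [BorelSpace X] [MetricSpace Y] [MeasurableSpace Y] [BorelSpace Y] {f : X → Y} {s : Set X}
    {K : ℝ≥0} (h : LipschitzOnWith K f s) (d : ℕ) : μHE[d] (f '' s) ≤ (K : ℝ≥0∞) ^ d * μHE[d] s := by
  have := h.hausdorffMeasure_image_le (d := (d : ℝ)) (by positivity)
  rw [ENNReal.rpow_natCast] at this
  rw [euclideanHausdorffMeasure_def, euclideanHausdorffMeasure_def, Measure.smul_apply,
    Measure.smul_apply,
    ENNReal.smul_def, ENNReal.smul_def, smul_eq_mul, smul_eq_mul, mul_left_comm]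
  gcongr

variable [FiniteDimensional ℝ E] [MeasurableSpace E] [BorelSpace E]

/-- The volume of a cone of height one over a set in the affine hyperplane `⟪x, p⟫ = 1`, given as
the set of points whose direction lies in a prescribed set `A` of the sphere. -/
theorem volume_cone {p : E} (hp : ‖p‖ = 1) {A : Set E} (hA : MeasurableSet A) (hE : 0 < finrank ℝ E) :
    finrank ℝ E * volume {x : E | (0 < ⟪p, x⟫ ∧ ⟪p, x⟫ < 1) ∧ ‖x‖⁻¹ • x ∈ A}
      = μHE[finrank ℝ E - 1] {x : E | ⟪p, x⟫ = 1 ∧ ‖x‖⁻¹ • x ∈ A} := by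
  set T := {x : E | (0 < ⟪p, x⟫ ∧ ⟪p, x⟫ < 1) ∧ ‖x‖⁻¹ • x ∈ A} with hT
  set A' := {x : E | ⟪p, x⟫ = 1 ∧ ‖x‖⁻¹ • x ∈ A} with hA'
  have hp0 : p ≠ 0 := by rintro rfl; simp at hp
  have hTm : MeasurableSet T := by
    have h1 : Measurable fun x : E => ⟪p, x⟫ := by fun_prop
    have h2 : Measurable fun x : E => ‖x‖⁻¹ • x := by fun_prop
    exact ((measurableSet_lt measurable_const h1).inter (measurableSet_lt h1 measurable_const)).inter
      (h2 hA)
  have key := EuclideanGeometry.euclideanHausdorffMeasure_eq_lintegral (0 : E) hp0 hTm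
  rw [InnerProductSpace.euclideanHausdorffMeasure_eq_volume] at key
  have hsec : ∀ s : ℝ, μHE[finrank ℝ E - 1]
      (T ∩ AffineSubspace.mk' (s • p +ᵥ (0 : E)) (ℝ ∙ p)ᗮ)
      = (Ioo (0 : ℝ) 1).indicator (fun s => ENNReal.ofReal (s ^ (finrank ℝ E - 1))) s
        * μHE[finrank ℝ E - 1] A' := by
    intro s
    have hmem : ∀ x : E, x ∈ (AffineSubspace.mk' (s • p +ᵥ (0 : E)) (ℝ ∙ p)ᗮ : Set E)
        ↔ ⟪p, x⟫ = s := fun x => by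
      rw [SetLike.mem_coe, AffineSubspace.mem_mk', Submodule.mem_orthogonal_singleton_iff_inner_right]
      simp only [vadd_eq_add, add_zero, vsub_eq_sub, inner_sub_right, inner_smul_right,
        real_inner_self_eq_norm_sq, hp]
      constructor <;> intro h <;> linarith
    by_cases hs : s ∈ Ioo (0 : ℝ) 1
    · rw [indicator_of_mem hs]
      have : T ∩ AffineSubspace.mk' (s • p +ᵥ (0 : E)) (ℝ ∙ p)ᗮ = s • A' := by
        ext x
        rw [mem_inter_iff, hmem, mem_smul_set_iff_inv_smul_mem₀ hs.1.ne']
        simp only [hT, hA', mem_ofPred_eq, inner_smul_right, norm_smul, norm_inv,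
          Real.norm_of_nonneg hs.1.le, smul_smul, mul_inv, inv_inv]
        have e : s * ‖x‖⁻¹ * s⁻¹ = ‖x‖⁻¹ := by have := hs.1.ne'; field_simp
        have e2 : s⁻¹ * ⟪p, x⟫ = 1 ↔ ⟪p, x⟫ = s := by
          rw [inv_mul_eq_iff_eq_mul₀ hs.1.ne', mul_one]
        rw [e, e2]
        constructor
        · rintro ⟨⟨_, h1⟩, h2⟩; exact ⟨h2, h1⟩
        · rintro ⟨h1, h2⟩; exact ⟨⟨by rw [h1]; exact hs, h2⟩, h1⟩
      rw [this, euclideanHausdorffMeasure_smul₀ _ hs.1.ne', ENNReal.smul_def, smul_eq_mul]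
      congr 1
      rw [ENNReal.coe_pow, ENNReal.ofReal_pow hs.1.le, ← enorm_eq_nnnorm,
        Real.enorm_eq_ofReal hs.1.le]
    · rw [indicator_of_notMem hs, zero_mul]
      convert measure_empty (μ := (μHE[finrank ℝ E - 1] : Measure E))
      rw [eq_empty_iff_forall_notMem]
      rintro x ⟨h1, h2⟩
      rw [hmem] at h2
      exact hs (by rw [← h2]; exact h1.1)
  have hpow : ∫⁻ s : ℝ, (Ioo (0 : ℝ) 1).indicator (fun s => ENNReal.ofReal (s ^ (finrank ℝ E - 1))) s
      = ENNReal.ofReal (1 / finrank ℝ E) := by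
    rw [lintegral_indicator measurableSet_Ioo, ← ofReal_integral_eq_lintegral_ofReal,
      ← integral_Ioc_eq_integral_Ioo, ← intervalIntegral.integral_of_le zero_le_one, integral_pow]
    · congr 1
      have : ((finrank ℝ E - 1 : ℕ) : ℝ) + 1 = finrank ℝ E := by
        rw [Nat.cast_pred hE]; ring
      rw [this, Nat.sub_add_cancel hE]
      simp [hE.ne']
    · exact (continuous_pow _).integrableOn_Icc.mono_set Ioo_subset_Icc_self
    · exact (ae_restrict_iff' measurableSet_Ioo).2 (ae_of_all _ fun s hs => pow_nonneg hs.1.le _)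
  simp_rw [hsec] at key
  rw [lintegral_mul_const _ (Measurable.indicator (by fun_prop) measurableSet_Ioo), hpow,
    ← ofReal_norm, hp, ENNReal.ofReal_one, one_mul] at key
  rw [key, ← mul_assoc, ← ENNReal.ofReal_natCast, ← ENNReal.ofReal_mul (Nat.cast_nonneg _),
    mul_one_div_cancel (Nat.cast_ne_zero.2 hE.ne'), ENNReal.ofReal_one, one_mul]

/-- On a small piece `A` of the unit sphere the Hausdorff measure and the cone measure almost agree:
both are compared with the measure of the central projection of `A` to a tangent plane. -/
theorem toSphere_compare {δ : ℝ} (hδ0 : 0 < δ) (hδ1 : δ < 1) (p : sphere (0 : E) 1)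
    {A : Set (sphere (0 : E) 1)} (hAp : A ⊆ closedBall p δ) (hA : MeasurableSet A)
    (hE : 0 < finrank ℝ E) :
    (volume : Measure E).toSphere A ≤ ENNReal.ofReal ((1 - δ)⁻¹ + δ * ((1 - δ)⁻¹) ^ 2)
        ^ (finrank ℝ E - 1) * μHE[finrank ℝ E - 1] ((↑) '' A : Set E) ∧
    ENNReal.ofReal (1 - δ) ^ (finrank ℝ E) * μHE[finrank ℝ E - 1] ((↑) '' A : Set E) ≤
      (volume : Measure E).toSphere A := by
  have hc : 0 < 1 - δ := by linarith
  have hp : ‖(p : E)‖ = 1 := norm_eq_of_mem_sphere p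
  set a : Set E := (↑) '' A with ha
  have ham : MeasurableSet a :=
    (MeasurableEmbedding.subtype_coe isClosed_sphere.measurableSet).measurableSet_image.2 hA
  have ha1 : ∀ u ∈ a, ‖u‖ = 1 := by
    rintro _ ⟨u, -, rfl⟩; exact norm_eq_of_mem_sphere u
  have hap : ∀ u ∈ a, ‖u - p‖ ≤ δ := by
    rintro _ ⟨u, hu, rfl⟩
    have := hAp hu
    rwa [mem_closedBall, Subtype.dist_eq, dist_eq_norm] at this
  have hai : ∀ u ∈ a, 1 - δ ≤ ⟪u, (p : E)⟫ := fun u hu =>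
    inner_ge_of_norm_sub_le (ha1 u hu) hp hδ1.le (hap u hu)
  have hai1 : ∀ u ∈ a, ⟪u, (p : E)⟫ ≤ 1 := fun u hu => by
    simpa [ha1 u hu, hp] using real_inner_le_norm u (p : E)
  set a' : Set E := {x : E | ⟪(p : E), x⟫ = 1 ∧ ‖x‖⁻¹ • x ∈ a} with ha'
  set T := {x : E | (0 < ⟪(p : E), x⟫ ∧ ⟪(p : E), x⟫ < 1) ∧ ‖x‖⁻¹ • x ∈ a} with hT
  have hvol := volume_cone hp ham hE
  have hgn : a' = (fun u => (⟪u, (p : E)⟫)⁻¹ • u) '' a := by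
    ext x
    constructor
    · rintro ⟨h1, h2⟩
      have hx0 : x ≠ 0 := by rintro rfl; simp at h1
      have hn : ‖x‖ ≠ 0 := norm_ne_zero_iff.2 hx0
      refine ⟨_, h2, ?_⟩
      simp only [inner_smul_left, conj_trivial, smul_smul]
      rw [real_inner_comm, h1, mul_one, inv_inv, mul_inv_cancel₀ hn, one_smul]
    · rintro ⟨u, hu, rfl⟩
      have hu0 : 0 < ⟪u, (p : E)⟫ := hc.trans_le (hai u hu)
      refine ⟨?_, ?_⟩
      · rw [real_inner_comm, inner_smul_left, conj_trivial, inv_mul_cancel₀ hu0.ne']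
      · rw [norm_smul, ha1 u hu, mul_one, norm_inv, inv_inv, smul_smul, Real.norm_of_nonneg hu0.le,
          mul_inv_cancel₀ hu0.ne', one_smul]
        exact hu
  have hcone : ∀ x : E, x ∈ Ioo (0 : ℝ) 1 • a ↔ (0 < ‖x‖ ∧ ‖x‖ < 1) ∧ ‖x‖⁻¹ • x ∈ a := fun x => by
    rw [Set.mem_smul]
    constructor
    · rintro ⟨s, hs, u, hu, rfl⟩
      rw [norm_smul, ha1 u hu, mul_one, Real.norm_of_nonneg hs.1.le, smul_smul,
        inv_mul_cancel₀ hs.1.ne', one_smul]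
      exact ⟨hs, hu⟩
    · rintro ⟨h1, h2⟩
      exact ⟨‖x‖, h1, _, h2, by rw [smul_smul, mul_inv_cancel₀ h1.1.ne', one_smul]⟩
  have hdir : ∀ x : E, ‖x‖⁻¹ • x ∈ a → 0 < ‖x‖ ∧ (1 - δ) * ‖x‖ ≤ ⟪(p : E), x⟫ ∧
      ⟪(p : E), x⟫ ≤ ‖x‖ := fun x hx => by
    have hn : 0 < ‖x‖ := by
      rcases (norm_nonneg x).eq_or_lt with h | h
      · have := ha1 _ hx; rw [← h] at this; simp at this
      · exact h
    have h1 := hai _ hx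
    have h2 := hai1 _ hx
    rw [inner_smul_left, conj_trivial, real_inner_comm] at h1 h2
    rw [inv_mul_eq_div] at h1 h2
    rw [le_div_iff₀ hn] at h1
    rw [div_le_iff₀ hn] at h2
    exact ⟨hn, h1, by linarith⟩
  rw [toSphere_apply' _ hA]
  constructor
  · have hsub : Ioo (0 : ℝ) 1 • a ⊆ T := fun x hx => by
      obtain ⟨h1, h2⟩ := (hcone x).1 hx
      obtain ⟨h3, h4, h5⟩ := hdir x h2
      exact ⟨⟨lt_of_lt_of_le (by positivity) h4, by linarith⟩, h2⟩
    set K : ℝ≥0 := Real.toNNReal ((1 - δ)⁻¹ + δ * ((1 - δ)⁻¹) ^ 2) with hK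
    have hL : LipschitzOnWith K (fun u : E => (⟪u, (p : E)⟫)⁻¹ • u) a := by
      refine LipschitzOnWith.of_dist_le_mul fun u hu v hv => ?_
      rw [dist_eq_norm, dist_eq_norm, hK, Real.coe_toNNReal _ (by positivity)]
      exact norm_gnomonic_sub_le (ha1 u hu) (ha1 v hv) hp hδ1 (hap u hu) (hap v hv)
    calc _ ≤ finrank ℝ E * volume T := by gcongr
      _ = μHE[finrank ℝ E - 1] a' := hvol
      _ ≤ _ := by rw [hgn]; exact euclideanHausdorffMeasure_image_le hL _
  · have hsub : (1 - δ) • T ⊆ Ioo (0 : ℝ) 1 • a := by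
      rintro _ ⟨x, ⟨h1, h2⟩, rfl⟩
      obtain ⟨h3, h4, h5⟩ := hdir x h2
      simp only
      rw [hcone, norm_smul, Real.norm_of_nonneg hc.le, smul_smul]
      refine ⟨⟨by positivity, by linarith [h1.2]⟩, ?_⟩
      rw [mul_inv, mul_comm (1 - δ)⁻¹, mul_assoc, inv_mul_cancel₀ hc.ne', mul_one]
      exact h2
    have hL : LipschitzOnWith 1 (fun x : E => ‖x‖⁻¹ • x) a' := by
      refine LipschitzOnWith.of_dist_le_mul fun x hx y hy => ?_
      obtain ⟨hx1, -, hx3⟩ := hdir x hx.2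
      obtain ⟨hy1, -, hy3⟩ := hdir y hy.2
      rw [hx.1] at hx3
      rw [hy.1] at hy3
      rw [dist_eq_norm, dist_eq_norm, NNReal.coe_one, one_mul]
      have := norm_sub_le_norm_smul_sub_smul (ha1 _ hx.2) (ha1 _ hy.2) hx3 hy3
      rwa [smul_smul, smul_smul, mul_inv_cancel₀ hx1.ne', mul_inv_cancel₀ hy1.ne', one_smul,
        one_smul] at this
    have himg : a = (fun x : E => ‖x‖⁻¹ • x) '' a' := by
      ext u
      constructor
      · intro hu
        have hu0 : 0 < ⟪u, (p : E)⟫ := hc.trans_le (hai u hu)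
        have hmem : (⟪u, (p : E)⟫)⁻¹ • u ∈ a' := by rw [hgn]; exact ⟨u, hu, rfl⟩
        refine ⟨_, hmem, ?_⟩
        simp only [norm_smul, ha1 u hu, mul_one, norm_inv, inv_inv, smul_smul,
          Real.norm_of_nonneg hu0.le]
        rw [mul_inv_cancel₀ hu0.ne', one_smul]
      · rintro ⟨x, hx, rfl⟩
        exact hx.2
    calc _ ≤ ENNReal.ofReal (1 - δ) ^ (finrank ℝ E) * μHE[finrank ℝ E - 1] a' := by
          have := euclideanHausdorffMeasure_image_le hL (finrank ℝ E - 1)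
          rw [← himg, ENNReal.coe_one, one_pow, one_mul] at this
          exact mul_le_mul' le_rfl this
      _ = finrank ℝ E * volume ((1 - δ) • T) := by
          rw [← hvol, Measure.addHaar_smul_of_nonneg _ hc.le, ENNReal.ofReal_pow hc.le]
          ring
      _ ≤ _ := by gcongr

/-- The `(n-1)`-dimensional Hausdorff measure on the unit sphere is the surface measure that appears
in integration in polar coordinates. -/
theorem toSphere_eq_euclideanHausdorffMeasure {A : Set (sphere (0 : E) 1)} (hA : MeasurableSet A)
    (hE : 0 < finrank ℝ E) :
    (volume : Measure E).toSphere A = μHE[finrank ℝ E - 1] ((↑) '' A : Set E) := by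
  have : Nontrivial E := finrank_pos_iff.1 hE
  have : Nonempty (sphere (0 : E) 1) := (NormedSpace.sphere_nonempty.2 zero_le_one).to_subtype
  have hemb := MeasurableEmbedding.subtype_coe (isClosed_sphere (x := (0 : E)) (ε := 1)).measurableSet
  set ν : Measure (sphere (0 : E) 1) := (μHE[finrank ℝ E - 1] : Measure E).comap (↑) with hν
  have hνA : ∀ A, ν A = μHE[finrank ℝ E - 1] ((↑) '' A : Set E) := fun A => hemb.comap_apply _ _
  rw [← hνA]
  apply le_antisymm
  · have hle : ∀ᶠ δ in 𝓝[>] (0 : ℝ), (volume : Measure E).toSphere A ≤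
        ENNReal.ofReal ((1 - δ)⁻¹ + δ * ((1 - δ)⁻¹) ^ 2) ^ (finrank ℝ E - 1) * ν A := by
      filter_upwards [Ioo_mem_nhdsGT (zero_lt_one' ℝ)] with δ hδ
      exact measure_le_mul_of_closedBall hδ.1 (fun p B hBp hB => by
        rw [hνA]; exact (toSphere_compare hδ.1 hδ.2 p hBp hB hE).1) hA
    have hlim : Tendsto (fun δ : ℝ => ENNReal.ofReal ((1 - δ)⁻¹ + δ * ((1 - δ)⁻¹) ^ 2)
        ^ (finrank ℝ E - 1) * ν A) (𝓝[>] 0) (𝓝 (1 * ν A)) := by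
      refine ENNReal.Tendsto.mul_const ?_ (Or.inl one_ne_zero)
      have h1 : ContinuousAt (fun δ : ℝ => (1 - δ)⁻¹ + δ * ((1 - δ)⁻¹) ^ 2) 0 := by
        fun_prop (disch := norm_num)
      have h2 := ((ENNReal.continuous_pow (finrank ℝ E - 1)).tendsto _).comp
        ((ENNReal.tendsto_ofReal h1.tendsto))
      simp only [sub_zero, inv_one, zero_mul, add_zero, ENNReal.ofReal_one, one_pow] at h2
      exact h2.mono_left nhdsWithin_le_nhds
    rw [one_mul] at hlim
    exact ge_of_tendsto hlim hle
  · have hle : ∀ᶠ δ in 𝓝[>] (0 : ℝ), ENNReal.ofReal (1 - δ) ^ (finrank ℝ E) * ν A ≤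
        (volume : Measure E).toSphere A := by
      filter_upwards [Ioo_mem_nhdsGT (zero_lt_one' ℝ)] with δ hδ
      have hk0 : ENNReal.ofReal (1 - δ) ^ (finrank ℝ E) ≠ 0 :=
        pow_ne_zero _ (by simpa using hδ.2)
      have hk1 : ENNReal.ofReal (1 - δ) ^ (finrank ℝ E) ≠ ⊤ := ENNReal.pow_ne_top ENNReal.ofReal_ne_top
      rw [mul_comm, ← ENNReal.le_div_iff_mul_le (Or.inl hk0) (Or.inl hk1), ENNReal.div_eq_inv_mul]
      exact measure_le_mul_of_closedBall hδ.1 (fun p B hBp hB => by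
        rw [hνA, ← ENNReal.div_eq_inv_mul, ENNReal.le_div_iff_mul_le (Or.inl hk0) (Or.inl hk1),
          mul_comm]
        exact (toSphere_compare hδ.1 hδ.2 p hBp hB hE).2) hA
    have hlim : Tendsto (fun δ : ℝ => ENNReal.ofReal (1 - δ) ^ (finrank ℝ E) * ν A) (𝓝[>] 0)
        (𝓝 (1 * ν A)) := by
      refine ENNReal.Tendsto.mul_const ?_ (Or.inl one_ne_zero)
      have h1 : ContinuousAt (fun δ : ℝ => 1 - δ) 0 := by fun_prop
      have h2 := ((ENNReal.continuous_pow (finrank ℝ E)).tendsto _).comp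
        ((ENNReal.tendsto_ofReal h1.tendsto))
      simp only [sub_zero, ENNReal.ofReal_one, one_pow] at h2
      exact h2.mono_left nhdsWithin_le_nhds
    rw [one_mul] at hlim
    exact le_of_tendsto hlim hle

/-- The Hausdorff measure on the sphere of radius `r` is a dilation of the surface measure. -/
theorem euclideanHausdorffMeasure_restrict_sphere {r : ℝ} (hr : 0 < r) (hE : 0 < finrank ℝ E) :
    (μHE[finrank ℝ E - 1] : Measure E).restrict (sphere 0 r) =
      ENNReal.ofReal (r ^ (finrank ℝ E - 1)) •
        (volume : Measure E).toSphere.map (fun θ : sphere (0 : E) 1 => r • (θ : E)) := by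
  have hmeas : Measurable fun θ : sphere (0 : E) 1 => r • (θ : E) := by fun_prop
  ext s hs
  rw [Measure.restrict_apply hs, Measure.smul_apply, Measure.map_apply hmeas hs,
    toSphere_eq_euclideanHausdorffMeasure (hmeas hs) hE, smul_eq_mul]
  have hset : s ∩ sphere 0 r
      = r • ((↑) '' ((fun θ : sphere (0 : E) 1 => r • (θ : E)) ⁻¹' s) : Set E) := by
    ext x
    rw [mem_smul_set_iff_inv_smul_mem₀ hr.ne']
    constructor
    · rintro ⟨h1, h2⟩
      have h3 : ‖r⁻¹ • x‖ = 1 := by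
        rw [norm_smul, norm_inv, Real.norm_of_nonneg hr.le, mem_sphere_zero_iff_norm.1 h2,
          inv_mul_cancel₀ hr.ne']
      refine ⟨⟨r⁻¹ • x, mem_sphere_zero_iff_norm.2 h3⟩, ?_, rfl⟩
      simpa [smul_smul, mul_inv_cancel₀ hr.ne'] using h1
    · rintro ⟨θ, h1, h2⟩
      have h3 : x = r • (θ : E) := by rw [h2, smul_smul, mul_inv_cancel₀ hr.ne', one_smul]
      refine ⟨by rw [h3]; exact h1, ?_⟩
      rw [h3, mem_sphere_zero_iff_norm, norm_smul, norm_eq_of_mem_sphere θ, mul_one,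
        Real.norm_of_nonneg hr.le]
  rw [hset, euclideanHausdorffMeasure_smul₀ _ hr.ne', ENNReal.smul_def, smul_eq_mul,
    ENNReal.coe_pow, ENNReal.ofReal_pow hr.le, ← enorm_eq_nnnorm, Real.enorm_eq_ofReal hr.le]

end Sphere

end AllenCahn

namespace AllenCahn

/-! ### Limits of densities with integer mass between good points -/

/-- A sequence of densities `e k` on `(0, ∞)` with bounded mass for the weight `t ^ m`, such that
the mass of `e k` between the points `q 0` and `q i` of a dense sequence tends to an integer. -/
structure HasIntegerLimit (m : ℕ) (C : ℝ) (e : ℕ → ℝ → ℝ) (q : ℕ → ℝ) (F : ℕ → ℤ) : Prop where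
  pos : ∀ i, 0 < q i
  dense : ∀ x y, 0 < x → x < y → ∃ i, x < q i ∧ q i < y
  cont : ∀ k, ContinuousOn (e k) (Ioi 0)
  nonneg : ∀ k t, 0 ≤ e k t
  integrable : ∀ k, IntegrableOn (fun t => t ^ m * e k t) (Ioi 0)
  mass_le : ∀ k, ∫ t in Ioi (0 : ℝ), t ^ m * e k t ≤ C
  tendsto : ∀ i, Tendsto (fun k => ∫ t in q 0..q i, e k t) atTop (𝓝 (F i))

/-- The integers that are jumped over or reached by the limit distribution function `F`; each of
them carries one unit of mass of the limit. -/
def jumpSet (F : ℕ → ℤ) : Set ℤ := {j | ∃ i i', F i < j ∧ j ≤ F i'}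

/-- The position of the `j`-th unit of mass: the quantile function of `F`. -/
noncomputable def jumpRadius (q : ℕ → ℝ) (F : ℕ → ℤ) (j : ℤ) : ℝ := sSup (q '' {i | F i < j})

namespace HasIntegerLimit

variable {m : ℕ} {C : ℝ} {e : ℕ → ℝ → ℝ} {q : ℕ → ℝ} {F : ℕ → ℤ}

theorem intervalIntegrable_mul (h : HasIntegerLimit m C e q F) {G : ℝ → ℝ} (hG : Continuous G)
    (k : ℕ) {x y : ℝ} (hx : 0 < x) (hy : 0 < y) :
    IntervalIntegrable (fun t => G t * e k t) volume x y := by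
  apply ContinuousOn.intervalIntegrable
  apply hG.continuousOn.mul ((h.cont k).mono _)
  intro t ht
  exact lt_of_lt_of_le (lt_min hx hy) ht.1

theorem intervalIntegrable (h : HasIntegerLimit m C e q F)
    (k : ℕ) {x y : ℝ} (hx : 0 < x) (hy : 0 < y) : IntervalIntegrable (e k) volume x y := by
  simpa using h.intervalIntegrable_mul (G := fun _ => 1) continuous_const k hx hy

theorem tendsto_sub (h : HasIntegerLimit m C e q F) (i i' : ℕ) :
    Tendsto (fun k => ∫ t in q i..q i', e k t) atTop (𝓝 ((F i' : ℝ) - F i)) := by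
  refine ((h.tendsto i').sub (h.tendsto i)).congr fun k => ?_
  exact intervalIntegral.integral_interval_sub_left
    (h.intervalIntegrable k (h.pos 0) (h.pos _)) (h.intervalIntegrable k (h.pos 0) (h.pos _))

theorem mono (h : HasIntegerLimit m C e q F) {i i' : ℕ} (hi : q i ≤ q i') : F i ≤ F i' := by
  have : (0 : ℝ) ≤ (F i' : ℝ) - F i := ge_of_tendsto' (h.tendsto_sub i i') fun k =>
    intervalIntegral.integral_nonneg hi fun t _ => h.nonneg k t
  exact_mod_cast sub_nonneg.1 this

theorem lt_of_lt (h : HasIntegerLimit m C e q F) {i i' : ℕ} (hi : F i < F i') : q i < q i' := by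
  by_contra! hc
  exact absurd (h.mono hc) (not_le.2 hi)

theorem le_jumpRadius (h : HasIntegerLimit m C e q F) {j : ℤ} (hj : j ∈ jumpSet F) {i : ℕ}
    (hi : F i < j) : q i ≤ jumpRadius q F j := by
  obtain ⟨-, i', -, hi'⟩ := hj
  refine le_csSup ⟨q i', ?_⟩ ⟨i, hi, rfl⟩
  rintro _ ⟨l, hl, rfl⟩
  exact (h.lt_of_lt (lt_of_lt_of_le hl hi')).le

theorem jumpRadius_le (h : HasIntegerLimit m C e q F) {j : ℤ} (hj : j ∈ jumpSet F) {i : ℕ}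
    (hi : j ≤ F i) : jumpRadius q F j ≤ q i := by
  obtain ⟨i', -, hi', -⟩ := hj
  refine csSup_le ⟨_, i', hi', rfl⟩ ?_
  rintro _ ⟨l, hl, rfl⟩
  exact (h.lt_of_lt (lt_of_lt_of_le hl hi)).le

theorem jumpRadius_pos (h : HasIntegerLimit m C e q F) {j : ℤ} (hj : j ∈ jumpSet F) :
    0 < jumpRadius q F j := by
  obtain ⟨i, i', hi, hi'⟩ := hj
  exact (h.pos i).trans_le (h.le_jumpRadius ⟨i, i', hi, hi'⟩ hi)

/-- If `G` oscillates by at most `τ` between two points of the dense sequence, then its integral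
against `e k` is asymptotically close to its sum over the jumps. -/
theorem eventually_abs_sub_le_of_osc (h : HasIntegerLimit m C e q F) {G : ℝ → ℝ}
    (hG : Continuous G) {i i' : ℕ} (hi : q i ≤ q i') {c τ η : ℝ} (hη : 0 < η)
    (hosc : ∀ t ∈ Icc (q i) (q i'), |G t - c| ≤ τ) :
    ∀ᶠ k in atTop, |(∫ t in q i..q i', G t * e k t)
      - ∑ j ∈ Finset.Ioc (F i) (F i'), G (jumpRadius q F j)| ≤
        2 * τ * ((F i' : ℝ) - F i) + η := by
  have hF := h.mono hi
  have hsum : |(∑ j ∈ Finset.Ioc (F i) (F i'), G (jumpRadius q F j)) - c * ((F i' : ℝ) - F i)| ≤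
      τ * ((F i' : ℝ) - F i) := by
    have hcard : ∀ c : ℝ, ∑ _j ∈ Finset.Ioc (F i) (F i'), c = c * ((F i' : ℝ) - F i) := fun c => by
      rw [Finset.sum_const, Int.card_Ioc, nsmul_eq_mul, mul_comm]
      congr 1
      have : (((F i' - F i).toNat : ℤ) : ℝ) = ((F i' - F i : ℤ) : ℝ) := by
        rw [Int.toNat_of_nonneg (by linarith)]
      rw [← Int.cast_sub, ← this, Int.cast_natCast]
    rw [← hcard c, ← hcard τ, ← Finset.sum_sub_distrib]
    refine (Finset.abs_sum_le_sum_abs _ _).trans (Finset.sum_le_sum fun j hj => ?_)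
    rw [Finset.mem_Ioc] at hj
    have hjJ : j ∈ jumpSet F := ⟨i, i', hj.1, hj.2⟩
    exact hosc _ ⟨h.le_jumpRadius hjJ hj.1, h.jumpRadius_le hjJ hj.2⟩
  have hlim : Tendsto (fun k => τ * (∫ t in q i..q i', e k t)
      + |c| * |(∫ t in q i..q i', e k t) - ((F i' : ℝ) - F i)| + τ * ((F i' : ℝ) - F i)) atTop
      (𝓝 (2 * τ * ((F i' : ℝ) - F i))) := by
    have h1 := h.tendsto_sub i i'
    have h2 := ((h1.const_mul τ).add (((h1.sub_const ((F i' : ℝ) - F i)).abs).const_mul |c|)).add_const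
      (τ * ((F i' : ℝ) - F i))
    simp only [sub_self, abs_zero, mul_zero, add_zero] at h2
    convert h2 using 2
    ring
  filter_upwards [hlim.eventually (gt_mem_nhds (lt_add_of_pos_right _ hη))] with k hk
  refine le_trans ?_ hk.le
  have hei := h.intervalIntegrable k (h.pos i) (h.pos i')
  have hint : |(∫ t in q i..q i', G t * e k t) - c * ∫ t in q i..q i', e k t| ≤
      τ * ∫ t in q i..q i', e k t := by
    rw [← intervalIntegral.integral_const_mul, ← intervalIntegral.integral_const_mul,
      ← intervalIntegral.integral_sub (h.intervalIntegrable_mul hG k (h.pos i) (h.pos i'))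
        (hei.const_mul c)]
    have := intervalIntegral.norm_integral_le_of_norm_le (f := fun t => G t * e k t - c * e k t) hi
      (g := fun t => τ * e k t) (ae_of_all _ fun t ht => ?_) (hei.const_mul τ)
    · exact this
    rw [← sub_mul, Real.norm_eq_abs, abs_mul, abs_of_nonneg (h.nonneg k t)]
    exact mul_le_mul_of_nonneg_right (hosc t ⟨ht.1.le, ht.2⟩) (h.nonneg k t)
  set X := ∫ t in q i..q i', G t * e k t
  set Y := ∫ t in q i..q i', e k t
  set S := ∑ j ∈ Finset.Ioc (F i) (F i'), G (jumpRadius q F j)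
  set N := (F i' : ℝ) - F i
  calc |X - S| = |(X - c * Y) + c * (Y - N) + (c * N - S)| := by ring_nf
    _ ≤ |X - c * Y| + |c * (Y - N)| + |c * N - S| := abs_add_three _ _ _
    _ ≤ _ := by
      rw [abs_mul, abs_sub_comm (c * N)]
      gcongr

/-- Convergence of the integrals of continuous functions between two points of the dense
sequence. -/
theorem tendsto_integral (h : HasIntegerLimit m C e q F) {G : ℝ → ℝ} (hG : Continuous G)
    {i₀ i₁ : ℕ} (hi : q i₀ ≤ q i₁) :
    Tendsto (fun k => ∫ t in q i₀..q i₁, G t * e k t) atTop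
      (𝓝 (∑ j ∈ Finset.Ioc (F i₀) (F i₁), G (jumpRadius q F j))) := by
  rw [Metric.tendsto_atTop']
  have hchain : ∀ τ > 0, ∀ η > 0, ∀ᶠ k in atTop, |(∫ t in q i₀..q i₁, G t * e k t)
      - ∑ j ∈ Finset.Ioc (F i₀) (F i₁), G (jumpRadius q F j)| ≤
        2 * τ * ((F i₁ : ℝ) - F i₀) + η := by
    intro τ hτ
    obtain ⟨δ, hδ, hunif⟩ := Metric.uniformContinuousOn_iff.1
      ((isCompact_Icc (a := q i₀) (b := q i₁)).uniformContinuousOn_of_continuous hG.continuousOn)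
      τ hτ
    have hstep : ∀ i i', q i₀ ≤ q i → q i ≤ q i' → q i' ≤ q i₁ → q i' - q i < δ → ∀ η > 0,
        ∀ᶠ k in atTop, |(∫ t in q i..q i', G t * e k t)
          - ∑ j ∈ Finset.Ioc (F i) (F i'), G (jumpRadius q F j)| ≤
            2 * τ * ((F i' : ℝ) - F i) + η := by
      intro i i' h0 h1 h2 h3 η hη
      refine h.eventually_abs_sub_le_of_osc hG h1 (c := G (q i)) hη fun t ht => ?_
      have := hunif t ⟨h0.trans ht.1, ht.2.trans h2⟩ (q i) ⟨h0, h1.trans h2⟩ (by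
        rw [Real.dist_eq, abs_of_nonneg (by linarith [ht.1])]
        linarith [ht.2])
      rw [Real.dist_eq] at this
      exact this.le
    -- induction on the number of steps of length at least `δ / 2`
    have hind : ∀ N : ℕ, ∀ i, q i₀ ≤ q i → q i ≤ q i₁ → q i₁ - q i < (N + 1) * (δ / 2) → ∀ η > 0,
        ∀ᶠ k in atTop, |(∫ t in q i..q i₁, G t * e k t)
          - ∑ j ∈ Finset.Ioc (F i) (F i₁), G (jumpRadius q F j)| ≤
            2 * τ * ((F i₁ : ℝ) - F i) + η := by
      intro N
      induction N with
      | zero =>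
        intro i h0 h1 h2
        exact hstep i i₁ h0 h1 le_rfl (by simp at h2; linarith)
      | succ N ih =>
        intro i h0 h1 h2 η hη
        by_cases hsmall : q i₁ - q i < δ
        · exact hstep i i₁ h0 h1 le_rfl hsmall η hη
        push Not at hsmall
        obtain ⟨l, hl1, hl2⟩ := h.dense (q i + δ / 2) (q i + δ) (by linarith [h.pos i])
          (by linarith)
        have hil : q i ≤ q l := by linarith
        have hl : q l ≤ q i₁ := by linarith
        push_cast at h2
        filter_upwards [hstep i l h0 hil hl (by linarith) (η / 2) (by positivity),
          ih l (by linarith) hl (by linarith) (η / 2) (by positivity)] with k hk1 hk2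
        rw [← intervalIntegral.integral_add_adjacent_intervals
          (h.intervalIntegrable_mul hG k (h.pos i) (h.pos l))
          (h.intervalIntegrable_mul hG k (h.pos l) (h.pos i₁))]
        have hFs : ∑ j ∈ Finset.Ioc (F i) (F i₁), G (jumpRadius q F j)
            = (∑ j ∈ Finset.Ioc (F i) (F l), G (jumpRadius q F j))
              + ∑ j ∈ Finset.Ioc (F l) (F i₁), G (jumpRadius q F j) := by
          rw [← Finset.sum_union]
          · rw [Finset.Ioc_union_Ioc_eq_Ioc (h.mono hil) (h.mono hl)]
          · rw [Finset.disjoint_left]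
            intro j hj1 hj2
            rw [Finset.mem_Ioc] at hj1 hj2
            exact absurd hj1.2 (not_le.2 hj2.1)
        rw [hFs, add_sub_add_comm]
        refine (abs_add_le _ _).trans ((add_le_add hk1 hk2).trans (le_of_eq ?_))
        ring
    obtain ⟨N, hN⟩ := exists_nat_gt ((q i₁ - q i₀) / (δ / 2))
    refine hind N i₀ le_rfl hi ?_
    rw [div_lt_iff₀ (by positivity)] at hN
    nlinarith
  intro η hη
  have hF : (0 : ℝ) ≤ (F i₁ : ℝ) - F i₀ := sub_nonneg.2 (by exact_mod_cast h.mono hi)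
  have := hchain (η / (8 * ((F i₁ : ℝ) - F i₀ + 1))) (by positivity) (η / 2) (by positivity)
  obtain ⟨k₀, hk₀⟩ := eventually_atTop.1 this
  refine ⟨k₀, fun k hk => ?_⟩
  rw [Real.dist_eq]
  refine (hk₀ k hk.le).trans_lt ?_
  have : 2 * (η / (8 * ((F i₁ : ℝ) - F i₀ + 1))) * ((F i₁ : ℝ) - F i₀) ≤ η / 4 := by
    rw [mul_div_assoc', div_mul_eq_mul_div, div_le_div_iff₀ (by positivity) (by positivity)]
    nlinarith
  linarith

theorem exists_bounds (h : HasIntegerLimit m C e q F) (s : Finset (jumpSet F)) :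
    ∃ i₀ i₁, q i₀ ≤ q i₁ ∧ ∀ j ∈ s, F i₀ < (j : ℤ) ∧ (j : ℤ) ≤ F i₁ := by
  classical
  induction s using Finset.induction_on with
  | empty => exact ⟨0, 0, le_rfl, by simp⟩
  | insert j s _ ih =>
    obtain ⟨i₀, i₁, h01, hs⟩ := ih
    obtain ⟨l₀, l₁, h1, h2⟩ := j.2
    have hl : q l₀ ≤ q l₁ := (h.lt_of_lt (lt_of_lt_of_le h1 h2)).le
    obtain ⟨a₀, ha₀, ha₀'⟩ : ∃ a₀, q a₀ ≤ q i₀ ∧ q a₀ ≤ q l₀ := by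
      rcases le_total (q i₀) (q l₀) with hc | hc
      · exact ⟨i₀, le_rfl, hc⟩
      · exact ⟨l₀, hc, le_rfl⟩
    obtain ⟨a₁, ha₁, ha₁'⟩ : ∃ a₁, q i₁ ≤ q a₁ ∧ q l₁ ≤ q a₁ := by
      rcases le_total (q i₁) (q l₁) with hc | hc
      · exact ⟨l₁, hc, le_rfl⟩
      · exact ⟨i₁, le_rfl, hc⟩
    refine ⟨a₀, a₁, by linarith, fun j' hj' => ?_⟩
    rcases Finset.mem_insert.1 hj' with rfl | hj'
    · exact ⟨(h.mono ha₀').trans_lt h1, h2.trans (h.mono ha₁')⟩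
    · exact ⟨(h.mono ha₀).trans_lt (hs j' hj').1, (hs j' hj').2.trans (h.mono ha₁)⟩

theorem integral_pow_le (h : HasIntegerLimit m C e q F) (k : ℕ) {x y : ℝ} (hx : 0 < x)
    (hxy : x ≤ y) : ∫ t in x..y, t ^ m * e k t ≤ C := by
  rw [intervalIntegral.integral_of_le hxy]
  refine (setIntegral_mono_set (h.integrable k) ?_ ?_).trans (h.mass_le k)
  · exact (ae_restrict_iff' measurableSet_Ioi).2 (ae_of_all _ fun t ht =>
      mul_nonneg (pow_nonneg (le_of_lt ht) _) (h.nonneg k t))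
  · exact Eventually.of_forall fun t ht => hx.trans ht.1

theorem sum_pow_le (h : HasIntegerLimit m C e q F) (s : Finset (jumpSet F)) :
    ∑ j ∈ s, jumpRadius q F j ^ m ≤ C := by
  obtain ⟨i₀, i₁, h01, hs⟩ := h.exists_bounds s
  obtain ⟨l₀, hl₀, hl₀'⟩ := h.dense (q i₀ / 2) (q i₀) (by linarith [h.pos i₀]) (by linarith [h.pos i₀])
  obtain ⟨l₁, hl₁, hl₁'⟩ := h.dense (q i₁) (q i₁ + 1) (h.pos i₁) (by linarith)
  have hl : q l₀ ≤ q l₁ := by linarith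
  have hlim := h.tendsto_integral (G := fun t => t ^ m) (by fun_prop) hl
  have hle : ∑ j ∈ Finset.Ioc (F l₀) (F l₁), jumpRadius q F j ^ m ≤ C :=
    le_of_tendsto' hlim fun k => h.integral_pow_le k (h.pos _) hl
  refine le_trans ?_ hle
  refine (Finset.sum_map s (Function.Embedding.subtype _)
    (fun j => jumpRadius q F j ^ m)).symm.trans_le ?_
  apply Finset.sum_le_sum_of_subset_of_nonneg
  · intro j hj
    rw [Finset.mem_map] at hj
    obtain ⟨j, hj, rfl⟩ := hj
    rw [Finset.mem_Ioc]
    exact ⟨(h.mono hl₀'.le).trans_lt (hs j hj).1, (hs j hj).2.trans (h.mono hl₁.le)⟩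
  · intro j hj _
    rw [Finset.mem_Ioc] at hj
    exact pow_nonneg (h.jumpRadius_pos ⟨l₀, l₁, hj.1, hj.2⟩).le _

theorem summable_pow (h : HasIntegerLimit m C e q F) :
    Summable fun j : jumpSet F => jumpRadius q F j ^ m :=
  summable_of_sum_le (fun j => pow_nonneg (h.jumpRadius_pos j.2).le _) h.sum_pow_le

theorem summable_mul_pow (h : HasIntegerLimit m C e q F) {g : ℝ → ℝ} {B : ℝ}
    (hg : ∀ t > 0, |g t| ≤ B) :
    Summable fun j : jumpSet F => g (jumpRadius q F j) * jumpRadius q F j ^ m := by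
  refine Summable.of_norm_bounded (h.summable_pow.mul_left B) fun j => ?_
  have hj := h.jumpRadius_pos j.2
  rw [Real.norm_eq_abs, abs_mul, abs_of_nonneg (pow_nonneg hj.le m)]
  exact mul_le_mul_of_nonneg_right (hg _ hj) (pow_nonneg hj.le m)

theorem integrableOn_mul (h : HasIntegerLimit m C e q F) {g : ℝ → ℝ} (hgc : Continuous g) {B : ℝ}
    (hg : ∀ t > 0, |g t| ≤ B) (k : ℕ) :
    IntegrableOn (fun t => g t * (t ^ m * e k t)) (Ioi 0) :=
  (h.integrable k).bdd_mul (c := B) hgc.aestronglyMeasurable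
    ((ae_restrict_iff' measurableSet_Ioi).2 (ae_of_all _ fun t ht => hg t ht))

/-- Convergence of the integrals of functions that vanish near `0` and near infinity. -/
theorem tendsto_integral_of_support (h : HasIntegerLimit m C e q F) {g : ℝ → ℝ}
    (hg : Continuous g) {x y : ℝ} (hx : 0 < x) (hxy : x < y) (hgx : ∀ t, 0 < t → t ≤ x → g t = 0)
    (hgy : ∀ t, y ≤ t → g t = 0) :
    Tendsto (fun k => ∫ t in Ioi (0 : ℝ), g t * (t ^ m * e k t)) atTop
      (𝓝 (∑' j : jumpSet F, g (jumpRadius q F j) * jumpRadius q F j ^ m)) := by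
  classical
  obtain ⟨i₀, -, hi₀⟩ := h.dense (x / 2) x (by linarith) (by linarith)
  obtain ⟨i₁, hi₁, -⟩ := h.dense y (y + 1) (by linarith) (by linarith)
  have hi : q i₀ ≤ q i₁ := by linarith
  have hsum : ∑' j : jumpSet F, g (jumpRadius q F j) * jumpRadius q F j ^ m
      = ∑ j ∈ Finset.Ioc (F i₀) (F i₁), g (jumpRadius q F j) * jumpRadius q F j ^ m := by
    rw [tsum_eq_sum (s := (Finset.Ioc (F i₀) (F i₁)).subtype (· ∈ jumpSet F))]
    · exact Finset.sum_subtype_of_mem (p := (· ∈ jumpSet F))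
        (fun j : ℤ => g (jumpRadius q F j) * jumpRadius q F j ^ m)
        fun j hj => ⟨i₀, i₁, (Finset.mem_Ioc.1 hj).1, (Finset.mem_Ioc.1 hj).2⟩
    · intro j hj
      rw [Finset.mem_subtype, Finset.mem_Ioc, not_and_or, not_lt, not_le] at hj
      rcases hj with hj | hj
      · rw [hgx _ (h.jumpRadius_pos j.2) ((h.jumpRadius_le j.2 hj).trans hi₀.le), zero_mul]
      · rw [hgy _ (hi₁.le.trans (h.le_jumpRadius j.2 hj)), zero_mul]
  rw [hsum]
  refine (h.tendsto_integral (G := fun t => g t * t ^ m) (by fun_prop) hi).congr fun k => ?_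
  rw [intervalIntegral.integral_of_le hi]
  simp_rw [mul_assoc]
  symm
  refine setIntegral_eq_of_subset_of_forall_sdiff_eq_zero measurableSet_Ioi
    (fun t ht => (h.pos _).trans ht.1) ?_
  rintro t ⟨ht0, ht⟩
  rw [mem_Ioc, not_and_or, not_lt, not_le] at ht
  rcases ht with ht | ht
  · rw [hgx t ht0 (ht.trans hi₀.le), zero_mul]
  · rw [hgy t (by linarith), zero_mul]

end HasIntegerLimit

/-- A continuous function on `(0, ∞)` that vanishes at both ends is uniformly close to a continuous
function with compact support. -/
theorem exists_support_approx {g : ℝ → ℝ} (hg : Continuous g) (hg0 : g 0 = 0)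
    (hginf : Tendsto g atTop (𝓝 0)) {τ : ℝ} (hτ : 0 < τ) :
    ∃ f : ℝ → ℝ, Continuous f ∧ (∀ t, |g t - f t| ≤ τ) ∧ ∃ x y, 0 < x ∧ x < y ∧
      (∀ t, 0 < t → t ≤ x → f t = 0) ∧ ∀ t, y ≤ t → f t = 0 := by
  have hzero : ∀ t, |g t| ≤ τ → g t - max (-τ) (min τ (g t)) = 0 := fun t ht => by
    rw [min_eq_right (abs_le.1 ht).2, max_eq_right (abs_le.1 ht).1, sub_self]
  refine ⟨fun t => g t - max (-τ) (min τ (g t)), by fun_prop, fun t => ?_, ?_⟩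
  · rw [sub_sub_cancel, abs_le]
    exact ⟨le_max_left _ _, max_le (by linarith) (min_le_left _ _)⟩
  · have h0 : ∀ᶠ t in 𝓝 (0 : ℝ), |g t| < τ := by
      have := (hg.tendsto 0).abs
      rw [hg0, abs_zero] at this
      exact this.eventually (gt_mem_nhds hτ)
    have h1 : ∀ᶠ t in atTop, |g t| < τ := by
      have := hginf.abs
      rw [abs_zero] at this
      exact this.eventually (gt_mem_nhds hτ)
    obtain ⟨x, hx, hx'⟩ := Metric.eventually_nhds_iff.1 h0
    obtain ⟨y, hy⟩ := eventually_atTop.1 h1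
    refine ⟨x / 2, max y x, by linarith, lt_of_lt_of_le (by linarith) (le_max_right _ _),
      fun t ht htx => hzero t (hx' ?_).le, fun t ht => hzero t (hy t ((le_max_left _ _).trans ht)).le⟩
    rw [Real.dist_eq, sub_zero, abs_of_pos ht]
    linarith

/-- A continuous function on `(0, ∞)` that vanishes at both ends is bounded there. -/
theorem exists_bound_of_tendsto {g : ℝ → ℝ} (hg : Continuous g) (hginf : Tendsto g atTop (𝓝 0)) :
    ∃ B, ∀ t > 0, |g t| ≤ B := by
  have h1 : ∀ᶠ t in atTop, |g t| < 1 := by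
    have := hginf.abs
    rw [abs_zero] at this
    exact this.eventually (gt_mem_nhds one_pos)
  obtain ⟨y, hy⟩ := eventually_atTop.1 h1
  obtain ⟨B, hB⟩ := (isCompact_Icc (a := (0 : ℝ)) (b := y)).exists_bound_of_continuousOn
    hg.continuousOn
  refine ⟨max 1 B, fun t ht => ?_⟩
  rcases le_total y t with h | h
  · exact (hy t h).le.trans (le_max_left _ _)
  · exact (hB t ⟨ht.le, h⟩).trans (le_max_right _ _)

namespace HasIntegerLimit

variable {m : ℕ} {C : ℝ} {e : ℕ → ℝ → ℝ} {q : ℕ → ℝ} {F : ℕ → ℤ}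

/-- The densities `t ^ m * e k` converge, in duality with continuous functions that vanish at `0`
and at infinity, to the sum of the point masses `r ^ m` at the jump radii. -/
theorem tendsto_integral_Ioi (h : HasIntegerLimit m C e q F) {g : ℝ → ℝ}
    (hg : Continuous g) (hg0 : g 0 = 0) (hginf : Tendsto g atTop (𝓝 0)) :
    Tendsto (fun k => ∫ t in Ioi (0 : ℝ), g t * (t ^ m * e k t)) atTop
      (𝓝 (∑' j : jumpSet F, g (jumpRadius q F j) * jumpRadius q F j ^ m)) := by
  obtain ⟨B, hB⟩ := exists_bound_of_tendsto hg hginf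
  have hC : 0 ≤ C := by simpa using h.sum_pow_le ∅
  rw [Metric.tendsto_atTop']
  intro η hη
  set τ := η / (4 * (C + 1)) with hτ
  have hτ0 : 0 < τ := by positivity
  obtain ⟨f, hf, hgf, x, y, hx, hxy, hfx, hfy⟩ := exists_support_approx hg hg0 hginf hτ0
  have hfB : ∀ t > 0, |f t| ≤ B + τ := fun t ht => by
    have h1 := abs_le.1 (hgf t)
    have h2 := abs_le.1 (hB t ht)
    rw [abs_le]
    constructor <;> linarith
  obtain ⟨k₀, hk₀⟩ := Metric.tendsto_atTop'.1 (h.tendsto_integral_of_support hf hx hxy hfx hfy)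
    (η / 2) (by positivity)
  refine ⟨k₀, fun k hk => ?_⟩
  have h1 : |(∫ t in Ioi (0 : ℝ), g t * (t ^ m * e k t))
      - ∫ t in Ioi (0 : ℝ), f t * (t ^ m * e k t)| ≤ τ * C := by
    rw [← integral_sub (h.integrableOn_mul hg hB k) (h.integrableOn_mul hf hfB k)]
    have := norm_integral_le_of_norm_le
      (f := fun t => g t * (t ^ m * e k t) - f t * (t ^ m * e k t)) ((h.integrable k).const_mul τ)
      ((ae_restrict_iff' measurableSet_Ioi).2 (ae_of_all _ fun t ht => ?_))
    · refine this.trans ?_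
      rw [integral_const_mul]
      exact mul_le_mul_of_nonneg_left (h.mass_le k) hτ0.le
    · have ht' : 0 ≤ t ^ m * e k t := mul_nonneg (pow_nonneg (le_of_lt ht) _) (h.nonneg k t)
      rw [← sub_mul, Real.norm_eq_abs, abs_mul, abs_of_nonneg ht']
      exact mul_le_mul_of_nonneg_right (hgf t) ht'
  have h2 : |(∑' j : jumpSet F, f (jumpRadius q F j) * jumpRadius q F j ^ m)
      - ∑' j : jumpSet F, g (jumpRadius q F j) * jumpRadius q F j ^ m| ≤ τ * C := by
    rw [← (h.summable_mul_pow hfB).tsum_sub (h.summable_mul_pow hB)]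
    have hbd : ∀ j : jumpSet F, ‖f (jumpRadius q F j) * jumpRadius q F j ^ m
        - g (jumpRadius q F j) * jumpRadius q F j ^ m‖ ≤ τ * jumpRadius q F j ^ m := fun j => by
      have hj := pow_nonneg (h.jumpRadius_pos j.2).le m
      rw [← sub_mul, Real.norm_eq_abs, abs_mul, abs_of_nonneg hj, abs_sub_comm]
      exact mul_le_mul_of_nonneg_right (hgf _) hj
    refine (tsum_of_norm_bounded (h.summable_pow.mul_left τ).hasSum hbd).trans ?_
    rw [tsum_mul_left]
    exact mul_le_mul_of_nonneg_left (h.summable_pow.tsum_le_of_sum_le h.sum_pow_le) hτ0.le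
  have h3 := hk₀ k hk
  rw [Real.dist_eq] at h3 ⊢
  have h4 : τ * C < η / 4 := by
    rw [hτ, div_mul_eq_mul_div, div_lt_div_iff₀ (by positivity) (by positivity)]
    nlinarith
  set X := ∫ t in Ioi (0 : ℝ), g t * (t ^ m * e k t)
  set Y := ∫ t in Ioi (0 : ℝ), f t * (t ^ m * e k t)
  set S := ∑' j : jumpSet F, f (jumpRadius q F j) * jumpRadius q F j ^ m
  set R := ∑' j : jumpSet F, g (jumpRadius q F j) * jumpRadius q F j ^ m
  calc |X - R| = |(X - Y) + (Y - S) + (S - R)| := by ring_nf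
    _ ≤ |X - Y| + |Y - S| + |S - R| := abs_add_three _ _ _
    _ < η := by linarith

end HasIntegerLimit

end AllenCahn

namespace AllenCahn

/-! ### Polar coordinates -/

section Polar

open Metric Measure Module

variable {E : Type*} [NormedAddCommGroup E] [NormedSpace ℝ E] [MeasurableSpace E] [BorelSpace E]
  [FiniteDimensional ℝ E] (μ : Measure E) [μ.IsAddHaarMeasure]

/-- The integral of `V` over the sphere of radius `r`, without the factor `r ^ (dim E - 1)`. -/
noncomputable def sphereIntegral (V : E → ℝ) (r : ℝ) : ℝ :=
  ∫ θ : sphere (0 : E) 1, V (r • (θ : E)) ∂μ.toSphere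

/-- The map `(θ, r) ↦ r θ` is measure preserving. -/
theorem measurePreserving_polar :
    MeasurePreserving (fun z : sphere (0 : E) 1 × Ioi (0 : ℝ) => (z.2 : ℝ) • (z.1 : E))
      (μ.toSphere.prod (volumeIoiPow (finrank ℝ E - 1))) (μ.restrict {0}ᶜ) := by
  have h1 : MeasurePreserving (homeomorphUnitSphereProd E).symm
      (μ.toSphere.prod (volumeIoiPow (finrank ℝ E - 1))) (μ.comap (↑)) :=
    MeasurePreserving.symm (homeomorphUnitSphereProd E).toMeasurableEquiv
      (μ.measurePreserving_homeomorphUnitSphereProd)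
  have h2 : MeasurePreserving ((↑) : ({0}ᶜ : Set E) → E) (μ.comap (↑)) (μ.restrict {0}ᶜ) :=
    ⟨measurable_subtype_coe, map_comap_subtype_coe (measurableSet_singleton 0).compl μ⟩
  exact h2.comp h1

theorem ae_volumeIoiPow_iff (n : ℕ) {P : ℝ → Prop} :
    (∀ᵐ r : Ioi (0 : ℝ) ∂volumeIoiPow n, P r) ↔ ∀ᵐ r ∂(volume.restrict (Ioi (0 : ℝ))), P r := by
  rw [volumeIoiPow, ae_withDensity_iff (by fun_prop), ae_restrict_iff_subtype measurableSet_Ioi]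
  refine eventually_congr (Eventually.of_forall fun r => ?_)
  have : (0 : ℝ) < r := r.2
  simp [pow_pos this]

variable {μ}

theorem ae_ae_polar [Nontrivial E] {P : E → Prop} (h : ∀ᵐ x ∂μ, P x) :
    ∀ᵐ r ∂(volume.restrict (Ioi (0 : ℝ))), ∀ᵐ θ : sphere (0 : E) 1 ∂μ.toSphere,
      P (r • (θ : E)) := by
  rw [← ae_volumeIoiPow_iff (finrank ℝ E - 1)]
  have h1 : ∀ᵐ x ∂μ.restrict {0}ᶜ, P x := ae_restrict_of_ae h
  have h2 := (measurePreserving_polar μ).quasiMeasurePreserving.ae h1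
  exact ae_ae_of_ae_prod (measurePreserving_swap.quasiMeasurePreserving.ae h2)

theorem ae_norm_of_ae [Nontrivial E] {P : ℝ → Prop}
    (h : ∀ᵐ r ∂(volume.restrict (Ioi (0 : ℝ))), P r) : ∀ᵐ x ∂μ, P ‖x‖ := by
  rw [← ae_volumeIoiPow_iff (finrank ℝ E - 1)] at h
  have h1 : ∀ᵐ z ∂(μ.toSphere.prod (volumeIoiPow (finrank ℝ E - 1))), P z.2 :=
    quasiMeasurePreserving_snd.tendsto_ae.eventually h
  have h2 := μ.measurePreserving_homeomorphUnitSphereProd.quasiMeasurePreserving.ae h1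
  have h3 : ∀ᵐ x ∂μ.restrict {0}ᶜ, P ‖x‖ := by
    rw [ae_restrict_iff_subtype (measurableSet_singleton 0).compl]
    simpa using h2
  rwa [restrict_compl_singleton] at h3

theorem integrable_volumeIoiPow_iff (n : ℕ) {f : ℝ → ℝ} :
    Integrable (fun r : Ioi (0 : ℝ) => f r) (volumeIoiPow n) ↔
      IntegrableOn (fun r => r ^ n * f r) (Ioi 0) := by
  rw [integrableOn_iff_comap_subtypeVal measurableSet_Ioi, Measure.volumeIoiPow,
    integrable_withDensity_iff_integrable_smul' (by fun_prop) (by simp)]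
  refine integrable_congr (.of_forall ?_)
  rintro ⟨x, hx : 0 < x⟩
  simp (disch := positivity) [ENNReal.toReal_ofReal]

theorem integral_volumeIoiPow (n : ℕ) (f : ℝ → ℝ) :
    ∫ r : Ioi (0 : ℝ), f r ∂volumeIoiPow n = ∫ r in Ioi (0 : ℝ), r ^ n * f r := by
  simp only [Measure.volumeIoiPow, ENNReal.ofReal]
  rw [integral_withDensity_eq_integral_smul,
    integral_subtype_comap measurableSet_Ioi fun a ↦ Real.toNNReal (a ^ n) • f a,
    setIntegral_congr_fun measurableSet_Ioi fun x hx ↦ ?_]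
  · rw [NNReal.smul_def, Real.coe_toNNReal _ (pow_nonneg hx.out.le _), smul_eq_mul]
  · exact (measurable_subtype_coe.pow_const _).real_toNNReal

/-- Integration in polar coordinates. -/
theorem integrable_polar [Nontrivial E] {V : E → ℝ} (hV : Integrable V μ) :
    (∀ᵐ r ∂(volume.restrict (Ioi (0 : ℝ))),
      Integrable (fun θ : sphere (0 : E) 1 => V (r • (θ : E))) μ.toSphere) ∧
    IntegrableOn (fun r => r ^ (finrank ℝ E - 1) * sphereIntegral μ V r) (Ioi 0) ∧
    ∫ x, V x ∂μ = ∫ r in Ioi (0 : ℝ), r ^ (finrank ℝ E - 1) * sphereIntegral μ V r := by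
  have hp := measurePreserving_polar μ
  have hemb : MeasurableEmbedding
      (fun z : sphere (0 : E) 1 × Ioi (0 : ℝ) => (z.2 : ℝ) • (z.1 : E)) :=
    (MeasurableEmbedding.subtype_coe (measurableSet_singleton (0 : E)).compl).comp
      (homeomorphUnitSphereProd E).symm.measurableEmbedding
  have h0 : Integrable V (μ.restrict {0}ᶜ) := hV.restrict
  have h1 := (hp.integrable_comp_emb hemb).2 h0
  refine ⟨?_, ?_, ?_⟩
  · rw [← ae_volumeIoiPow_iff (finrank ℝ E - 1)]
    exact h1.prod_left_ae
  · exact (integrable_volumeIoiPow_iff _).1 h1.integral_prod_right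
  · have h2 := hp.integral_comp hemb V
    rw [restrict_compl_singleton] at h2
    rw [← integral_volumeIoiPow, ← h2]
    exact integral_prod_symm _ h1

theorem sphereIntegral_mul_norm (V : E → ℝ) (f : ℝ → ℝ) {r : ℝ} (hr : 0 < r) :
    sphereIntegral μ (fun x => V x * f ‖x‖) r = sphereIntegral μ V r * f r := by
  rw [sphereIntegral, sphereIntegral, ← integral_mul_const]
  refine integral_congr_ae (.of_forall fun θ => ?_)
  simp [norm_smul, abs_of_pos hr]

theorem sphereIntegral_norm (f : ℝ → ℝ) {r : ℝ} (hr : 0 < r) :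
    sphereIntegral μ (fun x => f ‖x‖) r = μ.toSphere.real univ * f r := by
  have := sphereIntegral_mul_norm (μ := μ) (fun _ => 1) f hr
  simp only [one_mul] at this
  rw [this, sphereIntegral, integral_const, smul_eq_mul, mul_one]

/-- Integration in polar coordinates of a product with a radial factor. -/
theorem integral_mul_norm [Nontrivial E] {V : E → ℝ} {f : ℝ → ℝ}
    (hV : Integrable (fun x => V x * f ‖x‖) μ) :
    IntegrableOn (fun r => r ^ (finrank ℝ E - 1) * (sphereIntegral μ V r * f r)) (Ioi 0) ∧
    ∫ x, V x * f ‖x‖ ∂μ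
      = ∫ r in Ioi (0 : ℝ), r ^ (finrank ℝ E - 1) * (sphereIntegral μ V r * f r) := by
  have hc : ∀ r ∈ Ioi (0 : ℝ), r ^ (finrank ℝ E - 1) * sphereIntegral μ (fun x => V x * f ‖x‖) r
      = r ^ (finrank ℝ E - 1) * (sphereIntegral μ V r * f r) := fun r hr => by
    rw [sphereIntegral_mul_norm V f hr]
  obtain ⟨-, h2, h3⟩ := integrable_polar hV
  exact ⟨h2.congr_fun hc measurableSet_Ioi, h3.trans (setIntegral_congr_fun measurableSet_Ioi hc)⟩

theorem integrable_mul_indicator_norm {V : E → ℝ} (hV : LocallyIntegrable V μ) (A B : ℝ) :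
    Integrable (fun x => V x * (Icc A B).indicator (fun _ => (1 : ℝ)) ‖x‖) μ := by
  have h0 := (hV.integrableOn_isCompact (isCompact_closedBall (0 : E) B))
  have h2 : IntegrableOn V ((fun x : E => ‖x‖) ⁻¹' Icc A B) μ :=
    h0.mono_set fun x hx => by simpa using hx.2
  rw [← integrable_indicator_iff (measurableSet_Icc.preimage measurable_norm)] at h2
  refine h2.congr (.of_forall fun x => ?_)
  by_cases hx : ‖x‖ ∈ Icc A B
  · simp only [indicator_of_mem hx, mul_one]
    exact indicator_of_mem (s := (fun x : E => ‖x‖) ⁻¹' Icc A B) hx V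
  · simp only [indicator_of_notMem hx, mul_zero]
    exact indicator_of_notMem (s := (fun x : E => ‖x‖) ⁻¹' Icc A B) hx V

theorem ae_integrable_sphere [Nontrivial E] {V : E → ℝ} (hV : LocallyIntegrable V μ)
    {A B : ℝ} (hA : 0 < A) : ∀ᵐ r ∂(volume.restrict (Icc A B)),
      Integrable (fun θ : sphere (0 : E) 1 => V (r • (θ : E))) μ.toSphere := by
  have h1 := (integrable_polar (integrable_mul_indicator_norm hV A B)).1
  have h2 : Icc A B ⊆ Ioi (0 : ℝ) := fun r hr => hA.trans_le hr.1
  filter_upwards [ae_restrict_of_ae_restrict_of_subset h2 h1, ae_restrict_mem measurableSet_Icc]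
    with r hr hr'
  refine hr.congr (.of_forall fun θ => ?_)
  have : ‖r • (θ : E)‖ = r := by simp [norm_smul, abs_of_pos (hA.trans_le hr'.1)]
  simp only [this, indicator_of_mem hr', mul_one]

theorem integrableOn_Icc_of_pow_mul {f : ℝ → ℝ} {N : ℕ}
    (hf : IntegrableOn (fun r => r ^ N * f r) (Ioi 0)) {A B : ℝ} (hA : 0 < A) :
    IntegrableOn f (Icc A B) := by
  have h2 := hf.mono_set (fun r (hr : r ∈ Icc A B) => hA.trans_le hr.1)
  have h3 := h2.continuousOn_mul (g := fun r : ℝ => (r ^ N)⁻¹)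
    (ContinuousOn.inv₀ (by fun_prop) fun r hr => (pow_pos (hA.trans_le hr.1) _).ne') isCompact_Icc
  refine h3.congr_fun (fun r hr => ?_) measurableSet_Icc
  exact inv_mul_cancel_left₀ (pow_pos (hA.trans_le hr.1) _).ne' _

theorem integral_le_of_pow_mul {f : ℝ → ℝ} {N : ℕ} (hf0 : ∀ r, 0 < r → 0 ≤ f r)
    (hf : IntegrableOn (fun r => r ^ N * f r) (Ioi 0)) {A B : ℝ} (hA : 0 < A) (hAB : A ≤ B) :
    ∫ r in A..B, f r ≤ (A ^ N)⁻¹ * ∫ r in Ioi 0, r ^ N * f r := by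
  have hsub : Ioc A B ⊆ Ioi (0 : ℝ) := fun r hr => hA.trans hr.1
  rw [intervalIntegral.integral_of_le hAB, ← integral_const_mul]
  have hi : IntegrableOn (fun r => (A ^ N)⁻¹ * (r ^ N * f r)) (Ioi 0) := hf.const_mul _
  calc ∫ r in Ioc A B, f r ≤ ∫ r in Ioc A B, (A ^ N)⁻¹ * (r ^ N * f r) := by
        refine setIntegral_mono_on ((integrableOn_Icc_of_pow_mul hf hA).mono_set Ioc_subset_Icc_self)
          (hi.mono_set hsub) measurableSet_Ioc fun r hr => ?_
        rw [← mul_assoc]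
        refine le_mul_of_one_le_left (hf0 r (hsub hr)) ?_
        rw [inv_mul_eq_div, one_le_div (by positivity)]
        exact pow_le_pow_left₀ hA.le hr.1.le _
    _ ≤ _ := by
        refine setIntegral_mono_set hi ?_ hsub.eventuallyLE
        refine (ae_restrict_iff' measurableSet_Ioi).2 (ae_of_all _ fun r hr => ?_)
        have hr0 : (0 : ℝ) < r := hr
        have := hf0 r hr0
        show 0 ≤ (A ^ N)⁻¹ * (r ^ N * f r)
        positivity

theorem integrableOn_sphereIntegral [Nontrivial E] {V : E → ℝ} (hV : LocallyIntegrable V μ)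
    {A B : ℝ} (hA : 0 < A) : IntegrableOn (sphereIntegral μ V) (Icc A B) := by
  have h2 := (integral_mul_norm (integrable_mul_indicator_norm hV A B)).1
  refine (integrableOn_Icc_of_pow_mul h2 hA).congr_fun (fun r hr => ?_) measurableSet_Icc
  simp only [indicator_of_mem hr, mul_one]

end Polar

end AllenCahn

namespace AllenCahn

/-! ### Weak derivatives on the half-line -/

/-- `g` is the weak derivative of `f` on `(0, ∞)`, both functions being locally integrable there. -/
structure HasWeakDeriv (f g : ℝ → ℝ) : Prop where
  integrable : ∀ A B : ℝ, 0 < A → IntegrableOn f (Icc A B)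
  integrable' : ∀ A B : ℝ, 0 < A → IntegrableOn g (Icc A B)
  integral_eq : ∀ h : ℝ → ℝ, ContDiff ℝ ((⊤ : ℕ∞) : WithTop ℕ∞) h → HasCompactSupport h →
    tsupport h ⊆ Ioi 0 → ∫ r in Ioi 0, f r * deriv h r = - ∫ r in Ioi 0, g r * h r

theorem exists_Ioo_of_tsupport_subset_Ioi {h : ℝ → ℝ} (hc : HasCompactSupport h)
    (hs : tsupport h ⊆ Ioi 0) : ∃ A B, 0 < A ∧ A < 1 ∧ 1 < B ∧ tsupport h ⊆ Ioo A B := by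
  rcases (tsupport h).eq_empty_or_nonempty with he | hne
  · exact ⟨1 / 2, 2, by norm_num, by norm_num, by norm_num, by simp [he]⟩
  · have hcc : IsCompact (tsupport h) := hc
    obtain ⟨x, hx, hx'⟩ := hcc.exists_isLeast hne
    obtain ⟨y, hy, hy'⟩ := hcc.exists_isGreatest hne
    have hx0 : 0 < x := hs hx
    refine ⟨min (x / 2) (1 / 2), max (y + 1) 2, lt_min (by linarith) (by norm_num),
      (min_le_right _ _).trans_lt (by norm_num), lt_of_lt_of_le (by norm_num) (le_max_right _ _),
      fun z hz => ⟨?_, ?_⟩⟩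
    · have := hx' hz
      exact (min_le_left _ _).trans_lt (by linarith)
    · have := hy' hz
      exact lt_of_lt_of_le (by linarith) (le_max_left _ _)

theorem integral_Ioi_mul_eq {F h : ℝ → ℝ} {A B : ℝ} (hA : 0 < A) (hAB : A ≤ B)
    (hs : ∀ r ∉ Ioo A B, h r = 0) : ∫ r in Ioi 0, F r * h r = ∫ r in A..B, F r * h r := by
  rw [intervalIntegral.integral_of_le hAB]
  refine setIntegral_eq_of_subset_of_forall_sdiff_eq_zero measurableSet_Ioi
    (fun r hr => hA.trans hr.1) fun r hr => ?_
  rw [hs r (fun h' => hr.2 ⟨h'.1, h'.2.le⟩), mul_zero]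

theorem isPrimitiveOn_integral {g : ℝ → ℝ} (hg : ∀ A B : ℝ, 0 < A → IntegrableOn g (Icc A B))
    {A B : ℝ} (hA : 0 < A) (hAB : A ≤ B) :
    IsPrimitiveOn (fun r => ∫ t in (1 : ℝ)..r, g t) g A B := by
  have hi : ∀ x y : ℝ, 0 < x → 0 < y → IntervalIntegrable g volume x y := fun x y hx hy =>
    (intervalIntegrable_iff_integrableOn_Icc_of_le min_le_max |>.2
      (hg (min x y) (max x y) (lt_min hx hy))).mono_set (by
        rw [uIcc_of_le min_le_max]; exact subset_rfl)
  refine ⟨hi A B hA (hA.trans_le hAB), fun r hr => ?_⟩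
  exact (intervalIntegral.integral_add_adjacent_intervals (hi _ _ one_pos hA)
    (hi _ _ hA (hA.trans_le hr.1))).symm

theorem isPrimitiveOn_of_contDiff {h : ℝ → ℝ} (hh : ContDiff ℝ ((⊤ : ℕ∞) : WithTop ℕ∞) h)
    {A B : ℝ} (hAB : A ≤ B) : IsPrimitiveOn h (deriv h) A B :=
  IsPrimitiveOn.of_hasDerivAt
    (fun r _ => ((hh.differentiable (by norm_num)) r).hasDerivAt)
    (hh.continuous_deriv (by norm_num)).continuousOn hAB

theorem locallyIntegrableOn_Ioi {f : ℝ → ℝ} (hf : ∀ A B : ℝ, 0 < A → IntegrableOn f (Icc A B)) :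
    LocallyIntegrableOn f (Ioi 0) := fun x hx => by
  have hx0 : (0 : ℝ) < x := hx
  exact ⟨Icc (x / 2) (x + 1), mem_nhdsWithin_of_mem_nhds (Icc_mem_nhds (by linarith) (by linarith)),
    hf _ _ (by linarith)⟩

theorem integrableOn_Ioi_mul {f h : ℝ → ℝ} (hf : ∀ A B : ℝ, 0 < A → IntegrableOn f (Icc A B))
    (hh : Continuous h) (hc : HasCompactSupport h) (hs : tsupport h ⊆ Ioi 0) :
    IntegrableOn (fun r => f r * h r) (Ioi 0) := by
  obtain ⟨A, B, hA, hA1, h1B, hAB⟩ := exists_Ioo_of_tsupport_subset_Ioi hc hs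
  have h1 : IntegrableOn (fun r => f r * h r) (Icc A B) :=
    (hf A B hA).mul_continuousOn hh.continuousOn isCompact_Icc
  refine h1.of_forall_sdiff_eq_zero measurableSet_Ioi fun r hr => ?_
  rw [image_eq_zero_of_notMem_tsupport fun hr' => hr.2 (Ioo_subset_Icc_self (hAB hr')), mul_zero]

/-- A locally integrable function on `(0, ∞)` with zero weak derivative is constant. -/
theorem ae_eq_const_of_weakDeriv_zero {F : ℝ → ℝ}
    (hF : ∀ A B : ℝ, 0 < A → IntegrableOn F (Icc A B))
    (h0 : ∀ h : ℝ → ℝ, ContDiff ℝ ((⊤ : ℕ∞) : WithTop ℕ∞) h → HasCompactSupport h →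
      tsupport h ⊆ Ioi 0 → ∫ r in Ioi 0, F r * deriv h r = 0) :
    ∃ c, ∀ᵐ r ∂(volume.restrict (Ioi (0 : ℝ))), F r = c := by
  obtain ⟨φ, hφs, hφc, hφd, hφr, hφ1⟩ := exists_contDiff_tsupport_subset (E := ℝ)
    (n := ⊤) (s := Ioi 0) (x := 1) (Ioi_mem_nhds one_pos)
  have hφi : 0 < ∫ r, φ r :=
    hφd.continuous.integral_pos_of_hasCompactSupport_nonneg_nonzero hφc
      (fun r => (hφr (mem_range_self r)).1) (x := 1) (by rw [hφ1]; exact one_ne_zero)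
  set c := (∫ r, φ r)⁻¹ * ∫ r in Ioi 0, F r * φ r with hc
  refine ⟨c, ?_⟩
  have hFc : ∀ A B : ℝ, 0 < A → IntegrableOn (fun r => F r - c) (Icc A B) := fun A B hA =>
    (hF A B hA).sub (continuousOn_const.integrableOn_Icc)
  have key := isOpen_Ioi.ae_eq_zero_of_integral_contDiff_smul_eq_zero (μ := volume)
    (locallyIntegrableOn_Ioi hFc) fun η hηd hηc hηs => ?_
  · rw [ae_restrict_iff' measurableSet_Ioi]
    filter_upwards [key] with r hr hr0
    linarith [hr hr0]
  obtain ⟨A₁, B₁, hA₁, hA₁1, hB₁, hs₁⟩ := exists_Ioo_of_tsupport_subset_Ioi hηc hηs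
  obtain ⟨A₂, B₂, hA₂, hA₂1, hB₂, hs₂⟩ := exists_Ioo_of_tsupport_subset_Ioi hφc hφs
  set A := min A₁ A₂
  set B := max B₁ B₂
  have hA : 0 < A := lt_min hA₁ hA₂
  have hAB : A < B := (min_le_left _ _).trans_lt (hA₁1.trans (hB₁.trans_le (le_max_left _ _)))
  have hη0 : ∀ r ∉ Ioo A B, η r = 0 := fun r hr => image_eq_zero_of_notMem_tsupport fun h =>
    hr ⟨(min_le_left _ _).trans_lt (hs₁ h).1, (hs₁ h).2.trans_le (le_max_left _ _)⟩
  have hφ0 : ∀ r ∉ Ioo A B, φ r = 0 := fun r hr => image_eq_zero_of_notMem_tsupport fun h =>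
    hr ⟨(min_le_right _ _).trans_lt (hs₂ h).1, (hs₂ h).2.trans_le (le_max_right _ _)⟩
  -- subtracting a multiple of the bump makes the primitive compactly supported
  set k : ℝ → ℝ := fun r => η r - ((∫ r, η r) * (∫ r, φ r)⁻¹) * φ r with hk
  have hkd : ContDiff ℝ ((⊤ : ℕ∞) : WithTop ℕ∞) k := hηd.sub (contDiff_const.mul hφd)
  have hk0 : ∀ r ∉ Ioo A B, k r = 0 := fun r hr => by
    simp only [hk]; rw [hη0 r hr, hφ0 r hr]; ring
  have hηi : Integrable η := hηd.continuous.integrable_of_hasCompactSupport hηc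
  have hφi' : Integrable φ := hφd.continuous.integrable_of_hasCompactSupport hφc
  have hkint : ∫ r in A..B, k r = 0 := by
    have h1 : ∫ r in A..B, k r = ∫ r, k r := by
      rw [intervalIntegral.integral_of_le hAB.le]
      exact setIntegral_eq_integral_of_forall_compl_eq_zero fun r hr =>
        hk0 r fun h => hr ⟨h.1, h.2.le⟩
    rw [h1, integral_sub hηi (hφi'.const_mul _), integral_const_mul]
    field_simp
    ring
  set K : ℝ → ℝ := fun r => ∫ t in A..r, k t with hK
  have hKd : ∀ r, HasDerivAt K (k r) r := fun r =>
    intervalIntegral.integral_hasDerivAt_right (hkd.continuous.intervalIntegrable _ _)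
      hkd.continuous.aestronglyMeasurable.stronglyMeasurableAtFilter hkd.continuous.continuousAt
  have hKderiv : deriv K = k := funext fun r => (hKd r).deriv
  have hKc : ContDiff ℝ ((⊤ : ℕ∞) : WithTop ℕ∞) K := by
    rw [contDiff_infty_iff_deriv, hKderiv]
    exact ⟨fun r => (hKd r).differentiableAt, hkd⟩
  have hK0 : ∀ r ∉ Icc A B, K r = 0 := fun r hr => by
    rw [mem_Icc, not_and_or, not_le, not_le] at hr
    rcases hr with hr | hr
    · refine intervalIntegral.integral_zero_ae (ae_of_all _ fun t ht => hk0 t fun h => ?_)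
      rw [uIoc_of_ge hr.le] at ht
      exact absurd h.1 (not_lt.2 ht.2)
    · have h2 : ∫ t in B..r, k t = 0 :=
        intervalIntegral.integral_zero_ae (ae_of_all _ fun t ht => hk0 t fun h => by
          rw [uIoc_of_le hr.le] at ht
          exact absurd h.2 (not_lt.2 ht.1.le))
      simp only [hK]
      rw [← intervalIntegral.integral_add_adjacent_intervals
        (hkd.continuous.intervalIntegrable A B) (hkd.continuous.intervalIntegrable B r), hkint, h2,
        add_zero]
  have hKs : tsupport K ⊆ Icc A B := closure_minimal (fun r hr => by
    by_contra h; exact hr (hK0 r h)) isClosed_Icc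
  have hzero := h0 K hKc (HasCompactSupport.of_support_subset_isCompact isCompact_Icc
    (subset_closure.trans hKs)) (hKs.trans fun r hr => hA.trans_le hr.1)
  rw [hKderiv] at hzero
  have hFη := integrableOn_Ioi_mul hF hηd.continuous hηc hηs
  have hFφ := integrableOn_Ioi_mul hF hφd.continuous hφc hφs
  have h1 : ∫ r in Ioi 0, F r * k r = (∫ r in Ioi 0, F r * η r) - (∫ r, η r) * c := by
    have : ∀ r, F r * k r = F r * η r - ((∫ r, η r) * (∫ r, φ r)⁻¹) * (F r * φ r) := fun r => by
      simp only [hk]; ring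
    simp_rw [this]
    rw [integral_sub hFη (hFφ.const_mul _), integral_const_mul, hc, mul_assoc]
  have h2 : ∫ r, η r • (F r - c) = ∫ r in Ioi 0, (F r * η r - c * η r) := by
    rw [← setIntegral_eq_integral_of_forall_compl_eq_zero (s := Ioi 0)]
    · refine integral_congr_ae (ae_of_all _ fun r => ?_)
      simp only [smul_eq_mul]; ring
    · intro r hr
      rw [image_eq_zero_of_notMem_tsupport fun h => hr (hηs h), zero_smul]
  rw [h2, integral_sub hFη (hηi.integrableOn.const_mul c), integral_const_mul,
    setIntegral_eq_integral_of_forall_compl_eq_zero (f := η)]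
  · linarith
  · intro r hr
    exact image_eq_zero_of_notMem_tsupport fun h => hr (hηs h)

/-- A function with a weak derivative is the primitive of its weak derivative, up to a constant. -/
theorem HasWeakDeriv.ae_eq {f g : ℝ → ℝ} (hfg : HasWeakDeriv f g) :
    ∃ c, ∀ᵐ r ∂(volume.restrict (Ioi (0 : ℝ))), f r = c + ∫ t in (1 : ℝ)..r, g t := by
  set P : ℝ → ℝ := fun r => ∫ t in (1 : ℝ)..r, g t with hP
  have hPp : ∀ A B : ℝ, 0 < A → A ≤ B → IsPrimitiveOn P g A B := fun A B hA hAB =>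
    isPrimitiveOn_integral hfg.integrable' hA hAB
  have hPi : ∀ A B : ℝ, 0 < A → IntegrableOn P (Icc A B) := fun A B hA => by
    rcases le_or_gt A B with h | h
    · exact ((hPp A B hA h).continuousOn h).integrableOn_Icc
    · rw [Icc_eq_empty (not_le.2 h)]; exact integrableOn_empty
  suffices h0 : ∀ h : ℝ → ℝ, ContDiff ℝ ((⊤ : ℕ∞) : WithTop ℕ∞) h → HasCompactSupport h →
      tsupport h ⊆ Ioi 0 → ∫ r in Ioi 0, (f r - P r) * deriv h r = 0 by
    obtain ⟨c, hc⟩ := ae_eq_const_of_weakDeriv_zero (F := fun r => f r - P r)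
      (fun A B hA => (hfg.integrable A B hA).sub (hPi A B hA)) h0
    exact ⟨c, hc.mono fun r hr => by linarith⟩
  intro h hd hcs hs
  obtain ⟨A, B, hA, hA1, hB, hsAB⟩ := exists_Ioo_of_tsupport_subset_Ioi hcs hs
  have hAB : A ≤ B := (hA1.trans hB).le
  have h0 : ∀ r ∉ Ioo A B, h r = 0 := fun r hr => image_eq_zero_of_notMem_tsupport fun h' =>
    hr (hsAB h')
  have h0' : ∀ r ∉ Ioo A B, deriv h r = 0 := fun r hr => image_eq_zero_of_notMem_tsupport fun h' =>
    hr (hsAB (tsupport_deriv_subset h'))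
  have hmul := ((hPp A B hA hAB).mul (isPrimitiveOn_of_contDiff hd hAB) hAB).sub_eq le_rfl hAB le_rfl
  rw [h0 A (by simp), h0 B (by simp), mul_zero, mul_zero, sub_zero] at hmul
  have hcd : Continuous (deriv h) := hd.continuous_deriv (by norm_num)
  have hgi : IntervalIntegrable (fun r => g r * h r) volume A B :=
    ((hPp A B hA hAB).1).mul_continuousOn hd.continuous.continuousOn
  have hPi' : IntervalIntegrable (fun r => P r * deriv h r) volume A B := by
    apply ContinuousOn.intervalIntegrable
    rw [uIcc_of_le hAB]
    exact ((hPp A B hA hAB).continuousOn hAB).mul hcd.continuousOn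
  rw [intervalIntegral.integral_add hgi hPi'] at hmul
  have h1 := hfg.integral_eq h hd hcs hs
  have hd' : HasCompactSupport (deriv h) := hcs.deriv
  have hds : tsupport (deriv h) ⊆ Ioi 0 := tsupport_deriv_subset.trans hs
  simp_rw [sub_mul]
  rw [integral_sub (integrableOn_Ioi_mul hfg.integrable hcd hd' hds)
    (integrableOn_Ioi_mul hPi hcd hd' hds), h1, integral_Ioi_mul_eq hA hAB h0,
    integral_Ioi_mul_eq hA hAB h0']
  linarith

end AllenCahn

namespace AllenCahn

/-! ### Radial test functions -/

section TestFunctions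

variable {E : Type*} [NormedAddCommGroup E] [InnerProductSpace ℝ E] {h : ℝ → ℝ}

theorem eventually_comp_norm_eq_zero (hs : tsupport h ⊆ Ioi 0) :
    (fun x : E => h ‖x‖) =ᶠ[𝓝 0] 0 := by
  have h0 : (0 : ℝ) ∉ tsupport h := fun h' => lt_irrefl (0 : ℝ) (hs h')
  have h1 := notMem_tsupport_iff_eventuallyEq.1 h0
  have h2 : Tendsto (fun x : E => ‖x‖) (𝓝 0) (𝓝 0) := tendsto_norm_zero
  exact h2.eventually h1

theorem contDiff_comp_norm (hd : ContDiff ℝ ((⊤ : ℕ∞) : WithTop ℕ∞) h) (hs : tsupport h ⊆ Ioi 0) :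
    ContDiff ℝ ((⊤ : ℕ∞) : WithTop ℕ∞) fun x : E => h ‖x‖ := by
  rw [contDiff_iff_contDiffAt]
  intro x
  rcases eq_or_ne x 0 with rfl | hx
  · exact contDiffAt_const.congr_of_eventuallyEq (eventually_comp_norm_eq_zero hs)
  · exact hd.contDiffAt.comp x (contDiffAt_norm ℝ hx)

theorem hasFDerivAt_norm_of_ne_zero {x : E} (hx : x ≠ 0) :
    HasFDerivAt (fun x : E => ‖x‖) (‖x‖⁻¹ • innerSL ℝ x) x := by
  have h1 := ((hasStrictFDerivAt_norm_sq x).hasFDerivAt).sqrt (pow_ne_zero 2 (norm_ne_zero_iff.2 hx))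
  simp only [Real.sqrt_sq (norm_nonneg _)] at h1
  convert h1 using 1
  ext v
  have := norm_ne_zero_iff.2 hx
  simp
  field_simp

theorem hasFDerivAt_comp_norm {h' : ℝ} {x : E} (hx : x ≠ 0) (hh : HasDerivAt h h' ‖x‖) :
    HasFDerivAt (fun x : E => h ‖x‖) ((h' * ‖x‖⁻¹) • innerSL ℝ x) x := by
  have := hh.comp_hasFDerivAt x (hasFDerivAt_norm_of_ne_zero hx)
  rwa [smul_smul] at this

theorem fderiv_comp_norm (hd : ContDiff ℝ ((⊤ : ℕ∞) : WithTop ℕ∞) h) (hs : tsupport h ⊆ Ioi 0)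
    (x : E) : fderiv ℝ (fun x : E => h ‖x‖) x = (deriv h ‖x‖ * ‖x‖⁻¹) • innerSL ℝ x := by
  rcases eq_or_ne x 0 with rfl | hx
  · rw [(eventually_comp_norm_eq_zero hs).fderiv_eq]
    ext v
    simp
  · exact (hasFDerivAt_comp_norm hx ((hd.differentiable (by norm_num)) _).hasDerivAt).fderiv

theorem hasCompactSupport_comp_norm [FiniteDimensional ℝ E] (hc : HasCompactSupport h)
    (hs : tsupport h ⊆ Ioi 0) : HasCompactSupport fun x : E => h ‖x‖ := by
  obtain ⟨A, B, -, -, -, hAB⟩ := exists_Ioo_of_tsupport_subset_Ioi hc hs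
  refine HasCompactSupport.intro (isCompact_closedBall (0 : E) B) fun x hx => ?_
  refine image_eq_zero_of_notMem_tsupport fun h' => hx ?_
  rw [mem_closedBall_zero_iff]
  exact (hAB h').2.le

/-- Division by a power of `r` does not affect smoothness of a test function on `(0, ∞)`. -/
theorem contDiff_mul_inv_pow (hd : ContDiff ℝ ((⊤ : ℕ∞) : WithTop ℕ∞) h) (hs : tsupport h ⊆ Ioi 0)
    (n : ℕ) : ContDiff ℝ ((⊤ : ℕ∞) : WithTop ℕ∞) fun r => h r * (r ^ n)⁻¹ := by
  rw [contDiff_iff_contDiffAt]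
  intro r
  rcases eq_or_ne r 0 with rfl | hr
  · have h0 : (0 : ℝ) ∉ tsupport h := fun h' => lt_irrefl (0 : ℝ) (hs h')
    have h1 := notMem_tsupport_iff_eventuallyEq.1 h0
    refine (contDiffAt_const (c := (0 : ℝ))).congr_of_eventuallyEq ?_
    filter_upwards [h1] with r hr
    rw [hr]; simp
  · exact hd.contDiffAt.mul ((contDiffAt_id.pow n).inv (pow_ne_zero n hr))

end TestFunctions

/-! ### Weak partial derivatives -/

variable {n : ℕ}

theorem HasWeakPartial.ae_unique {i : Fin n} {u v v' : Space n → ℝ} (h : HasWeakPartial i u v)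
    (h' : HasWeakPartial i u v') : v =ᵐ[volume] v' := by
  refine ae_eq_of_integral_contDiff_smul_eq h.2.1 h'.2.1 fun φ hd hc => ?_
  have h1 := h.2.2 φ hd hc
  have h2 := h'.2.2 φ hd hc
  simp only [smul_eq_mul, mul_comm (φ _)]
  linarith

theorem HasWeakPartial.congr {i : Fin n} {u u' v : Space n → ℝ} (h : HasWeakPartial i u v)
    (hu : u =ᵐ[volume] u') : HasWeakPartial i u' v := by
  refine ⟨h.1.congr hu, h.2.1, fun φ hd hc => ?_⟩
  rw [← h.2.2 φ hd hc]
  exact integral_congr_ae (hu.mono fun x hx => by simp only [hx])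

theorem hasWeakPartial_weakPartial {i : Fin n} {u v : Space n → ℝ} (h : HasWeakPartial i u v) :
    HasWeakPartial i u (weakPartial i u) := by
  have h' : ∃ v, HasWeakPartial i u v := ⟨v, h⟩
  rw [weakPartial, dif_pos h']
  exact h'.choose_spec

theorem MemSobolevLoc.hasWeakPartial {p : ℝ≥0∞} {k : ℕ} {u : Space n → ℝ}
    (h : MemSobolevLoc p (k + 1) u) (i : Fin n) : HasWeakPartial i u (weakPartial i u) := by
  obtain ⟨-, h⟩ := h
  obtain ⟨v, hv, -⟩ := h i
  exact hasWeakPartial_weakPartial hv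

theorem MemSobolevLoc.hasWeakPartial₂ {p : ℝ≥0∞} {k : ℕ} {u : Space n → ℝ}
    (h : MemSobolevLoc p (k + 2) u) (i : Fin n) :
    HasWeakPartial i (weakPartial i u) (weakPartial i (weakPartial i u)) := by
  obtain ⟨-, h'⟩ := h
  obtain ⟨v, hv, -, hv'⟩ := h' i
  obtain ⟨z, hz, -⟩ := hv' i
  exact hasWeakPartial_weakPartial (hz.congr (hv.ae_unique (hasWeakPartial_weakPartial hv)))

theorem _root_.MeasureTheory.LocallyIntegrable.integrable_mul {u φ : Space n → ℝ}
    (hu : LocallyIntegrable u) (hφ : Continuous φ) (hc : HasCompactSupport φ) :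
    Integrable fun x => u x * φ x := by
  simpa only [smul_eq_mul, mul_comm] using hu.integrable_smul_left_of_hasCompactSupport hφ hc

theorem locallyIntegrable_sum {v : Fin n → Space n → ℝ} (hv : ∀ i, LocallyIntegrable (v i)) :
    LocallyIntegrable fun x => ∑ i, v i x := by
  rw [locallyIntegrable_iff]
  exact fun K hK => integrable_finsetSum _ fun i _ => (hv i).integrableOn_isCompact hK

theorem fderiv_mul_apply_single {φ : Space n → ℝ} (hφ : Differentiable ℝ φ) (i : Fin n)
    (x : Space n) : fderiv ℝ (fun x => φ x * x i) x (EuclideanSpace.single i 1)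
      = fderiv ℝ φ x (EuclideanSpace.single i 1) * x i + φ x := by
  have h1 : HasFDerivAt (fun x : Space n => x i) (EuclideanSpace.proj i : Space n →L[ℝ] ℝ) x :=
    (EuclideanSpace.proj i : Space n →L[ℝ] ℝ).hasFDerivAt
  rw [((hφ x).hasFDerivAt.fun_mul h1).fderiv]
  simp [mul_comm, add_comm]

theorem continuous_fderiv_apply {φ : Space n → ℝ} (hd : ContDiff ℝ ((⊤ : ℕ∞) : WithTop ℕ∞) φ)
    (v : Space n) : Continuous fun x => fderiv ℝ φ x v :=
  (hd.continuous_fderiv (by norm_num)).clm_apply continuous_const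

theorem hasCompactSupport_fderiv_apply {φ : Space n → ℝ} (hc : HasCompactSupport φ)
    (v : Space n) : HasCompactSupport fun x => fderiv ℝ φ x v :=
  hc.fderiv_apply ℝ v

/-- The spherical means of `u` are weakly differentiable, and the weak derivative is the spherical
mean of the radial derivative. The test fields are `h(|x|) |x| ^ (-n) x`. -/
theorem hasWeakDeriv_sphereIntegral [Nontrivial (Space n)] {u : Space n → ℝ}
    {v : Fin n → Space n → ℝ} (hv : ∀ i, HasWeakPartial i u (v i)) :
    HasWeakDeriv (sphereIntegral volume u)
      (fun r => r⁻¹ * sphereIntegral volume (fun x => ∑ i, v i x * x i) r) := by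
  have hn : 0 < n := by
    have := Module.finrank_pos (R := ℝ) (M := Space n)
    rwa [finrank_euclideanSpace_fin] at this
  have hu : LocallyIntegrable u := (hv ⟨0, hn⟩).1
  have hV : LocallyIntegrable fun x => ∑ i, v i x * x i :=
    locallyIntegrable_sum fun i => (hv i).2.1.mul_continuous (by fun_prop)
  refine ⟨fun A B hA => integrableOn_sphereIntegral hu hA, fun A B hA => ?_, fun h hd hc hs => ?_⟩
  · exact (integrableOn_sphereIntegral hV hA).continuousOn_mul
      (continuousOn_id.inv₀ fun r hr => (hA.trans_le hr.1).ne') isCompact_Icc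
  set k : ℝ → ℝ := fun r => h r * (r ^ n)⁻¹ with hk
  have hkd := contDiff_mul_inv_pow hd hs n
  have hks : tsupport k ⊆ Ioi 0 := (tsupport_mul_subset_left).trans hs
  have hkc : HasCompactSupport k := hc.mul_right
  have hψd : ContDiff ℝ ((⊤ : ℕ∞) : WithTop ℕ∞) fun x : Space n => k ‖x‖ := contDiff_comp_norm hkd hks
  have hψc : HasCompactSupport fun x : Space n => k ‖x‖ := hasCompactSupport_comp_norm hkc hks
  have hφd : ∀ i, ContDiff ℝ ((⊤ : ℕ∞) : WithTop ℕ∞) fun x : Space n => k ‖x‖ * x i := fun i =>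
    hψd.mul (by fun_prop)
  have hφc : ∀ i, HasCompactSupport fun x : Space n => k ‖x‖ * x i := fun i => hψc.mul_right
  have hweak : ∑ i, ∫ x, u x * fderiv ℝ (fun x : Space n => k ‖x‖ * x i) x
      (EuclideanSpace.single i 1) = - ∑ i, ∫ x, v i x * (k ‖x‖ * x i) := by
    rw [← Finset.sum_neg_distrib]
    exact Finset.sum_congr rfl fun i _ => (hv i).2.2 _ (hφd i) (hφc i)
  have hi1 : ∀ i, Integrable fun x => u x * fderiv ℝ (fun x : Space n => k ‖x‖ * x i) x
      (EuclideanSpace.single i 1) := fun i =>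
    hu.integrable_mul (continuous_fderiv_apply (hφd i) _) (hasCompactSupport_fderiv_apply (hφc i) _)
  have hi2 : ∀ i, Integrable fun x => v i x * (k ‖x‖ * x i) := fun i =>
    (hv i).2.1.integrable_mul (hφd i).continuous (hφc i)
  rw [← integral_finsetSum _ fun i _ => hi1 i, ← integral_finsetSum _ fun i _ => hi2 i] at hweak
  have hdiv : ∀ x : Space n, ∑ i, u x * fderiv ℝ (fun x : Space n => k ‖x‖ * x i) x
      (EuclideanSpace.single i 1) = u x * (deriv h ‖x‖ * (‖x‖ ^ (n - 1))⁻¹) := fun x => by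
    rw [← Finset.mul_sum]
    congr 1
    simp_rw [fderiv_mul_apply_single (hψd.differentiable (by norm_num)), fderiv_comp_norm (h := k) hkd hks]
    rcases eq_or_ne x 0 with rfl | hx
    · have h0 : (0 : ℝ) ∉ tsupport h := fun h' => lt_irrefl (0 : ℝ) (hs h')
      have h1 : deriv h 0 = 0 := image_eq_zero_of_notMem_tsupport fun h' =>
        h0 (tsupport_deriv_subset h')
      have h2 : h 0 = 0 := image_eq_zero_of_notMem_tsupport h0
      simp [hk, h1, h2]
    · have hx0 : ‖x‖ ≠ 0 := norm_ne_zero_iff.2 hx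
      have hk' : deriv k ‖x‖ = deriv h ‖x‖ * (‖x‖ ^ n)⁻¹
          + h ‖x‖ * (-(n * ‖x‖ ^ (n - 1)) / (‖x‖ ^ n) ^ 2) :=
        (((hd.differentiable (by norm_num)) _).hasDerivAt.mul
          ((hasDerivAt_pow n ‖x‖).inv (pow_ne_zero n hx0))).deriv
      have hsq : ∑ i, x i * x i = ‖x‖ ^ 2 := by
        rw [EuclideanSpace.real_norm_sq_eq]
        exact Finset.sum_congr rfl fun i _ => (sq _).symm
      rw [Finset.sum_add_distrib]
      simp only [FunLike.coe_smul, Pi.smul_apply, innerSL_apply_apply,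
        EuclideanSpace.inner_single_right, smul_eq_mul, Finset.sum_const, Finset.card_univ,
        Fintype.card_fin, nsmul_eq_mul, conj_trivial, one_mul]
      simp_rw [mul_assoc]
      rw [← Finset.mul_sum, ← Finset.mul_sum, hsq, hk']
      obtain ⟨N, rfl⟩ : ∃ N, n = N + 1 := ⟨n - 1, by omega⟩
      simp only [hk, Nat.add_sub_cancel]
      push_cast
      field_simp
      ring
  have hsum : ∀ x : Space n, ∑ i, v i x * (k ‖x‖ * x i) = (∑ i, v i x * x i) * k ‖x‖ := fun x => by
    rw [Finset.sum_mul]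
    exact Finset.sum_congr rfl fun i _ => by ring
  have hI1 : Integrable fun x => u x * (deriv h ‖x‖ * (‖x‖ ^ (n - 1))⁻¹) :=
    (integrable_finsetSum _ fun i _ => hi1 i).congr (.of_forall hdiv)
  have hI2 : Integrable fun x => (∑ i, v i x * x i) * k ‖x‖ :=
    (integrable_finsetSum _ fun i _ => hi2 i).congr (.of_forall hsum)
  simp_rw [hdiv, hsum] at hweak
  rw [(integral_mul_norm (f := fun r => deriv h r * (r ^ (n - 1))⁻¹) hI1).2,
    (integral_mul_norm hI2).2, finrank_euclideanSpace_fin] at hweak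
  convert hweak using 1
  · refine setIntegral_congr_fun measurableSet_Ioi fun r hr => ?_
    have : r ^ (n - 1) ≠ 0 := (pow_pos hr _).ne'
    field_simp
  · congr 1
    refine setIntegral_congr_fun measurableSet_Ioi fun r hr => ?_
    have hr0 : r ≠ 0 := ne_of_gt hr
    obtain ⟨N, rfl⟩ : ∃ N, n = N + 1 := ⟨n - 1, by omega⟩
    simp only [hk, Nat.add_sub_cancel, pow_succ]
    field_simp

/-- The flux of a weakly differentiable vector field through spheres is weakly differentiable, and
the weak derivative is the spherical integral of the divergence. -/
theorem hasWeakDeriv_flux [Nontrivial (Space n)] {v z : Fin n → Space n → ℝ}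
    (hv : ∀ i, HasWeakPartial i (v i) (z i)) :
    HasWeakDeriv
      (fun r => r ^ (n - 1) * (r⁻¹ * sphereIntegral volume (fun x => ∑ i, v i x * x i) r))
      (fun r => r ^ (n - 1) * sphereIntegral volume (fun x => ∑ i, z i x) r) := by
  have hV : LocallyIntegrable fun x => ∑ i, v i x * x i :=
    locallyIntegrable_sum fun i => (hv i).1.mul_continuous (by fun_prop)
  have hZ : LocallyIntegrable fun x => ∑ i, z i x := locallyIntegrable_sum fun i => (hv i).2.1
  refine ⟨fun A B hA => ?_, fun A B hA => ?_, fun h hd hc hs => ?_⟩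
  · exact ((integrableOn_sphereIntegral hV hA).continuousOn_mul
      (continuousOn_id.inv₀ fun r hr => (hA.trans_le hr.1).ne') isCompact_Icc).continuousOn_mul
      (by fun_prop) isCompact_Icc
  · exact (integrableOn_sphereIntegral hZ hA).continuousOn_mul (by fun_prop) isCompact_Icc
  have hψd : ContDiff ℝ ((⊤ : ℕ∞) : WithTop ℕ∞) fun x : Space n => h ‖x‖ := contDiff_comp_norm hd hs
  have hψc : HasCompactSupport fun x : Space n => h ‖x‖ := hasCompactSupport_comp_norm hc hs
  have hweak : ∑ i, ∫ x, v i x * fderiv ℝ (fun x : Space n => h ‖x‖) x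
      (EuclideanSpace.single i 1) = - ∑ i, ∫ x, z i x * h ‖x‖ := by
    rw [← Finset.sum_neg_distrib]
    exact Finset.sum_congr rfl fun i _ => (hv i).2.2 _ hψd hψc
  have hi1 : ∀ i, Integrable fun x => v i x * fderiv ℝ (fun x : Space n => h ‖x‖) x
      (EuclideanSpace.single i 1) := fun i =>
    (hv i).1.integrable_mul (continuous_fderiv_apply hψd _) (hasCompactSupport_fderiv_apply hψc _)
  have hi2 : ∀ i, Integrable fun x => z i x * h ‖x‖ := fun i =>
    (hv i).2.1.integrable_mul hψd.continuous hψc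
  rw [← integral_finsetSum _ fun i _ => hi1 i, ← integral_finsetSum _ fun i _ => hi2 i] at hweak
  have hdiv : ∀ x : Space n, ∑ i, v i x * fderiv ℝ (fun x : Space n => h ‖x‖) x
      (EuclideanSpace.single i 1) = (∑ i, v i x * x i) * (deriv h ‖x‖ * ‖x‖⁻¹) := fun x => by
    rw [Finset.sum_mul, fderiv_comp_norm hd hs]
    refine Finset.sum_congr rfl fun i _ => ?_
    simp only [FunLike.coe_smul, Pi.smul_apply, innerSL_apply_apply,
      EuclideanSpace.inner_single_right, smul_eq_mul, conj_trivial, one_mul]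
    ring
  have hsum : ∀ x : Space n, ∑ i, z i x * h ‖x‖ = (∑ i, z i x) * h ‖x‖ := fun x => by
    rw [Finset.sum_mul]
  have hI1 : Integrable fun x => (∑ i, v i x * x i) * (deriv h ‖x‖ * ‖x‖⁻¹) :=
    (integrable_finsetSum _ fun i _ => hi1 i).congr (.of_forall hdiv)
  have hI2 : Integrable fun x => (∑ i, z i x) * h ‖x‖ :=
    (integrable_finsetSum _ fun i _ => hi2 i).congr (.of_forall hsum)
  simp_rw [hdiv, hsum] at hweak
  rw [(integral_mul_norm (f := fun r => deriv h r * r⁻¹) hI1).2,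
    (integral_mul_norm hI2).2, finrank_euclideanSpace_fin] at hweak
  convert hweak using 1
  · refine setIntegral_congr_fun measurableSet_Ioi fun r hr => ?_
    ring
  · congr 1
    refine setIntegral_congr_fun measurableSet_Ioi fun r hr => ?_
    ring

end AllenCahn

namespace AllenCahn

/-! ### The radial profile of a Sobolev function -/

variable {n : ℕ}

/-- The area of the unit sphere. -/
noncomputable def sphereArea (n : ℕ) : ℝ := (volume : Measure (Space n)).toSphere.real univ

theorem sphereArea_pos [Nontrivial (Space n)] : 0 < sphereArea n := by
  have : NeZero (volume : Measure (Space n)).toSphere := ⟨Measure.toSphere_ne_zero _⟩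
  exact measureReal_univ_pos

/-- `w` is a representative of the radial function `u`, with derivative `w'` and with radial
Laplacian `L = w'' + (n - 1) w' / r`. -/
structure IsRadialProfile (u : Space n → ℝ) (w w' L : ℝ → ℝ) : Prop where
  ae_eq : ∀ᵐ x : Space n, u x = w ‖x‖
  hasDerivAt : ∀ r, 0 < r → HasDerivAt w (w' r) r
  primitive : ∀ A B, 0 < A → A ≤ B → IsPrimitiveOn w' (fun r => L r - (n - 1) / r * w' r) A B
  grad : ∀ᵐ x : Space n, weakGrad u x = (w' ‖x‖ * ‖x‖⁻¹) • x
  laplacian : ∀ r, sphereArea n * L r = sphereIntegral volume (weakLaplacian u) r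

/-- Off the origin, the weak partial derivatives of a radial function are the classical ones. -/
theorem HasWeakPartial.ae_eq_radial [Nontrivial (Space n)] {i : Fin n} {u v : Space n → ℝ}
    (hv : HasWeakPartial i u v) {w w' : ℝ → ℝ} (hu : ∀ᵐ x : Space n, u x = w ‖x‖)
    (hw : ∀ r, 0 < r → HasDerivAt w (w' r) r) (hw' : ContinuousOn w' (Ioi 0)) :
    ∀ᵐ x : Space n, v x = w' ‖x‖ * ‖x‖⁻¹ * x i := by
  set ψ : Space n → ℝ := fun x => w' ‖x‖ * ‖x‖⁻¹ * x i with hψ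
  have hψc : ContinuousOn ψ {0}ᶜ := by
    have h1 : ContinuousOn (fun x : Space n => w' ‖x‖) {0}ᶜ :=
      hw'.comp continuous_norm.continuousOn fun x hx => norm_pos_iff.2 hx
    have h2 : ContinuousOn (fun x : Space n => ‖x‖⁻¹) {0}ᶜ :=
      continuous_norm.continuousOn.inv₀ fun x hx => norm_ne_zero_iff.2 hx
    exact (h1.mul h2).mul (by fun_prop)
  have hopen : IsOpen ({0}ᶜ : Set (Space n)) := isOpen_compl_singleton
  have key := hopen.ae_eq_zero_of_integral_contDiff_smul_eq_zero (μ := volume)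
    (f := fun x => v x - ψ x)
    ((hv.2.1.locallyIntegrableOn _).sub
      (hψc.locallyIntegrableOn hopen.measurableSet)) fun φ hd hc hs => ?_
  · have h0 : ∀ᵐ x : Space n, x ∈ ({0}ᶜ : Set (Space n)) := compl_mem_ae_iff.2 (measure_singleton 0)
    filter_upwards [key, h0] with x hx hx0
    linarith [hx hx0]
  · set f : Space n → ℝ := fun x => w ‖x‖ with hf
    have hfd : ∀ x ∈ ({0}ᶜ : Set (Space n)),
        HasFDerivAt f ((w' ‖x‖ * ‖x‖⁻¹) • innerSL ℝ x) x := fun x hx =>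
      hasFDerivAt_comp_norm hx (hw _ (norm_pos_iff.2 hx))
    have hfφ : ∀ x, fderiv ℝ f x (EuclideanSpace.single i 1) * φ x = ψ x * φ x := fun x => by
      by_cases hx : x ∈ tsupport φ
      · rw [(hfd x (hs hx)).fderiv]
        simp only [hψ, FunLike.coe_smul, Pi.smul_apply, innerSL_apply_apply,
          EuclideanSpace.inner_single_right, smul_eq_mul, conj_trivial, one_mul]
      · rw [image_eq_zero_of_notMem_tsupport hx, mul_zero, mul_zero]
    have hψφ : Integrable fun x => ψ x * φ x := by
      have h1 : IntegrableOn (fun x => ψ x * φ x) (tsupport φ) :=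
        ((hψc.mono hs).mul hd.continuous.continuousOn).integrableOn_compact hc
      refine (integrableOn_iff_integrable_of_support_subset fun x hx => ?_).1 h1
      by_contra hx'
      exact hx (by simp only [image_eq_zero_of_notMem_tsupport hx', mul_zero])
    have hae : ∀ g : Space n → ℝ, (fun x => u x * g x) =ᵐ[volume] fun x => f x * g x := fun g =>
      hu.mono fun x hx => by simp only [hx, hf]
    have hi1 : Integrable fun x => f x * fderiv ℝ φ x (EuclideanSpace.single i 1) :=
      (hv.1.integrable_mul (continuous_fderiv_apply hd _)
        (hasCompactSupport_fderiv_apply hc _)).congr (hae _)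
    have hi2 : Integrable fun x => f x * φ x :=
      (hv.1.integrable_mul hd.continuous hc).congr (hae _)
    have hibp := integral_mul_fderiv_eq_neg_fderiv_mul_of_integrable (μ := volume)
      (v := EuclideanSpace.single i (1 : ℝ)) (hψφ.congr (.of_forall fun x => (hfφ x).symm)) hi1 hi2
      (fun x hx => (hfd x (hs hx)).differentiableAt)
      (fun x _ => hd.differentiable (by norm_num) x)
    have hweak := hv.2.2 φ hd hc
    rw [integral_congr_ae (hae _), hibp] at hweak
    simp_rw [hfφ] at hweak
    simp only [smul_eq_mul, mul_comm (φ _), sub_mul]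
    rw [integral_sub (hv.2.1.integrable_mul hd.continuous hc) hψφ]
    linarith

theorem MemSobolevLoc.exists_isRadialProfile [Nontrivial (Space n)] {u : Space n → ℝ} {q : ℝ≥0∞}
    (hu : MemSobolevLoc q 2 u) (hrad : IsRadial u) : ∃ w w' L, IsRadialProfile u w w' L := by
  have hn : 0 < n := by
    have := Module.finrank_pos (R := ℝ) (M := Space n)
    rwa [finrank_euclideanSpace_fin] at this
  set ω := sphereArea n with hω
  have hω0 : 0 < ω := sphereArea_pos
  have hv : ∀ i, HasWeakPartial i u (weakPartial i u) := fun i => hu.hasWeakPartial i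
  have hz : ∀ i, HasWeakPartial i (weakPartial i u) (weakPartial i (weakPartial i u)) := fun i =>
    hu.hasWeakPartial₂ i
  have D1 := hasWeakDeriv_sphereIntegral hv
  have D2 := hasWeakDeriv_flux hz
  obtain ⟨c₀, hc₀⟩ := D1.ae_eq
  obtain ⟨c₁, hc₁⟩ := D2.ae_eq
  set g : ℝ → ℝ := fun r => r⁻¹ * sphereIntegral volume (fun x => ∑ i, weakPartial i u x * x i) r
    with hg
  set S : ℝ → ℝ := sphereIntegral volume (weakLaplacian u) with hS
  have hSi : ∀ A B : ℝ, 0 < A → IntegrableOn (fun r => r ^ (n - 1) * S r) (Icc A B) := D2.integrable'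
  set Γ : ℝ → ℝ := fun r => c₁ + ∫ t in (1 : ℝ)..r, t ^ (n - 1) * S t with hΓ
  have hΓp : ∀ A B : ℝ, 0 < A → A ≤ B → IsPrimitiveOn Γ (fun r => r ^ (n - 1) * S r) A B :=
    fun A B hA hAB => by
      have := isPrimitiveOn_integral hSi hA hAB
      refine ⟨this.1, fun r hr => ?_⟩
      simp only [hΓ]
      rw [add_assoc, ← this.2 r hr]
  set G : ℝ → ℝ := fun r => (r ^ (n - 1))⁻¹ * Γ r with hG
  have hGp : ∀ A B : ℝ, 0 < A → A ≤ B →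
      IsPrimitiveOn (fun r => ω⁻¹ * G r) (fun r => ω⁻¹ * S r - (n - 1) / r * (ω⁻¹ * G r)) A B := by
    intro A B hA hAB
    have h1 : IsPrimitiveOn (fun r => ω⁻¹ * (r ^ (n - 1))⁻¹)
        (fun r => ω⁻¹ * (-(((n - 1 : ℕ) : ℝ) * r ^ (n - 1 - 1)) / (r ^ (n - 1)) ^ 2)) A B := by
      refine IsPrimitiveOn.of_hasDerivAt (fun r hr => ?_) ?_ hAB
      · have hr0 : r ≠ 0 := (hA.trans_le hr.1).ne'
        exact ((hasDerivAt_pow (n - 1) r).inv (pow_ne_zero _ hr0)).const_mul _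
      · refine continuousOn_const.mul (ContinuousOn.div (by fun_prop) (by fun_prop) fun r hr => ?_)
        exact pow_ne_zero _ (pow_ne_zero _ (hA.trans_le hr.1).ne')
    have h2 := (h1.mul (hΓp A B hA hAB) hAB).congr_deriv
      (g' := fun r => ω⁻¹ * S r - (n - 1) / r * (ω⁻¹ * G r)) (fun r hr => ?_) hAB
    · have h3 : (fun r => ω⁻¹ * (r ^ (n - 1))⁻¹ * Γ r) = fun r => ω⁻¹ * G r := by
        funext r; simp only [hG]; ring
      rwa [h3] at h2
    · have hr0 : r ≠ 0 := (hA.trans_le hr.1).ne'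
      obtain ⟨N, rfl⟩ : ∃ N, n = N + 1 := ⟨n - 1, by omega⟩
      simp only [hG, Nat.add_sub_cancel]
      push_cast
      rcases N with _ | N
      · simp
      · simp only [Nat.add_sub_cancel, pow_succ]
        push_cast
        field_simp
        ring
  have hGc : ContinuousOn G (Ioi 0) := by
    intro r hr
    have hr0 : (0 : ℝ) < r := hr
    have h1 := (hGp (r / 2) (r + 1) (by positivity) (by linarith)).continuousOn (by linarith)
    have h2 : ContinuousAt (fun r => ω⁻¹ * G r) r :=
      h1.continuousAt (Icc_mem_nhds (by linarith) (by linarith))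
    have h3 := h2.const_mul ω
    simp_rw [mul_inv_cancel_left₀ hω0.ne'] at h3
    exact h3.continuousWithinAt
  have hGi : ∀ r : ℝ, 0 < r → IntervalIntegrable G volume 1 r := fun r hr =>
    (hGc.mono fun t ht => lt_of_lt_of_le (lt_min one_pos hr) ht.1).intervalIntegrable
  set U : ℝ → ℝ := fun r => c₀ + ∫ t in (1 : ℝ)..r, G t with hU
  have hUd : ∀ r, 0 < r → HasDerivAt U (G r) r := fun r hr =>
    (intervalIntegral.integral_hasDerivAt_right (hGi r hr)
      (hGc.stronglyMeasurableAtFilter isOpen_Ioi r hr)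
      (hGc.continuousAt (Ioi_mem_nhds hr))).const_add c₀
  have hgG : ∀ᵐ r ∂(volume.restrict (Ioi (0 : ℝ))), g r = G r := by
    filter_upwards [hc₁, ae_restrict_mem measurableSet_Ioi] with r hr hr0
    have : r ^ (n - 1) ≠ 0 := (pow_pos hr0 _).ne'
    have h1 : Γ r = r ^ (n - 1) * g r := hr.symm
    simp only [hG, h1]
    rw [inv_mul_cancel_left₀ this]
  have hSU : ∀ᵐ r ∂(volume.restrict (Ioi (0 : ℝ))), sphereIntegral volume u r = U r := by
    filter_upwards [hc₀, ae_restrict_mem measurableSet_Ioi] with r hr hr0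
    rw [hr, hU]
    congr 1
    refine intervalIntegral.integral_congr_ae ?_
    rw [ae_restrict_iff' measurableSet_Ioi] at hgG
    filter_upwards [hgG] with t ht ht'
    exact ht (lt_of_le_of_lt (le_min zero_le_one (le_of_lt hr0)) ht'.1)
  obtain ⟨w₀, hw₀⟩ := hrad
  have hw₀U : ∀ᵐ r ∂(volume.restrict (Ioi (0 : ℝ))), w₀ r = ω⁻¹ * U r := by
    filter_upwards [hSU, ae_ae_polar hw₀, ae_restrict_mem measurableSet_Ioi] with r hr1 hr2 hr0
    have h1 : sphereIntegral volume u r = ω * w₀ r := by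
      rw [hω, sphereArea, ← sphereIntegral_norm w₀ hr0]
      exact integral_congr_ae hr2
    rw [← hr1, h1, inv_mul_cancel_left₀ hω0.ne']
  have hae : ∀ᵐ x : Space n, u x = ω⁻¹ * U ‖x‖ := by
    filter_upwards [hw₀, ae_norm_of_ae (μ := (volume : Measure (Space n))) hw₀U] with x h1 h2
    rw [h1, h2]
  have hd : ∀ r, 0 < r → HasDerivAt (fun r => ω⁻¹ * U r) (ω⁻¹ * G r) r := fun r hr =>
    (hUd r hr).const_mul _
  refine ⟨fun r => ω⁻¹ * U r, fun r => ω⁻¹ * G r, fun r => ω⁻¹ * S r, hae, hd, hGp, ?_, fun r => ?_⟩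
  · have h1 := fun i => (hv i).ae_eq_radial hae hd (hGc.const_smul ω⁻¹)
    filter_upwards [ae_all_iff.2 h1] with x hx
    ext i
    simpa [weakGrad] using hx i
  · exact mul_inv_cancel_left₀ hω0.ne' _

end AllenCahn

namespace AllenCahn

/-! ### Bounds for the profiles -/

variable {n : ℕ} {W : ℝ → ℝ} {a b ε C : ℝ} {u : Space n → ℝ} {w w' L : ℝ → ℝ}

theorem energyDensity_nonneg (hW : IsDoubleWell W a b) (hε : 0 < ε) (x : Space n) :
    0 ≤ energyDensity W ε u x := by
  have := hW.nonneg (u x)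
  unfold energyDensity
  positivity

theorem abs_discrepancyDensity_le (hW : IsDoubleWell W a b) (hε : 0 < ε) (x : Space n) :
    |discrepancyDensity W ε u x| ≤ energyDensity W ε u x := by
  have h1 := div_nonneg (hW.nonneg (u x)) hε.le
  have h2 : 0 ≤ ε * ‖weakGrad u x‖ ^ 2 := by positivity
  unfold discrepancyDensity energyDensity
  rw [abs_le]
  constructor <;> linarith

theorem ae_norm_pos [Nontrivial (Space n)] : ∀ᵐ x : Space n, 0 < ‖x‖ := by
  have h0 : ∀ᵐ x : Space n, x ∈ ({0}ᶜ : Set (Space n)) := compl_mem_ae_iff.2 (measure_singleton 0)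
  exact h0.mono fun x hx => norm_pos_iff.2 hx

theorem aestronglyMeasurable_comp_norm [Nontrivial (Space n)] {f : ℝ → ℝ}
    (hf : ContinuousOn f (Ioi 0)) :
    AEStronglyMeasurable (fun x : Space n => f ‖x‖) volume := by
  have h1 : ContinuousOn (fun x : Space n => f ‖x‖) {0}ᶜ :=
    hf.comp continuous_norm.continuousOn fun x hx => norm_pos_iff.2 hx
  have := h1.aestronglyMeasurable (μ := volume) (measurableSet_singleton 0).compl
  rwa [restrict_compl_singleton] at this

namespace IsRadialProfile

theorem continuousOn (h : IsRadialProfile u w w' L) : ContinuousOn w (Ioi 0) := fun r hr =>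
  (h.hasDerivAt r hr).continuousAt.continuousWithinAt

theorem continuousOn_deriv (h : IsRadialProfile u w w' L) : ContinuousOn w' (Ioi 0) := by
  intro r hr
  have hr0 : (0 : ℝ) < r := hr
  have h1 := (h.primitive (r / 2) (r + 1) (by positivity) (by linarith)).continuousOn (by linarith)
  exact (h1.continuousAt (Icc_mem_nhds (by linarith) (by linarith))).continuousWithinAt

theorem continuousOn_energy (h : IsRadialProfile u w w' L) (hW : IsDoubleWell W a b) :
    ContinuousOn (fun r => ((ε * w' r) ^ 2 + W (w r)) / ε) (Ioi 0) :=
  ((((continuousOn_const.mul h.continuousOn_deriv).pow 2).add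
    (hW.contDiff.continuous.comp_continuousOn h.continuousOn)).div_const ε)

theorem ae_norm_weakGrad [Nontrivial (Space n)] (h : IsRadialProfile u w w' L) :
    ∀ᵐ x : Space n, ‖weakGrad u x‖ ^ 2 = w' ‖x‖ ^ 2 := by
  filter_upwards [h.grad, ae_norm_pos] with x hx hx0
  rw [hx, norm_smul, norm_mul, norm_inv, norm_norm, mul_assoc, inv_mul_cancel₀ hx0.ne', mul_one,
    Real.norm_eq_abs, sq_abs]

theorem ae_energyDensity [Nontrivial (Space n)] (h : IsRadialProfile u w w' L) (hε : 0 < ε) :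
    ∀ᵐ x : Space n, energyDensity W ε u x = ((ε * w' ‖x‖) ^ 2 + W (w ‖x‖)) / ε := by
  filter_upwards [h.ae_norm_weakGrad, h.ae_eq] with x h1 h2
  rw [energyDensity, h1, h2]
  field_simp

theorem ae_discrepancyDensity [Nontrivial (Space n)] (h : IsRadialProfile u w w' L) (hε : 0 < ε) :
    ∀ᵐ x : Space n, discrepancyDensity W ε u x = ((ε * w' ‖x‖) ^ 2 - W (w ‖x‖)) / ε := by
  filter_upwards [h.ae_norm_weakGrad, h.ae_eq] with x h1 h2
  rw [discrepancyDensity, h1, h2]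
  field_simp

theorem aestronglyMeasurable_energyDensity [Nontrivial (Space n)] (h : IsRadialProfile u w w' L)
    (hW : IsDoubleWell W a b) (hε : 0 < ε) :
    AEStronglyMeasurable (energyDensity W ε u) volume :=
  (aestronglyMeasurable_comp_norm (h.continuousOn_energy hW)).congr
    ((h.ae_energyDensity hε).mono fun _ hx => hx.symm)

theorem aestronglyMeasurable_discrepancyDensity [Nontrivial (Space n)]
    (h : IsRadialProfile u w w' L) (hW : IsDoubleWell W a b) (hε : 0 < ε) :
    AEStronglyMeasurable (discrepancyDensity W ε u) volume := by
  have hc : ContinuousOn (fun r => ((ε * w' r) ^ 2 - W (w r)) / ε) (Ioi 0) :=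
    ((((continuousOn_const.mul h.continuousOn_deriv).pow 2).sub
      (hW.contDiff.continuous.comp_continuousOn h.continuousOn)).div_const ε)
  exact (aestronglyMeasurable_comp_norm hc).congr
    ((h.ae_discrepancyDensity hε).mono fun _ hx => hx.symm)

/-- The energy bound, for the energy density and in polar coordinates. -/
theorem energy_bound [Nontrivial (Space n)] (h : IsRadialProfile u w w' L)
    (hW : IsDoubleWell W a b) (hε : 0 < ε) (hC : 0 ≤ C) (hE : energy W ε u ≤ ENNReal.ofReal C) :
    Integrable (energyDensity W ε u) ∧ ∫ x, energyDensity W ε u x ≤ C ∧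
    IntegrableOn (fun r => r ^ (n - 1) * (((ε * w' r) ^ 2 + W (w r)) / ε)) (Ioi 0) ∧
    ∫ x, energyDensity W ε u x
      = sphereArea n * ∫ r in Ioi 0, r ^ (n - 1) * (((ε * w' r) ^ 2 + W (w r)) / ε) := by
  have hm := h.aestronglyMeasurable_energyDensity hW hε
  have h0 : 0 ≤ᵐ[volume] energyDensity W ε u := ae_of_all _ (energyDensity_nonneg hW hε)
  have hi : Integrable (energyDensity W ε u) :=
    (lintegral_ofReal_ne_top_iff_integrable hm h0).1 (ne_top_of_le_ne_top ENNReal.ofReal_ne_top hE)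
  have hae := h.ae_energyDensity (W := W) hε
  have hi' : Integrable fun x : Space n => 1 * (((ε * w' ‖x‖) ^ 2 + W (w ‖x‖)) / ε) :=
    (hi.congr hae).congr (.of_forall fun x => (one_mul _).symm)
  obtain ⟨h1, h2⟩ := integral_mul_norm (V := fun _ => 1)
    (f := fun r => ((ε * w' r) ^ 2 + W (w r)) / ε) hi'
  have h3 : sphereIntegral (volume : Measure (Space n)) (fun _ => (1 : ℝ)) = fun _ => sphereArea n := by
    funext r
    simp [sphereIntegral, sphereArea]
  have h4 : ∀ r : ℝ, r ^ (n - 1) * (sphereArea n * (((ε * w' r) ^ 2 + W (w r)) / ε))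
      = sphereArea n * (r ^ (n - 1) * (((ε * w' r) ^ 2 + W (w r)) / ε)) := fun r => by ring
  rw [h3, finrank_euclideanSpace_fin] at h1 h2
  simp_rw [h4] at h1 h2
  refine ⟨hi, ?_, ?_, ?_⟩
  · rw [integral_eq_lintegral_of_nonneg_ae h0 hm]
    exact ENNReal.toReal_le_of_le_ofReal hC hE
  · have := h1.const_mul (sphereArea n)⁻¹
    simp_rw [inv_mul_cancel_left₀ (sphereArea_pos (n := n)).ne'] at this
    exact this
  · rw [integral_congr_ae hae, ← integral_const_mul, ← h2]
    simp only [one_mul]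

end IsRadialProfile

/-- The constant in the bounds for the profiles on `[A, B]`. -/
noncomputable def profileConst (n : ℕ) (C A B : ℝ) : ℝ :=
  (sphereArea n)⁻¹ * ((A ^ (n - 1))⁻¹ *
    (volume.real (Metric.closedBall (0 : Space n) B) + C))

/-- The spherical means of `2 ε Δu - W'(u) / ε` are controlled by those of the integrands of
`energy` and `willmore`, by `|H| √e ≤ (1 + H² e) / 2`. -/
theorem IsRadialProfile.forcing_le [Nontrivial (Space n)] {q : ℝ≥0∞} (hu : MemSobolevLoc q 2 u)
    (h : IsRadialProfile u w w' L) (hW : IsDoubleWell W a b) (hε : 0 < ε) (hC : 0 ≤ C)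
    (hG : willmore W ε u ≤ ENNReal.ofReal C) {A B : ℝ} (hA : 0 < A) (hAB : A ≤ B) :
    ∫ r in A..B, |2 * ε * L r - deriv W (w r) / ε| * √(((ε * w' r) ^ 2 + W (w r)) / ε) ≤
      profileConst n C A B := by
  set e : ℝ → ℝ := fun r => ((ε * w' r) ^ 2 + W (w r)) / ε with he
  set D : Space n → ℝ := fun x =>
    (2 * ε * weakLaplacian u x - deriv W (u x) / ε) ^ 2 * energyDensity W ε u x with hD
  have hω := sphereArea_pos (n := n)
  have he0 : ∀ r, 0 ≤ e r := fun r =>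
    div_nonneg (add_nonneg (sq_nonneg _) (hW.nonneg _)) hε.le
  have hec : ContinuousOn e (Ioi 0) := h.continuousOn_energy hW
  have hn : 0 < n := by
    have := Module.finrank_pos (R := ℝ) (M := Space n)
    rwa [finrank_euclideanSpace_fin] at this
  have hui : LocallyIntegrable u := (hu.hasWeakPartial ⟨0, hn⟩).1
  have hLi : LocallyIntegrable (weakLaplacian u) :=
    locallyIntegrable_sum fun i => (hu.hasWeakPartial₂ i).2.1
  have hD0 : ∀ x, 0 ≤ D x := fun x => mul_nonneg (sq_nonneg _) (energyDensity_nonneg hW hε x)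
  have hWm : AEStronglyMeasurable (fun x => deriv W (u x) / ε) volume :=
    (hW.continuous_deriv.div_const ε).comp_aestronglyMeasurable hui.aestronglyMeasurable
  have hDm : AEStronglyMeasurable D volume :=
    (((hLi.aestronglyMeasurable.const_mul _).sub hWm).pow 2).mul
      (h.aestronglyMeasurable_energyDensity hW hε)
  have hDi : Integrable D := (lintegral_ofReal_ne_top_iff_integrable hDm (ae_of_all _ hD0)).1
    (ne_top_of_le_ne_top ENNReal.ofReal_ne_top hG)
  have hDC : ∫ x, D x ≤ C := by
    rw [integral_eq_lintegral_of_nonneg_ae (ae_of_all _ hD0) hDm]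
    exact ENNReal.toReal_le_of_le_ofReal hC hG
  set χ : Space n → ℝ := (Metric.closedBall (0 : Space n) B).indicator fun _ => 1 with hχ
  have hχi : Integrable χ :=
    (integrable_indicator_iff Metric.isClosed_closedBall.measurableSet).2
      (integrableOn_const (measure_closedBall_lt_top).ne)
  set Φ : Space n → ℝ := fun x => χ x + D x with hΦ
  have hΦi : Integrable Φ := hχi.add hDi
  have hΦ0 : ∀ x, 0 ≤ Φ x := fun x =>
    add_nonneg (indicator_nonneg (fun _ _ => zero_le_one) x) (hD0 x)
  obtain ⟨hΦ1, hΦ2, hΦ3⟩ := integrable_polar hΦi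
  rw [finrank_euclideanSpace_fin] at hΦ2 hΦ3
  have hS0 : ∀ r, 0 < r → 0 ≤ sphereIntegral volume Φ r := fun r _ =>
    integral_nonneg fun θ => hΦ0 _
  have hsub : Icc A B ⊆ Ioi (0 : ℝ) := fun r hr => hA.trans_le hr.1
  have hLI : IntervalIntegrable L volume A B := by
    rw [intervalIntegrable_iff_integrableOn_Icc_of_le hAB]
    refine ((integrableOn_sphereIntegral hLi hA).const_mul (sphereArea n)⁻¹).congr
      (ae_of_all _ fun r => ?_)
    simp only [← h.laplacian r]
    rw [inv_mul_cancel_left₀ hω.ne']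
  have hHi : IntervalIntegrable (fun r => 2 * ε * L r - deriv W (w r) / ε) volume A B := by
    refine (hLI.const_mul _).sub (ContinuousOn.intervalIntegrable ?_)
    rw [uIcc_of_le hAB]
    exact (hW.continuous_deriv.comp_continuousOn (h.continuousOn.mono hsub)).div_const ε
  have hHe : IntervalIntegrable (fun r => |2 * ε * L r - deriv W (w r) / ε| * √(e r)) volume A B :=
    hHi.abs.mul_continuousOn (by rw [uIcc_of_le hAB]; exact (hec.mono hsub).sqrt)
  have hΦI : IntegrableOn (sphereIntegral volume Φ) (Icc A B) := integrableOn_Icc_of_pow_mul hΦ2 hA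
  have hpt : ∀ᵐ r ∂(volume.restrict (Icc A B)),
      |2 * ε * L r - deriv W (w r) / ε| * √(e r) ≤ (sphereArea n)⁻¹ * sphereIntegral volume Φ r := by
    filter_upwards [ae_restrict_of_ae_restrict_of_subset hsub hΦ1, ae_integrable_sphere hLi hA,
      ae_restrict_of_ae_restrict_of_subset hsub (ae_ae_polar h.ae_eq),
      ae_restrict_of_ae_restrict_of_subset hsub (ae_ae_polar (h.ae_energyDensity (W := W) hε)),
      ae_restrict_mem measurableSet_Icc] with r h1 h2 h3 h4 hr
    have hnorm : ∀ θ : Metric.sphere (0 : Space n) 1, ‖r • (θ : Space n)‖ = r := fun θ => by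
      simp [norm_smul, abs_of_pos (hA.trans_le hr.1)]
    have hH : ∫ θ : Metric.sphere (0 : Space n) 1, (2 * ε * weakLaplacian u (r • (θ : Space n))
        - deriv W (w r) / ε) * √(e r) ∂(volume : Measure (Space n)).toSphere
        = sphereArea n * ((2 * ε * L r - deriv W (w r) / ε) * √(e r)) := by
      rw [integral_mul_const, integral_sub (h2.const_mul _) (integrable_const _),
        integral_const_mul, integral_const, smul_eq_mul]
      have := h.laplacian r
      rw [sphereIntegral] at this
      rw [← this, ← sphereArea]
      ring
    rw [← mul_le_mul_iff_right₀ hω, mul_inv_cancel_left₀ hω.ne']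
    have habs : sphereArea n * (|2 * ε * L r - deriv W (w r) / ε| * √(e r))
        = |sphereArea n * ((2 * ε * L r - deriv W (w r) / ε) * √(e r))| := by
      rw [abs_mul, abs_mul, abs_of_pos hω, abs_of_nonneg (Real.sqrt_nonneg _)]
    rw [habs, ← hH]
    refine (norm_integral_le_of_norm_le (f := fun θ : Metric.sphere (0 : Space n) 1 =>
      (2 * ε * weakLaplacian u (r • (θ : Space n)) - deriv W (w r) / ε) * √(e r)) h1 ?_ :)
    filter_upwards [h3, h4] with θ h5 h6
    rw [hnorm] at h5 h6
    have hχ1 : χ (r • (θ : Space n)) = 1 := by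
      rw [hχ, indicator_of_mem]
      rw [mem_closedBall_zero_iff, hnorm]
      exact hr.2
    simp only [hΦ, hD, hχ1, h5, h6]
    set X := 2 * ε * weakLaplacian u (r • (θ : Space n)) - deriv W (w r) / ε
    have h7 : √(e r) ^ 2 = e r := Real.sq_sqrt (he0 r)
    have h8 : ((ε * w' r) ^ 2 + W (w r)) / ε = √(e r) ^ 2 := h7.symm
    rw [h8, ← mul_pow, Real.norm_eq_abs, abs_le]
    constructor <;> nlinarith [sq_nonneg (X * √(e r) - 1), sq_nonneg (X * √(e r) + 1),
      sq_nonneg (X * √(e r))]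
  calc _ ≤ ∫ r in A..B, (sphereArea n)⁻¹ * sphereIntegral volume Φ r := by
        refine intervalIntegral.integral_mono_ae_restrict hAB hHe ?_ hpt
        rw [intervalIntegrable_iff_integrableOn_Icc_of_le hAB]
        exact hΦI.const_mul _
    _ = (sphereArea n)⁻¹ * ∫ r in A..B, sphereIntegral volume Φ r :=
        intervalIntegral.integral_const_mul _ _
    _ ≤ (sphereArea n)⁻¹ * ((A ^ (n - 1))⁻¹ * ∫ x, Φ x) := by
        rw [hΦ3]
        exact mul_le_mul_of_nonneg_left (integral_le_of_pow_mul hS0 hΦ2 hA hAB)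
          (inv_nonneg.2 hω.le)
    _ ≤ profileConst n C A B := by
        rw [profileConst]
        gcongr
        rw [hΦ, integral_add hχi hDi, hχ, integral_indicator Metric.isClosed_closedBall.measurableSet,
          setIntegral_const, smul_eq_mul, mul_one]
        linarith

theorem IsRadialProfile.isProfile [Nontrivial (Space n)] {q : ℝ≥0∞} (hu : MemSobolevLoc q 2 u)
    (h : IsRadialProfile u w w' L) (hW : IsDoubleWell W a b) (hε : 0 < ε) (hε1 : ε ≤ 1)
    (hC : 0 ≤ C) (hEG : energy W ε u + willmore W ε u ≤ ENNReal.ofReal C) {A B : ℝ} (hA : 0 < A)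
    (hAB : A ≤ B) :
    IsProfile W (fun r => (n - 1) / r) ((n - 1) / A) (profileConst n C A B) A B ε w
      (fun r => ε * w' r) (fun r => 2 * ε * L r - deriv W (w r) / ε) := by
  have hω := sphereArea_pos (n := n)
  have hn : 0 < n := by
    have := Module.finrank_pos (R := ℝ) (M := Space n)
    rwa [finrank_euclideanSpace_fin] at this
  have hn1 : (0 : ℝ) ≤ (n : ℝ) - 1 := by
    have : (1 : ℝ) ≤ n := by exact_mod_cast hn
    linarith
  have hsub : Icc A B ⊆ Ioi (0 : ℝ) := fun r hr => hA.trans_le hr.1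
  have hLi : LocallyIntegrable (weakLaplacian u) :=
    locallyIntegrable_sum fun i => (hu.hasWeakPartial₂ i).2.1
  have hLI : IntervalIntegrable L volume A B := by
    rw [intervalIntegrable_iff_integrableOn_Icc_of_le hAB]
    refine ((integrableOn_sphereIntegral hLi hA).const_mul (sphereArea n)⁻¹).congr
      (ae_of_all _ fun r => ?_)
    simp only [← h.laplacian r]
    rw [inv_mul_cancel_left₀ hω.ne']
  have hprim := h.primitive A B hA hAB
  have hsplit : ∀ r, (ε * w' r) ^ 2 + W (w r) = ε * (((ε * w' r) ^ 2 + W (w r)) / ε) := fun r => by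
    field_simp
  refine ⟨hε, hε1, ?_, fun r hr => ?_, fun r hr => ?_, ?_, ?_, ?_, ?_⟩
  · exact continuousOn_const.div continuousOn_id fun r hr => (hsub hr).ne'
  · have hr0 : 0 < r := hsub hr
    rw [abs_of_nonneg (by positivity)]
    exact div_le_div_of_nonneg_left hn1 hA hr.1
  · rw [mul_div_cancel_left₀ _ hε.ne']
    exact h.hasDerivAt r (hsub hr)
  · refine (hLI.const_mul _).sub (ContinuousOn.intervalIntegrable ?_)
    rw [uIcc_of_le hAB]
    exact (hW.continuous_deriv.comp_continuousOn (h.continuousOn.mono hsub)).div_const ε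
  · have h1 : IsPrimitiveOn (fun r => ε * w' r) (fun r => ε * (L r - (n - 1) / r * w' r)) A B := by
      refine ⟨hprim.1.const_mul ε, fun r hr => ?_⟩
      rw [intervalIntegral.integral_const_mul, ← mul_add, ← hprim.2 r hr]
    refine h1.congr_deriv (fun r hr => ?_) hAB
    have hr0 : r ≠ 0 := (hsub hr).ne'
    field_simp
    ring
  · obtain ⟨-, h2, h3, h4⟩ := h.energy_bound hW hε hC (le_self_add.trans hEG)
    have h5 := integral_le_of_pow_mul (f := fun r => ((ε * w' r) ^ 2 + W (w r)) / ε)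
      (fun r _ => div_nonneg (add_nonneg (sq_nonneg _) (hW.nonneg _)) hε.le) h3 hA hAB
    rw [h4] at h2
    have h6 : ∫ r in Ioi 0, r ^ (n - 1) * (((ε * w' r) ^ 2 + W (w r)) / ε)
        ≤ (sphereArea n)⁻¹ * C := by
      rw [inv_mul_eq_div, le_div_iff₀ hω]; linarith
    rw [intervalIntegral.integral_congr (fun r _ => hsplit r), intervalIntegral.integral_const_mul,
      mul_comm]
    gcongr
    refine h5.trans ?_
    rw [profileConst, mul_left_comm]
    gcongr
    refine h6.trans ?_
    gcongr
    exact le_add_of_nonneg_left measureReal_nonneg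
  · have h1 := h.forcing_le hu hW hε hC (le_add_self.trans hEG) hA hAB
    have h2 : ∀ r, |2 * ε * L r - deriv W (w r) / ε| * √((ε * w' r) ^ 2 + W (w r))
        = √ε * (|2 * ε * L r - deriv W (w r) / ε| * √(((ε * w' r) ^ 2 + W (w r)) / ε)) := fun r => by
      rw [mul_left_comm, ← Real.sqrt_mul hε.le, ← hsplit r]
    simp_rw [h2]
    rw [intervalIntegral.integral_const_mul, mul_comm]
    gcongr

end AllenCahn

namespace AllenCahn

/-! ### Compactness of profiles on the half-line -/

/-- A profile on `(0, ∞)`, with mass at most `C` for the weight `r ^ N` and with bounds on each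
compact interval. -/
structure IsGlobalProfile (W m M : ℝ → ℝ) (K : ℝ → ℝ → ℝ) (N : ℕ) (C ε : ℝ) (w p H : ℝ → ℝ) :
    Prop where
  cont_w : ContinuousOn w (Ioi 0)
  cont_p : ContinuousOn p (Ioi 0)
  integrable : IntegrableOn (fun r => r ^ N * ((p r ^ 2 + W (w r)) / ε)) (Ioi 0)
  mass_le : ∫ r in Ioi (0 : ℝ), r ^ N * ((p r ^ 2 + W (w r)) / ε) ≤ C
  profile : ∀ A B, 0 < A → A ≤ B → IsProfile W m (M A) (K A B) A B ε w p H

namespace IsGlobalProfile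

variable {W m M : ℝ → ℝ} {K : ℝ → ℝ → ℝ} {N : ℕ} {C ε a b : ℝ} {w p H : ℝ → ℝ}

theorem eps_pos (h : IsGlobalProfile W m M K N C ε w p H) : 0 < ε :=
  (h.profile 1 1 one_pos le_rfl).eps_pos

theorem density_nonneg (h : IsGlobalProfile W m M K N C ε w p H) (hW : IsDoubleWell W a b) (r : ℝ) :
    0 ≤ (p r ^ 2 + W (w r)) / ε :=
  div_nonneg (add_nonneg (sq_nonneg _) (hW.nonneg _)) h.eps_pos.le

theorem mass_nonneg (h : IsGlobalProfile W m M K N C ε w p H) (hW : IsDoubleWell W a b) : 0 ≤ C :=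
  (setIntegral_nonneg measurableSet_Ioi fun r hr =>
    mul_nonneg (pow_nonneg (le_of_lt hr) _) (h.density_nonneg hW r)).trans h.mass_le

theorem continuousOn_density (h : IsGlobalProfile W m M K N C ε w p H) (hW : IsDoubleWell W a b) :
    ContinuousOn (fun r => (p r ^ 2 + W (w r)) / ε) (Ioi 0) :=
  ((h.cont_p.pow 2).add (hW.contDiff.continuous.comp_continuousOn h.cont_w)).div_const ε

theorem continuousOn_discrepancy (h : IsGlobalProfile W m M K N C ε w p H)
    (hW : IsDoubleWell W a b) : ContinuousOn (fun r => (p r ^ 2 - W (w r)) / ε) (Ioi 0) :=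
  ((h.cont_p.pow 2).sub (hW.contDiff.continuous.comp_continuousOn h.cont_w)).div_const ε

theorem abs_discrepancy_le (h : IsGlobalProfile W m M K N C ε w p H) (hW : IsDoubleWell W a b)
    {r : ℝ} (hr : 0 < r) :
    |r ^ N * ((p r ^ 2 - W (w r)) / ε)| ≤ r ^ N * ((p r ^ 2 + W (w r)) / ε) := by
  have := h.eps_pos
  have h1 := hW.nonneg (w r)
  have h2 := sq_nonneg (p r)
  rw [abs_mul, abs_of_pos (pow_pos hr N), abs_div, abs_of_pos this]
  gcongr
  rw [abs_le]
  constructor <;> linarith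

theorem integrableOn_discrepancy (h : IsGlobalProfile W m M K N C ε w p H)
    (hW : IsDoubleWell W a b) :
    IntegrableOn (fun r => r ^ N * ((p r ^ 2 - W (w r)) / ε)) (Ioi 0) := by
  refine Integrable.mono' h.integrable ?_ ((ae_restrict_iff' measurableSet_Ioi).2
    (ae_of_all _ fun r hr => h.abs_discrepancy_le hW hr))
  exact (((continuous_pow N).continuousOn).mul
    (h.continuousOn_discrepancy hW)).aestronglyMeasurable measurableSet_Ioi

theorem integral_density_le (h : IsGlobalProfile W m M K N C ε w p H) (hW : IsDoubleWell W a b)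
    {A B : ℝ} (hA : 0 < A) (hAB : A ≤ B) :
    ∫ r in A..B, (p r ^ 2 + W (w r)) / ε ≤ (A ^ N)⁻¹ * C :=
  (integral_le_of_pow_mul (fun r _ => h.density_nonneg hW r) h.integrable hA hAB).trans
    (mul_le_mul_of_nonneg_left h.mass_le (by positivity))

end IsGlobalProfile

variable {W m M : ℝ → ℝ} {K : ℝ → ℝ → ℝ} {N : ℕ} {C a b : ℝ}

/-- Equipartition of energy: the discrepancy converges weakly to zero. -/
theorem IsDoubleWell.tendsto_integral_discrepancy (hW : IsDoubleWell W a b) {w p H : ℝ → ℝ → ℝ}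
    (h : ∀ᶠ ε in 𝓝[>] (0 : ℝ), IsGlobalProfile W m M K N C ε (w ε) (p ε) (H ε)) {g : ℝ → ℝ}
    (hg : Continuous g) (hg0 : g 0 = 0) (hginf : Tendsto g atTop (𝓝 0)) :
    Tendsto (fun ε => ∫ r in Ioi (0 : ℝ), g r * (r ^ N * ((p ε r ^ 2 - W (w ε r)) / ε)))
      (𝓝[>] 0) (𝓝 0) := by
  obtain ⟨ε₀, hε₀⟩ := h.exists
  have hC : 0 ≤ C := hε₀.mass_nonneg hW
  obtain ⟨Bg, hBg⟩ := exists_bound_of_tendsto hg hginf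
  rw [Metric.tendsto_nhds]
  intro η hη
  set τ := η / (4 * (C + 1)) with hτ
  have hτ0 : 0 < τ := by positivity
  obtain ⟨f, hf, hgf, x, y, hx, hxy, hfx, hfy⟩ := exists_support_approx hg hg0 hginf hτ0
  obtain ⟨D, hD⟩ := (isCompact_Icc (a := x) (b := y)).exists_bound_of_continuousOn
    (f := fun r => f r * r ^ N) (by fun_prop)
  have hD0 : 0 ≤ D := (norm_nonneg _).trans (hD x ⟨le_rfl, hxy.le⟩)
  have hprof := hε₀.profile (x / 2) (y + 1) (by linarith) (by linarith)
  set τ₂ := η / (8 * (D + 1)) with hτ₂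
  have hτ₂0 : 0 < τ₂ := by positivity
  obtain ⟨K₂, hK₂, δ, -, hquant⟩ := hW.exists_quantization (A := x / 2) (A' := x) (B' := y)
    (B := y + 1) (by linarith) hxy (by linarith) (hprof.curv_nonneg (by linarith))
    (hprof.const_nonneg (by linarith) hW) hτ₂0
  have hsmall : ∀ᶠ ε in 𝓝[>] (0 : ℝ), K₂ * √ε < τ₂ := by
    have h1 : Tendsto (fun ε : ℝ => K₂ * √ε) (𝓝 0) (𝓝 (K₂ * √0)) :=
      (Continuous.tendsto (by fun_prop) 0)
    rw [Real.sqrt_zero, mul_zero] at h1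
    exact (h1.mono_left nhdsWithin_le_nhds).eventually (gt_mem_nhds hτ₂0)
  filter_upwards [h, hsmall] with ε hε hKε
  have hε0 := hε.eps_pos
  have hξi := hε.integrableOn_discrepancy hW
  set ξ : ℝ → ℝ := fun r => (p ε r ^ 2 - W (w ε r)) / ε with hξ
  have hbdd : ∀ {k : ℝ → ℝ} {B : ℝ}, Continuous k → (∀ t > 0, |k t| ≤ B) →
      IntegrableOn (fun r => k r * (r ^ N * ξ r)) (Ioi 0) := fun {k B} hk hB =>
    hξi.bdd_mul (c := B) hk.aestronglyMeasurable
      ((ae_restrict_iff' measurableSet_Ioi).2 (ae_of_all _ fun t ht => hB t ht))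
  have hfi : IntegrableOn (fun r => f r * (r ^ N * ξ r)) (Ioi 0) :=
    hbdd (B := Bg + τ) hf fun t ht => by
      have h1 := abs_le.1 (hgf t)
      have h2 := abs_le.1 (hBg t ht)
      rw [abs_le]
      constructor <;> linarith
  have h1 : |(∫ r in Ioi (0 : ℝ), g r * (r ^ N * ξ r)) - ∫ r in Ioi (0 : ℝ), f r * (r ^ N * ξ r)|
      ≤ τ * C := by
    rw [← integral_sub (hbdd hg hBg) hfi]
    have := norm_integral_le_of_norm_le
      (f := fun r => g r * (r ^ N * ξ r) - f r * (r ^ N * ξ r)) (hε.integrable.const_mul τ)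
      ((ae_restrict_iff' measurableSet_Ioi).2 (ae_of_all _ fun r hr => ?_))
    · refine this.trans ?_
      rw [integral_const_mul]
      exact mul_le_mul_of_nonneg_left hε.mass_le hτ0.le
    · rw [← sub_mul, Real.norm_eq_abs, abs_mul]
      exact mul_le_mul (hgf r) (hε.abs_discrepancy_le hW hr) (abs_nonneg _) hτ0.le
  have h2 : |∫ r in Ioi (0 : ℝ), f r * (r ^ N * ξ r)| ≤ D * (τ₂ + K₂ * √ε) := by
    have e1 : ∫ r in Ioi (0 : ℝ), f r * (r ^ N * ξ r) = ∫ r in x..y, f r * (r ^ N * ξ r) := by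
      rw [intervalIntegral.integral_of_le hxy.le]
      refine setIntegral_eq_of_subset_of_forall_sdiff_eq_zero measurableSet_Ioi
        (fun t ht => hx.trans ht.1) fun t ht => ?_
      have ht2 := ht.2
      rw [mem_Ioc, not_and_or, not_lt, not_le] at ht2
      rcases ht2 with h' | h'
      · rw [hfx t ht.1 h', zero_mul]
      · rw [hfy t h'.le, zero_mul]
    have hcξ : IntervalIntegrable (fun r => |p ε r ^ 2 - W (w ε r)|) volume x y := by
      apply ContinuousOn.intervalIntegrable
      refine (((hε.cont_p.pow 2).sub
        (hW.contDiff.continuous.comp_continuousOn hε.cont_w)).abs).mono fun t ht => ?_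
      rw [uIcc_of_le hxy.le] at ht
      exact hx.trans_le ht.1
    rw [e1]
    have := intervalIntegral.norm_integral_le_of_norm_le (f := fun r => f r * (r ^ N * ξ r)) hxy.le
      (g := fun r => D / ε * |p ε r ^ 2 - W (w ε r)|) (ae_of_all _ fun t ht => ?_)
      (hcξ.const_mul (D / ε))
    · refine this.trans ?_
      rw [intervalIntegral.integral_const_mul]
      calc D / ε * ∫ r in x..y, |p ε r ^ 2 - W (w ε r)|
          ≤ D / ε * ((τ₂ + K₂ * √ε) * ε) := by
            gcongr
            exact (hquant (hε.profile (x / 2) (y + 1) (by linarith) (by linarith))).1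
        _ = _ := by field_simp
    · rw [← mul_assoc, norm_mul, hξ, Real.norm_eq_abs (_ / ε), abs_div, abs_of_pos hε0,
        div_mul_eq_mul_div, mul_div_assoc]
      gcongr
      exact hD t ⟨ht.1.le, ht.2⟩
  have h3 : τ * C ≤ η / 4 := by
    rw [hτ, div_mul_eq_mul_div, div_le_div_iff₀ (by positivity) (by positivity)]
    nlinarith
  have h4 : D * (τ₂ + K₂ * √ε) ≤ η / 4 := by
    calc D * (τ₂ + K₂ * √ε) ≤ D * (τ₂ + τ₂) := by gcongr
      _ ≤ η / 4 := by
        rw [hτ₂, ← two_mul, ← mul_assoc, mul_div_assoc',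
          div_le_div_iff₀ (by positivity) (by positivity)]
        nlinarith
  rw [Real.dist_eq, sub_zero]
  have h5 := abs_sub_abs_le_abs_sub (∫ r in Ioi (0 : ℝ), g r * (r ^ N * ξ r))
    (∫ r in Ioi (0 : ℝ), f r * (r ^ N * ξ r))
  linarith

/-- Along a subsequence, the profiles are close to the wells almost everywhere. -/
theorem IsDoubleWell.exists_subseq_tendsto_ae (hW : IsDoubleWell W a b) {ε : ℕ → ℝ}
    (hε : Tendsto ε atTop (𝓝 0)) {w p H : ℕ → ℝ → ℝ}
    (h : ∀ k, IsGlobalProfile W m M K N C (ε k) (w k) (p k) (H k)) :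
    ∃ s : ℕ → ℕ, StrictMono s ∧ ∀ᵐ r ∂(volume.restrict (Ioi (0 : ℝ))),
      Tendsto (fun k => W (w (s k) r)) atTop (𝓝 0) := by
  set f : ℕ → ℝ → ℝ := fun k r => r ^ N * W (w k r) with hf
  have hfm : ∀ k, AEStronglyMeasurable (f k) (volume.restrict (Ioi (0 : ℝ))) := fun k =>
    (((continuous_pow N).continuousOn).mul (hW.contDiff.continuous.comp_continuousOn
      (h k).cont_w)).aestronglyMeasurable measurableSet_Ioi
  have hlim : Tendsto (fun k => eLpNorm (f k - 0) 1 (volume.restrict (Ioi (0 : ℝ)))) atTop (𝓝 0) := by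
    have h1 : ∀ k, eLpNorm (f k - 0) 1 (volume.restrict (Ioi (0 : ℝ))) ≤ ENNReal.ofReal (ε k * C) := by
      intro k
      have hε0 := (h k).eps_pos
      rw [sub_zero, eLpNorm_one_eq_lintegral_enorm]
      calc ∫⁻ r in Ioi 0, ‖f k r‖ₑ
          ≤ ∫⁻ r in Ioi 0, ENNReal.ofReal
              (ε k * (r ^ N * ((p k r ^ 2 + W (w k r)) / ε k))) := by
            refine setLIntegral_mono_ae' measurableSet_Ioi (ae_of_all _ fun r hr => ?_)
            have hr0 : (0 : ℝ) < r := hr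
            have h2 := hW.nonneg (w k r)
            have h3 : 0 ≤ f k r := mul_nonneg (pow_nonneg hr0.le _) h2
            rw [Real.enorm_eq_ofReal h3]
            refine ENNReal.ofReal_le_ofReal ?_
            have h4 : ε k * (r ^ N * ((p k r ^ 2 + W (w k r)) / ε k))
                = r ^ N * (p k r ^ 2 + W (w k r)) := by field_simp
            rw [h4]
            exact mul_le_mul_of_nonneg_left (by linarith [sq_nonneg (p k r)]) (pow_nonneg hr0.le _)
        _ = ENNReal.ofReal (∫ r in Ioi 0, ε k * (r ^ N * ((p k r ^ 2 + W (w k r)) / ε k))) := by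
            rw [ofReal_integral_eq_lintegral_ofReal ((h k).integrable.const_mul _)]
            exact (ae_restrict_iff' measurableSet_Ioi).2 (ae_of_all _ fun r hr =>
              mul_nonneg hε0.le (mul_nonneg (pow_nonneg (le_of_lt hr) _)
                ((h k).density_nonneg hW r)))
        _ ≤ _ := by
            rw [integral_const_mul]
            exact ENNReal.ofReal_le_ofReal (mul_le_mul_of_nonneg_left (h k).mass_le hε0.le)
    have h2 : Tendsto (fun k => ENNReal.ofReal (ε k * C)) atTop (𝓝 0) := by
      have := ENNReal.tendsto_ofReal (hε.mul_const C)
      simpa using this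
    exact tendsto_of_tendsto_of_tendsto_of_le_of_le tendsto_const_nhds h2 (fun _ => zero_le) h1
  obtain ⟨s, hs, hs'⟩ := (tendstoInMeasure_of_tendsto_eLpNorm one_ne_zero hfm
    aestronglyMeasurable_zero hlim).exists_seq_tendsto_ae
  refine ⟨s, hs, ?_⟩
  filter_upwards [hs', ae_restrict_mem measurableSet_Ioi] with r hr hr0
  have h1 : r ^ N ≠ 0 := (pow_pos hr0 N).ne'
  have h2 := hr.const_mul (r ^ N)⁻¹
  simp only [hf, inv_mul_cancel_left₀ h1, Pi.zero_apply, mul_zero] at h2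
  exact h2

/-- A property that holds almost everywhere on `(0, ∞)` holds along a dense sequence. -/
theorem exists_dense_seq_of_ae {P : ℝ → Prop} (h : ∀ᵐ r ∂(volume.restrict (Ioi (0 : ℝ))), P r) :
    ∃ q : ℕ → ℝ, (∀ i, 0 < q i) ∧ (∀ i, P (q i)) ∧
      ∀ x y, 0 < x → x < y → ∃ i, x < q i ∧ q i < y := by
  have hex : ∀ x y : ℝ, 0 < x → x < y → ∃ z, P z ∧ x < z ∧ z < y := fun x y hx hxy => by
    obtain ⟨z, hz, hz'⟩ := (Measure.dense_of_ae
      ((ae_restrict_iff' measurableSet_Ioi).1 h)).exists_between hxy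
    exact ⟨z, hz (hx.trans hz'.1), hz'⟩
  have hsel : ∀ z : ℚ × ℚ, ∃ t : ℝ, 0 < t ∧ P t ∧
      ((0 : ℝ) < z.1 → (z.1 : ℝ) < z.2 → (z.1 : ℝ) < t ∧ t < z.2) := fun z => by
    by_cases hz : (0 : ℝ) < z.1 ∧ (z.1 : ℝ) < z.2
    · obtain ⟨t, ht, ht1, ht2⟩ := hex _ _ hz.1 hz.2
      exact ⟨t, hz.1.trans ht1, ht, fun _ _ => ⟨ht1, ht2⟩⟩
    · obtain ⟨t, ht, ht1, -⟩ := hex 1 2 one_pos one_lt_two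
      exact ⟨t, one_pos.trans ht1, ht, fun h1 h2 => absurd ⟨h1, h2⟩ hz⟩
  choose q hq using hsel
  obtain ⟨e, he⟩ := exists_surjective_nat (ℚ × ℚ)
  refine ⟨fun i => q (e i), fun i => (hq _).1, fun i => (hq _).2.1, fun x y hx hxy => ?_⟩
  obtain ⟨z₁, h1, h1'⟩ := exists_rat_btwn hxy
  obtain ⟨z₂, h2, h2'⟩ := exists_rat_btwn h1'
  obtain ⟨i, hi⟩ := he (z₁, z₂)
  obtain ⟨h3, h4⟩ := (hq (z₁, z₂)).2.2 (hx.trans h1) h2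
  exact ⟨i, by simpa only [hi] using h1.trans h3, by simpa only [hi] using h4.trans h2'⟩

/-- The mass between two points at which the profiles converge to the wells has integer limits. -/
theorem IsDoubleWell.exists_int_of_tendsto (hW : IsDoubleWell W a b) {ε : ℕ → ℝ}
    (hε : Tendsto ε atTop (𝓝 0)) {w p H : ℕ → ℝ → ℝ}
    (h : ∀ k, IsGlobalProfile W m M K N C (ε k) (w k) (p k) (H k)) {r s c : ℝ} (hr : 0 < r)
    (hrs : r ≤ s) (hwr : Tendsto (fun k => W (w k r)) atTop (𝓝 0))
    (hws : Tendsto (fun k => W (w k s)) atTop (𝓝 0))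
    (hc : Tendsto (fun k => ∫ t in r..s,
      (surfaceTension W a b)⁻¹ * ((p k t ^ 2 + W (w k t)) / ε k)) atTop (𝓝 c)) :
    ∃ j : ℤ, c = j := by
  have hmem : c ∈ closure (range ((↑) : ℤ → ℝ)) := by
    rw [Metric.mem_closure_iff]
    intro η hη
    have hprof := (h 0).profile (r / 2) (s + 2) (by linarith) (by linarith)
    obtain ⟨K₂, hK₂, δ, hδ, hquant⟩ := hW.exists_quantization (A := r / 2) (A' := r) (B' := s + 1)
      (B := s + 2) (by linarith) (by linarith) (by linarith) (hprof.curv_nonneg (by linarith))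
      (hprof.const_nonneg (by linarith) hW) (τ := η / 4) (by positivity)
    have hsmall : ∀ᶠ k in atTop, K₂ * √(ε k) < η / 4 := by
      have h1 : Tendsto (fun ε : ℝ => K₂ * √ε) (𝓝 0) (𝓝 (K₂ * √0)) :=
        (Continuous.tendsto (by fun_prop) 0)
      rw [Real.sqrt_zero, mul_zero] at h1
      exact (h1.comp hε).eventually (gt_mem_nhds (by positivity))
    obtain ⟨k, hk1, hk2, hk3, hk4⟩ := (hsmall.and ((hwr.eventually (gt_mem_nhds hδ)).and
      ((hws.eventually (gt_mem_nhds hδ)).and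
        (hc.eventually (Metric.ball_mem_nhds c (show 0 < η / 4 by positivity)))))).exists
    obtain ⟨j, hj⟩ := (hquant ((h k).profile (r / 2) (s + 2) (by linarith) (by linarith))).2 r s
      le_rfl hrs (by linarith) hk2 hk3
    refine ⟨j, mem_range_self j, ?_⟩
    have e1 : ∫ t in r..s, (surfaceTension W a b)⁻¹ * ((p k t ^ 2 + W (w k t)) / ε k)
        = (∫ t in r..s, (p k t ^ 2 + W (w k t))) / (ε k * surfaceTension W a b) := by
      rw [intervalIntegral.integral_const_mul, intervalIntegral.integral_div]
      field_simp
    rw [e1, Real.dist_eq, abs_sub_comm] at hk4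
    rw [Real.dist_eq]
    calc |c - j| ≤ |c - (∫ t in r..s, (p k t ^ 2 + W (w k t))) / (ε k * surfaceTension W a b)|
          + |(∫ t in r..s, (p k t ^ 2 + W (w k t))) / (ε k * surfaceTension W a b) - j| :=
          abs_sub_le _ _ _
      _ < η := by linarith
  rw [Int.isClosedEmbedding_coe_real.isClosed_range.closure_eq] at hmem
  obtain ⟨j, hj⟩ := hmem
  exact ⟨j, hj.symm⟩

/-- Compactness: along a subsequence the normalized energy densities have an integer limit. -/
theorem IsDoubleWell.exists_hasIntegerLimit (hW : IsDoubleWell W a b) {ε : ℕ → ℝ}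
    (hε : Tendsto ε atTop (𝓝 0)) {w p H : ℕ → ℝ → ℝ}
    (h : ∀ k, IsGlobalProfile W m M K N C (ε k) (w k) (p k) (H k)) :
    ∃ s : ℕ → ℕ, StrictMono s ∧ ∃ q F, HasIntegerLimit N ((surfaceTension W a b)⁻¹ * C)
      (fun k t => (surfaceTension W a b)⁻¹ * ((p (s k) t ^ 2 + W (w (s k) t)) / ε (s k))) q F := by
  have hσ := integral_sqrt_pos hW
  set σ := surfaceTension W a b with hσdef
  obtain ⟨s₁, hs₁, hae⟩ := hW.exists_subseq_tendsto_ae hε h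
  obtain ⟨q, hq0, hqP, hqd⟩ := exists_dense_seq_of_ae hae
  set e : ℕ → ℝ → ℝ := fun k t => σ⁻¹ * ((p k t ^ 2 + W (w k t)) / ε k) with he
  have he0 : ∀ k t, 0 ≤ e k t := fun k t =>
    mul_nonneg (inv_nonneg.2 hσ.le) ((h k).density_nonneg hW t)
  -- the masses between the points of the dense sequence are bounded
  set R : ℕ → ℝ := fun i => σ⁻¹ * (((min (q 0) (q i)) ^ N)⁻¹ * C) with hR
  have hbd : ∀ k i, (∫ t in q 0..q i, e k t) ∈ Icc (-R i) (R i) := fun k i => by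
    rw [mem_Icc, ← abs_le, intervalIntegral.abs_integral_eq_abs_integral_uIoc, uIoc,
      ← intervalIntegral.integral_of_le min_le_max,
      abs_of_nonneg (intervalIntegral.integral_nonneg min_le_max fun t _ => he0 k t),
      intervalIntegral.integral_const_mul]
    exact mul_le_mul_of_nonneg_left
      ((h k).integral_density_le hW (lt_min (hq0 0) (hq0 i)) min_le_max) (inv_nonneg.2 hσ.le)
  obtain ⟨c, -, s₂, hs₂, hc⟩ := (isCompact_univ_pi fun i => isCompact_Icc (a := -R i) (b := R i)).tendsto_subseq
    (x := fun k i => ∫ t in q 0..q i, e (s₁ k) t) fun k i _ => hbd _ i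
  have hsm : StrictMono (s₁ ∘ s₂) := hs₁.comp hs₂
  have hεs : Tendsto (ε ∘ s₁ ∘ s₂) atTop (𝓝 0) := hε.comp hsm.tendsto_atTop
  have hci : ∀ i, Tendsto (fun k => ∫ t in q 0..q i, e (s₁ (s₂ k)) t) atTop (𝓝 (c i)) := fun i =>
    (tendsto_pi_nhds.1 hc i)
  have hwi : ∀ i, Tendsto (fun k => W (w (s₁ (s₂ k)) (q i))) atTop (𝓝 0) := fun i =>
    (hqP i).comp hs₂.tendsto_atTop
  have hint : ∀ i, ∃ j : ℤ, c i = j := fun i => by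
    rcases le_total (q 0) (q i) with h0 | h0
    · exact hW.exists_int_of_tendsto hεs (fun k => h (s₁ (s₂ k))) (hq0 0) h0 (hwi 0) (hwi i) (hci i)
    · have hneg : Tendsto (fun k => ∫ t in q i..q 0, e (s₁ (s₂ k)) t) atTop (𝓝 (-c i)) := by
        refine (hci i).neg.congr fun k => ?_
        rw [intervalIntegral.integral_symm, neg_neg]
      obtain ⟨j, hj⟩ := hW.exists_int_of_tendsto hεs (fun k => h (s₁ (s₂ k))) (hq0 i) h0 (hwi i)
        (hwi 0) hneg
      exact ⟨-j, by push_cast; linarith⟩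
  choose F hF using hint
  have hmul : ∀ k, (fun t => t ^ N * e k t)
      = fun t => σ⁻¹ * (t ^ N * ((p k t ^ 2 + W (w k t)) / ε k)) := fun k => by
    funext t; simp only [he]; ring
  refine ⟨s₁ ∘ s₂, hsm, q, F, hq0, hqd, fun k => ?_, fun k t => he0 _ t, fun k => ?_, fun k => ?_,
    fun i => ?_⟩
  · exact continuousOn_const.mul ((h _).continuousOn_density hW)
  · have := (h (s₁ (s₂ k))).integrable.const_mul σ⁻¹
    rwa [← hmul] at this
  · have := mul_le_mul_of_nonneg_left (h (s₁ (s₂ k))).mass_le (inv_nonneg.2 hσ.le)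
    rwa [← integral_const_mul, ← hmul] at this
  · rw [← hF i]
    exact hci i

end AllenCahn

namespace AllenCahn

/-! ### Test functions in `C₀(ℝⁿ \ {0})` -/

variable {n : ℕ}

/-- The extension by zero of a test function to `ℝⁿ`. -/
noncomputable def extendByZero (φ : C₀(Punctured n, ℝ)) : Space n → ℝ :=
  Function.extend ((↑) : Punctured n → Space n) φ 0

@[simp]
theorem extendByZero_coe (φ : C₀(Punctured n, ℝ)) (x : Punctured n) : extendByZero φ x = φ x :=
  Subtype.val_injective.extend_apply _ _ _

theorem extendByZero_zero (φ : C₀(Punctured n, ℝ)) : extendByZero φ 0 = 0 :=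
  Function.extend_apply' _ _ _ (by rintro ⟨x, hx⟩; exact x.2 hx)

theorem exists_isCompact_extendByZero (φ : C₀(Punctured n, ℝ)) {η : ℝ} (hη : 0 < η) :
    ∃ K : Set (Space n), IsCompact K ∧ (0 : Space n) ∉ K ∧ ∀ x ∉ K, |extendByZero φ x| < η := by
  have h1 : ∀ᶠ x in cocompact (Punctured n), φ x ∈ Metric.ball 0 η :=
    (zero_at_infty φ).eventually (Metric.ball_mem_nhds 0 hη)
  obtain ⟨K, hK, hK'⟩ := mem_cocompact.1 h1
  refine ⟨(↑) '' K, hK.image continuous_subtype_val, ?_, fun x hx => ?_⟩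
  · rintro ⟨x, -, hx⟩
    exact x.2 hx
  · rcases eq_or_ne x 0 with rfl | hx0
    · rw [extendByZero_zero, abs_zero]; exact hη
    · have h2 := hK' (a := ⟨x, hx0⟩) fun h => hx ⟨_, h, rfl⟩
      have h3 := extendByZero_coe φ ⟨x, hx0⟩
      simp only at h3
      rw [h3]
      simpa using h2

theorem continuous_extendByZero (φ : C₀(Punctured n, ℝ)) : Continuous (extendByZero φ) := by
  rw [continuous_iff_continuousAt]
  intro x
  rcases eq_or_ne x 0 with rfl | hx
  · rw [ContinuousAt, extendByZero_zero, Metric.tendsto_nhds]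
    intro η hη
    obtain ⟨K, hK, hK0, hKη⟩ := exists_isCompact_extendByZero φ hη
    filter_upwards [hK.isClosed.isOpen_compl.mem_nhds hK0] with x hx
    rw [Real.dist_eq, sub_zero]
    exact hKη x hx
  · have hopen : IsOpen ({0}ᶜ : Set (Space n)) := isOpen_compl_singleton
    have h1 := hopen.isOpenEmbedding_subtypeVal.continuousAt_iff (g := extendByZero φ)
      (x := (⟨x, hx⟩ : Punctured n))
    refine h1.1 ?_
    have h2 : extendByZero φ ∘ Subtype.val = φ := funext fun x => extendByZero_coe φ x
    rw [h2]
    exact (map_continuous φ).continuousAt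

theorem tendsto_extendByZero (φ : C₀(Punctured n, ℝ)) :
    Tendsto (extendByZero φ) (cocompact (Space n)) (𝓝 0) := by
  rw [Metric.tendsto_nhds]
  intro η hη
  obtain ⟨K, hK, -, hKη⟩ := exists_isCompact_extendByZero φ hη
  filter_upwards [hK.compl_mem_cocompact] with x hx
  rw [Real.dist_eq, sub_zero]
  exact hKη x hx

theorem exists_bound_extendByZero (φ : C₀(Punctured n, ℝ)) : ∃ B, ∀ x, |extendByZero φ x| ≤ B := by
  obtain ⟨K, hK, -, hKη⟩ := exists_isCompact_extendByZero φ one_pos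
  obtain ⟨B, hB⟩ := hK.exists_bound_of_continuousOn (continuous_extendByZero φ).continuousOn
  refine ⟨max 1 B, fun x => ?_⟩
  by_cases hx : x ∈ K
  · exact (hB x hx).trans (le_max_right _ _)
  · exact (hKη x hx).le.trans (le_max_left _ _)

theorem integral_comap_eq (φ : C₀(Punctured n, ℝ)) (m : Measure (Space n)) :
    ∫ x, φ x ∂(m.comap ((↑) : Punctured n → Space n)) = ∫ x, extendByZero φ x ∂m := by
  have h1 := integral_subtype_comap (μ := m) (measurableSet_singleton (0 : Space n)).compl
    (extendByZero φ)
  simp only [extendByZero_coe] at h1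
  rw [h1]
  refine setIntegral_eq_integral_of_forall_compl_eq_zero fun x hx => ?_
  rw [notMem_compl_iff, mem_singleton_iff] at hx
  rw [hx, extendByZero_zero]

theorem integrable_comap (φ : C₀(Punctured n, ℝ)) {m : Measure (Space n)}
    (h : Integrable (extendByZero φ) m) :
    Integrable φ (m.comap ((↑) : Punctured n → Space n)) := by
  have h1 := (integrableOn_iff_comap_subtypeVal (measurableSet_singleton (0 : Space n)).compl).1
    h.integrableOn
  have h2 : extendByZero φ ∘ Subtype.val = φ := funext fun x => extendByZero_coe φ x
  rwa [h2] at h1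

theorem integral_comap_mul_eq [Nontrivial (Space n)] (φ : C₀(Punctured n, ℝ)) (f : Space n → ℝ) :
    ∫ x, φ x * f x ∂((volume : Measure (Space n)).comap ((↑) : Punctured n → Space n))
      = ∫ x, extendByZero φ x * f x := by
  have h1 := integral_subtype_comap (μ := volume) (measurableSet_singleton (0 : Space n)).compl
    (fun x => extendByZero φ x * f x)
  simp only [extendByZero_coe, restrict_compl_singleton] at h1
  exact h1

/-- The spherical means of a test function are continuous and vanish at `0` and at infinity. -/
theorem sphereIntegral_extendByZero (φ : C₀(Punctured n, ℝ)) :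
    Continuous (sphereIntegral volume (extendByZero φ)) ∧
    sphereIntegral volume (extendByZero φ) 0 = 0 ∧
    Tendsto (sphereIntegral volume (extendByZero φ)) atTop (𝓝 0) := by
  refine ⟨?_, ?_, ?_⟩
  · have hc : Continuous (Function.uncurry fun (r : ℝ) (θ : Metric.sphere (0 : Space n) 1) =>
        extendByZero φ (r • (θ : Space n))) :=
      (continuous_extendByZero φ).comp (by fun_prop)
    have := continuous_parametric_integral_of_continuous
      (μ := (volume : Measure (Space n)).toSphere) hc isCompact_univ
    simpa only [setIntegral_univ] using! this
  · simp [sphereIntegral, extendByZero_zero]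
  · rw [Metric.tendsto_nhds]
    intro η hη
    set A := (volume : Measure (Space n)).toSphere.real univ with hA
    have hA0 : 0 ≤ A := measureReal_nonneg
    have h1 : ∀ᶠ x in Bornology.cobounded (Space n), |extendByZero φ x| < η / (A + 1) := by
      have := (tendsto_extendByZero φ).abs
      rw [abs_zero, ← Metric.cobounded_eq_cocompact] at this
      exact this.eventually (gt_mem_nhds (by positivity))
    obtain ⟨R, -, hR⟩ := hasBasis_cobounded_norm.eventually_iff.1 h1
    filter_upwards [eventually_ge_atTop (max R 0)] with r hr
    have hr0 : 0 ≤ r := (le_max_right _ _).trans hr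
    have h2 : ∀ θ : Metric.sphere (0 : Space n) 1, ‖extendByZero φ (r • (θ : Space n))‖ ≤ η / (A + 1) :=
      fun θ => (hR (by simpa [norm_smul, abs_of_nonneg hr0] using (le_max_left _ _).trans hr)).le
    have h3 := norm_integral_le_of_norm_le_const (μ := (volume : Measure (Space n)).toSphere)
      (ae_of_all _ h2)
    rw [Real.dist_eq, sub_zero]
    refine lt_of_le_of_lt h3 ?_
    rw [← hA, div_mul_eq_mul_div, div_lt_iff₀ (by positivity)]
    nlinarith

/-- Integration over a sphere. -/
theorem integral_hausdorff_sphere [Nontrivial (Space n)] (φ : C₀(Punctured n, ℝ)) {r : ℝ}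
    (hr : 0 < r) :
    Integrable (extendByZero φ)
      ((Measure.euclideanHausdorffMeasure (n - 1)).restrict (Metric.sphere (0 : Space n) r)) ∧
    (∫ x in Metric.sphere (0 : Space n) r, extendByZero φ x ∂(Measure.euclideanHausdorffMeasure (n - 1))
      = sphereIntegral volume (extendByZero φ) r * r ^ (n - 1)) ∧
    (∀ B, (∀ x, |extendByZero φ x| ≤ B) →
      ∫ x in Metric.sphere (0 : Space n) r, ‖extendByZero φ x‖
        ∂(Measure.euclideanHausdorffMeasure (n - 1)) ≤ B * sphereArea n * r ^ (n - 1)) := by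
  have h0 := euclideanHausdorffMeasure_restrict_sphere (E := Space n) hr Module.finrank_pos
  rw [finrank_euclideanSpace_fin] at h0
  have hΦ := continuous_extendByZero φ
  have hm : AEMeasurable (fun θ : Metric.sphere (0 : Space n) 1 => r • (θ : Space n))
      (volume : Measure (Space n)).toSphere := by fun_prop
  have hc : Continuous fun θ : Metric.sphere (0 : Space n) 1 => extendByZero φ (r • (θ : Space n)) :=
    hΦ.comp (by fun_prop)
  have hrn : 0 ≤ r ^ (n - 1) := by positivity
  rw [h0]
  refine ⟨Integrable.smul_measure ?_ ENNReal.ofReal_ne_top, ?_, fun B hB => ?_⟩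
  · rw [integrable_map_measure hΦ.aestronglyMeasurable hm]
    exact hc.integrable_of_hasCompactSupport (HasCompactSupport.of_compactSpace _)
  · rw [integral_smul_measure, integral_map hm hΦ.aestronglyMeasurable, ENNReal.toReal_ofReal hrn,
      smul_eq_mul, mul_comm]
    rfl
  · rw [integral_smul_measure, integral_map hm hΦ.norm.aestronglyMeasurable,
      ENNReal.toReal_ofReal hrn, smul_eq_mul, mul_comm]
    refine mul_le_mul_of_nonneg_right ?_ hrn
    have := norm_integral_le_of_norm_le_const (μ := (volume : Measure (Space n)).toSphere)
      (f := fun θ : Metric.sphere (0 : Space n) 1 => ‖extendByZero φ (r • (θ : Space n))‖) (C := B)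
      (ae_of_all _ fun θ => by rw [norm_norm]; exact hB _)
    exact (le_abs_self _).trans this

theorem integral_sphereSum [Nontrivial (Space n)] {I : Type} [Countable I] {r : I → ℝ}
    (hr : ∀ i, 0 < r i) (hs : Summable fun i => r i ^ (n - 1)) (φ : C₀(Punctured n, ℝ)) :
    Integrable (extendByZero φ) (sphereSum r : Measure (Space n)) ∧
    ∫ x, extendByZero φ x ∂(sphereSum r : Measure (Space n))
      = ∑' i, sphereIntegral volume (extendByZero φ) (r i) * r i ^ (n - 1) := by
  obtain ⟨B, hB⟩ := exists_bound_extendByZero φ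
  have hi : Integrable (extendByZero φ) (sphereSum r : Measure (Space n)) := by
    refine integrable_sum_measure (fun i => (integral_hausdorff_sphere φ (hr i)).1) ?_
    refine Summable.of_nonneg_of_le (fun i => integral_nonneg fun x => norm_nonneg _)
      (fun i => (integral_hausdorff_sphere φ (hr i)).2.2 B hB) (hs.mul_left _)
  refine ⟨hi, ?_⟩
  rw [sphereSum] at hi ⊢
  rw [integral_sum_measure hi]
  exact tsum_congr fun i => (integral_hausdorff_sphere φ (hr i)).2.1

/-! ### Passage to the limit -/

variable {W : ℝ → ℝ} {a b ε C : ℝ} {u : Space n → ℝ} {w w' L : ℝ → ℝ}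

theorem IsRadialProfile.isGlobalProfile [Nontrivial (Space n)] {q : ℝ≥0∞}
    (hu : MemSobolevLoc q 2 u) (h : IsRadialProfile u w w' L) (hW : IsDoubleWell W a b)
    (hε : 0 < ε) (hε1 : ε ≤ 1) (hC : 0 ≤ C)
    (hEG : energy W ε u + willmore W ε u ≤ ENNReal.ofReal C) :
    IsGlobalProfile W (fun r => (n - 1) / r) (fun A => (n - 1) / A) (profileConst n C) (n - 1)
      ((sphereArea n)⁻¹ * C) ε w (fun r => ε * w' r)
      (fun r => 2 * ε * L r - deriv W (w r) / ε) := by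
  obtain ⟨-, h2, h3, h4⟩ := h.energy_bound hW hε hC (le_self_add.trans hEG)
  refine ⟨h.continuousOn, continuousOn_const.mul h.continuousOn_deriv, h3, ?_,
    fun A B hA hAB => h.isProfile hu hW hε hε1 hC hEG hA hAB⟩
  rw [inv_mul_eq_div, le_div_iff₀ sphereArea_pos]
  linarith

theorem IsRadialProfile.integral_discrepancy [Nontrivial (Space n)] (h : IsRadialProfile u w w' L)
    (hW : IsDoubleWell W a b) (hε : 0 < ε) (hi : Integrable (energyDensity W ε u))
    (φ : C₀(Punctured n, ℝ)) :
    Integrable (discrepancyDensity W ε u) ∧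
    ∫ x, extendByZero φ x * discrepancyDensity W ε u x
      = ∫ r in Ioi (0 : ℝ), sphereIntegral volume (extendByZero φ) r
          * (r ^ (n - 1) * (((ε * w' r) ^ 2 - W (w r)) / ε)) := by
  obtain ⟨B, hB⟩ := exists_bound_extendByZero φ
  have hd : Integrable (discrepancyDensity W ε u) :=
    hi.mono' (h.aestronglyMeasurable_discrepancyDensity hW hε)
      (ae_of_all _ fun x => abs_discrepancyDensity_le hW hε x)
  have hφd : Integrable fun x => extendByZero φ x * discrepancyDensity W ε u x :=
    hd.bdd_mul (c := B) (continuous_extendByZero φ).aestronglyMeasurable (ae_of_all _ hB)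
  have hae : (fun x => extendByZero φ x * discrepancyDensity W ε u x) =ᵐ[volume]
      fun x => extendByZero φ x * (((ε * w' ‖x‖) ^ 2 - W (w ‖x‖)) / ε) :=
    (h.ae_discrepancyDensity (W := W) hε).mono fun x hx => by simp only [hx]
  refine ⟨hd, ?_⟩
  rw [integral_congr_ae hae, (integral_mul_norm (f := fun r => ((ε * w' r) ^ 2 - W (w r)) / ε)
    (hφd.congr hae)).2, finrank_euclideanSpace_fin]
  exact integral_congr_ae (ae_of_all _ fun r => mul_left_comm _ _ _)

theorem IsRadialProfile.integral_energyMeasure [Nontrivial (Space n)]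
    (h : IsRadialProfile u w w' L) (hW : IsDoubleWell W a b) (hε : 0 < ε)
    (hi : Integrable (energyDensity W ε u)) (φ : C₀(Punctured n, ℝ)) :
    Integrable (extendByZero φ) (energyMeasure W a b ε u) ∧
    ∫ x, extendByZero φ x ∂(energyMeasure W a b ε u)
      = ∫ r in Ioi (0 : ℝ), sphereIntegral volume (extendByZero φ) r
          * (r ^ (n - 1) * ((surfaceTension W a b)⁻¹ * (((ε * w' r) ^ 2 + W (w r)) / ε))) := by
  obtain ⟨B, hB⟩ := exists_bound_extendByZero φ
  have hσ := integral_sqrt_pos hW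
  set σ := surfaceTension W a b with hσdef
  have hnn : ∀ x, 0 ≤ σ⁻¹ * energyDensity W ε u x := fun x =>
    mul_nonneg (inv_nonneg.2 hσ.le) (energyDensity_nonneg hW hε x)
  have hm : AEMeasurable (fun x => ENNReal.ofReal (σ⁻¹ * energyDensity W ε u x)) volume :=
    ((h.aestronglyMeasurable_energyDensity hW hε).aemeasurable.const_mul _).ennreal_ofReal
  have hfin : ∀ᵐ x : Space n, ENNReal.ofReal (σ⁻¹ * energyDensity W ε u x) < ⊤ :=
    ae_of_all _ fun x => ENNReal.ofReal_lt_top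
  have hφe : Integrable fun x => extendByZero φ x * (σ⁻¹ * energyDensity W ε u x) :=
    (hi.const_mul _).bdd_mul (c := B) (continuous_extendByZero φ).aestronglyMeasurable
      (ae_of_all _ hB)
  have hcomm : ∀ x, (ENNReal.ofReal (σ⁻¹ * energyDensity W ε u x)).toReal • extendByZero φ x
      = extendByZero φ x * (σ⁻¹ * energyDensity W ε u x) := fun x => by
    rw [ENNReal.toReal_ofReal (hnn x), smul_eq_mul, mul_comm]
  have hae : (fun x => extendByZero φ x * (σ⁻¹ * energyDensity W ε u x)) =ᵐ[volume]
      fun x => extendByZero φ x * (σ⁻¹ * (((ε * w' ‖x‖) ^ 2 + W (w ‖x‖)) / ε)) :=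
    (h.ae_energyDensity (W := W) hε).mono fun x hx => by simp only [hx]
  refine ⟨?_, ?_⟩
  · rw [energyMeasure, integrable_withDensity_iff_integrable_smul₀' hm hfin]
    exact hφe.congr (.of_forall fun x => (hcomm x).symm)
  · rw [energyMeasure, integral_withDensity_eq_integral_toReal_smul₀ hm hfin,
      integral_congr_ae (.of_forall hcomm), integral_congr_ae hae,
      (integral_mul_norm (f := fun r => σ⁻¹ * (((ε * w' r) ^ 2 + W (w r)) / ε))
        (hφe.congr hae)).2, finrank_euclideanSpace_fin]
    exact integral_congr_ae (ae_of_all _ fun r => mul_left_comm _ _ _)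

end AllenCahn

theorem mainTheorem3 {n : ℕ} (hn : 2 ≤ n) (W : ℝ → ℝ) (a b : ℝ)
    (hW : AllenCahn.IsDoubleWell W a b)
    (u : ℝ → AllenCahn.Space n → ℝ)
    (hu21 : ∀ ε : ℝ, 0 < ε → AllenCahn.MemSobolevLoc 1 2 (u ε))
    (hu12 : ∀ ε : ℝ, 0 < ε → AllenCahn.MemSobolevLoc 2 1 (u ε))
    (hrad : ∀ ε : ℝ, 0 < ε → AllenCahn.IsRadial (u ε))
    (hbound : limsup (fun ε : ℝ => AllenCahn.energy W ε (u ε) + AllenCahn.willmore W ε (u ε))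
      (𝓝[>] (0 : ℝ)) < ⊤) :
    (∀ εs : ℕ → ℝ, (∀ k, 0 < εs k) → Tendsto εs atTop (𝓝 0) →
      ∃ (I : Type) (_ : Countable I) (r : I → ℝ),
        (∀ i, 0 < r i) ∧
        Summable (fun i => r i ^ (n - 1)) ∧
        ∃ s : ℕ → ℕ, StrictMono s ∧
          AllenCahn.WeakStarTendsto
            (fun k => AllenCahn.energyMeasure W a b (εs (s k)) (u (εs (s k)))) atTop
            (AllenCahn.sphereSum r)) ∧
    AllenCahn.DensityWeakStarTendstoZero
      (fun ε => AllenCahn.discrepancyDensity W ε (u ε)) (𝓝[>] (0 : ℝ)) := by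
  open AllenCahn in
  have hnt : Nontrivial (Space n) := Module.nontrivial_of_finrank_pos (R := ℝ) (by
    rw [finrank_euclideanSpace_fin]; omega)
  obtain ⟨c, hc, hc'⟩ := exists_between hbound
  have hC0 : (0 : ℝ) ≤ c.toReal := ENNReal.toReal_nonneg
  have hEG : ∀ᶠ ε in 𝓝[>] (0 : ℝ), (0 < ε ∧ ε ≤ 1) ∧
      energy W ε (u ε) + willmore W ε (u ε) ≤ ENNReal.ofReal c.toReal := by
    filter_upwards [eventually_lt_of_limsup_lt hc, Ioc_mem_nhdsGT (zero_lt_one' ℝ)] with ε h1 h2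
    rw [ENNReal.ofReal_toReal hc'.ne]
    exact ⟨h2, h1.le⟩
  have hex : ∀ ε : ℝ, ∃ w w' L, 0 < ε → IsRadialProfile (u ε) w w' L := fun ε => by
    by_cases hε : 0 < ε
    · obtain ⟨w, w', L, h⟩ := (hu21 ε hε).exists_isRadialProfile (hrad ε hε)
      exact ⟨w, w', L, fun _ => h⟩
    · exact ⟨0, 0, 0, fun h => absurd h hε⟩
  choose w w' L hw using hex
  have hprof : ∀ {ε : ℝ}, (0 < ε ∧ ε ≤ 1) ∧
      energy W ε (u ε) + willmore W ε (u ε) ≤ ENNReal.ofReal c.toReal →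
      IsGlobalProfile W (fun r => (n - 1) / r) (fun A => (n - 1) / A) (profileConst n c.toReal)
        (n - 1) ((sphereArea n)⁻¹ * c.toReal) ε (w ε) (fun r => ε * w' ε r)
        (fun r => 2 * ε * L ε r - deriv W (w ε r) / ε) := fun {ε} h =>
    (hw ε h.1.1).isGlobalProfile (hu21 ε h.1.1) hW h.1.1 h.1.2 hC0 h.2
  have hint : ∀ {ε : ℝ}, (0 < ε ∧ ε ≤ 1) ∧
      energy W ε (u ε) + willmore W ε (u ε) ≤ ENNReal.ofReal c.toReal →
      Integrable (energyDensity W ε (u ε)) := fun {ε} h =>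
    ((hw ε h.1.1).energy_bound hW h.1.1 hC0 (le_self_add.trans h.2)).1
  refine ⟨fun εs hpos hlim => ?_, ?_, fun φ => ?_⟩
  · -- the bounds hold along a tail of the sequence
    have hlim' : Tendsto εs atTop (𝓝[>] 0) :=
      tendsto_nhdsWithin_iff.2 ⟨hlim, .of_forall hpos⟩
    obtain ⟨k₀, hk₀⟩ := eventually_atTop.1 (hlim'.eventually hEG)
    have hk : ∀ k, _ := fun k => hk₀ (k + k₀) (Nat.le_add_left k₀ k)
    obtain ⟨s, hs, q, F, hF⟩ := hW.exists_hasIntegerLimit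
      (hlim.comp (tendsto_add_atTop_nat k₀)) fun k => hprof (hk k)
    refine ⟨jumpSet F, inferInstance, fun j => jumpRadius q F j, fun j => hF.jumpRadius_pos j.2,
      hF.summable_pow, fun k => s k + k₀, fun i j hij => Nat.add_lt_add_right (hs hij) k₀,
      fun φ => ?_⟩
    have hsph := integral_sphereSum (r := fun j : jumpSet F => jumpRadius q F j)
      (fun j => hF.jumpRadius_pos j.2) hF.summable_pow φ
    have hen := fun k => (hw _ (hk (s k)).1.1).integral_energyMeasure hW (hk (s k)).1.1
      (hint (hk (s k))) φ
    obtain ⟨hg, hg0, hginf⟩ := sphereIntegral_extendByZero φ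
    refine ⟨.of_forall fun k => integrable_comap φ (hen k).1, integrable_comap φ hsph.1, ?_⟩
    simp only [integral_comap_eq]
    rw [hsph.2]
    exact (hF.tendsto_integral_Ioi hg hg0 hginf).congr fun k => ((hen k).2).symm
  · filter_upwards [hEG] with ε hε
    exact ((hw ε hε.1.1).integral_discrepancy hW hε.1.1 (hint hε) 0).1
  · obtain ⟨hg, hg0, hginf⟩ := sphereIntegral_extendByZero φ
    refine (hW.tendsto_integral_discrepancy (hEG.mono fun ε hε => hprof hε) hg hg0 hginf).congr' ?_
    filter_upwards [hEG] with ε hε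
    rw [integral_comap_mul_eq, ((hw ε hε.1.1).integral_discrepancy hW hε.1.1 (hint hε) φ).2]
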